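/- **Setting.** Let $H$ be a complex Hilbert space and $B(H)$ its algebra of bounded operators. For $j=1,2$ let $X_j\in B(H)$ be a spectral operator: there is a strongly countably additive, idempotent-valued measure $E_j$ on the Borel subsets of $\mathbb C$, with $E_j(A\cap B)=E_j(A)E_j(B)$ and $E_j(\sigma(X_j))=I$, commuting with $X_j$, such that $$X_j=\int_{\sigma(X_j)}\lambda\,dE_j(\lambda)+\int_{\sigma(X_j)}(X_j-\lambda I)\,dE_j(\lambda),$$ where the second summand is quasinilpotent (for instance nilpotent). Let $m_j(\lambda)\in\mathbb N\cup\{\infty\}$ be the order of the nilpotent $(X_j-\lambda I)dE_j(\lambda)$ at $\lambda$, i.e. the least $q$ such that the operator measure $(X_j-\lambda I)^q dE_j(\lambda)$ vanishes in a neighbourhood of $\lambda$ ($\infty$ if there is none). Let $D\subseteq\mathbb C^2$ be open and connected, with $\sigma(X_1)\times\sigma(X_2)\subseteq D$, and let $\mathcal O(D)$ be the algebra of analytic functions on $D$. For a family $c=(c_{p,q})_{p,q\ge 0}$ of functions on $\sigma(X_1)\times\sigma(X_2)$ and $Y\in B(H)$ put $$I_c(Y)=\int_{\sigma(X_1)}\int_{\sigma(X_2)}\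 \sum_{0\le p<m_1(\lambda_1)}\ \sum_{0\le q<m_2(\lambda_2)} c_{p,q}(\lambda_1,\lambda_2)\,(X_1-\lambda_1I)^p\,dE_1(\lambda_1)\,Y\,(X_2-\lambda_2I)^q\,dE_2(\lambda_2),$$ where the sum over $p,q$ is taken outside: it is the norm-convergent sum over $(p,q)$ of the integrals over $\{m_1>p\}\times\{m_2>q\}$, each being the operator-norm limit of Riemann–Stieltjes sums over tagged finite Borel partitions as the mesh tends to $0$. For $\beta\in\mathcal O(D)$ let $c^\beta_{p,q}=\frac{1}{p!\,q!}\,\partial_1^p\partial_2^q\beta$ on $\sigma(X_1)\times\sigma(X_2)$, and let $T_\beta^{X_1,X_2}(Y)=I_{c^\beta}(Y)$ be the generalized double operator integral. Let $\mathcal S_{X_1,X_2,Y}(D)$ be the set of all operators $I_c(Y)$ whose coefficients $c$ equal $c^\beta$ for some $\beta\in\mathcal O(D)$, and let $\mathcal S_{X_1,X_2}(D)$ be the set of all linear maps $\Phi$ on $B(H)$ for which there is one such family $c$ with $\Phi(Y)=I_c(Y)\in\mathcal S_{X_1,X_2,Y}(D)$ for all $Y\in B(H)$. *Condition (A).* Whenever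 $\beta,\gamma\in\mathcal O(D)$ satisfy $\partial_1^p\partial_2^q\beta=\partial_1^p\partial_2^q\gamma$ at all $(\lambda_1,\lambda_2)\in\sigma(X_1)\times\sigma(X_2)$ for all $p<m_1(\lambda_1)$, $q<m_2(\lambda_2)$, there is a nonempty finite set $P\subseteq\sigma(X_1)\times\sigma(X_2)$ at whose points all partial derivatives, of all orders, of $\beta$ and $\gamma$ agree. **Theorem.** 1. For all $\beta\in\mathcal O(D)$ and $Y\in B(H)$ the integral defining $T_\beta^{X_1,X_2}(Y)$ converges to a unique operator. 2. For each $Y\in B(H)$, $\{T_\beta^{X_1,X_2}(Y):\beta\in\mathcal O(D)\}=\mathcal S_{X_1,X_2,Y}(D)$. 3. If condition (A) holds, then $\mathcal S_{X_1,X_2}(D)$ is a unital subalgebra of the algebra of linear maps on $B(H)$, and $\beta\mapsto T_\beta^{X_1,X_2}$ is a linear isomorphism of $\mathcal O(D)$ onto it, with moreover $T^{X_1,X_2}_{\beta\gamma}=T^{X_1,X_2}_\beta\circ T^{X_1,X_2}_\gamma$. 4. Condition (A) holds whenever both $\sigma(X_1)$ and $\sigma(X_2)$ are infinite, in particular for operators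 with continuous spectrum. -/

import Mathlib

open scoped Nat

noncomputable section

namespace GDOI

/-! ### Bivariate analytic functions on a domain -/

/-- `𝒪(D)`: the algebra of complex functions on `D ⊆ ℂ²` which are analytic on `D`. -/
def Holo (D : Set (ℂ × ℂ)) : Subalgebra ℂ (D → ℂ) where
  carrier := {f | ∃ g : ℂ × ℂ → ℂ, AnalyticOnNhd ℂ g D ∧ ∀ z : D, g z = f z}
  mul_mem' := by
    rintro f₁ f₂ ⟨g₁, h₁, e₁⟩ ⟨g₂, h₂, e₂⟩
    exact ⟨g₁ * g₂, h₁.mul h₂, fun z => by simp [e₁, e₂]⟩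
  add_mem' := by
    rintro f₁ f₂ ⟨g₁, h₁, e₁⟩ ⟨g₂, h₂, e₂⟩
    exact ⟨g₁ + g₂, h₁.add h₂, fun z => by simp [e₁, e₂]⟩
  algebraMap_mem' := fun r => ⟨fun _ => r, analyticOnNhd_const, fun z => by simp⟩

open Classical in
/-- Extension by zero outside `D`. It is used only at points of `D` (an open set). -/
def zeroExt {D : Set (ℂ × ℂ)} (β : Holo D) (z : ℂ × ℂ) : ℂ :=
  if h : z ∈ D then (β : D → ℂ) ⟨z, h⟩ else 0

/-- The mixed partial derivative `β^{(p,q)}(z₁, z₂)`; the order `0` means that one does not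
differentiate in that variable. -/
def partialDeriv {D : Set (ℂ × ℂ)} (β : Holo D) (p q : ℕ) (z₁ z₂ : ℂ) : ℂ :=
  iteratedDeriv p (fun z => iteratedDeriv q (fun w => zeroExt β (z, w)) z₂) z₁

/-! ### Riemann–Stieltjes integrals against operator-valued set functions -/

/-- A finite partition of `K ⊆ ℂ` into Borel cells, with a tag in each cell. -/
structure TaggedPartition (K : Set ℂ) where
  n : ℕ
  cell : Fin n → Set ℂ
  tag : Fin n → ℂ
  measurable_cell : ∀ i, MeasurableSet (cell i)
  disjoint_cell : Pairwise fun i j => Disjoint (cell i) (cell j)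
  iUnion_cell : ⋃ i, cell i = K
  tag_mem : ∀ i, tag i ∈ cell i

/-- All cells have diameter at most `δ`. -/
def TaggedPartition.FinerThan {K : Set ℂ} (π : TaggedPartition K) (δ : ℝ) : Prop :=
  ∀ i, ∀ z ∈ π.cell i, ∀ w ∈ π.cell i, dist z w ≤ δ

variable {H : Type*} [NormedAddCommGroup H] [InnerProductSpace ℂ H] [CompleteSpace H]

/-- `∫_{λ ∈ K} F(λ) dE(λ) = S`: the Riemann–Stieltjes sums `∑ᵢ F(λᵢ) E(Kᵢ)` converge to `S` in
operator norm as the mesh of the tagged partition of `K` tends to `0`. -/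
def HasSpectralIntegral (F : ℂ → H →L[ℂ] H) (E : Set ℂ → H →L[ℂ] H) (K : Set ℂ)
    (S : H →L[ℂ] H) : Prop :=
  ∀ ε > 0, ∃ δ > 0, ∀ π : TaggedPartition K, π.FinerThan δ →
    ‖(∑ i, F (π.tag i) * E (π.cell i)) - S‖ < ε

/-- `∫_{λ₁ ∈ K₁} ∫_{λ₂ ∈ K₂} c(λ₁, λ₂) F₁(λ₁) dE₁(λ₁) Y F₂(λ₂) dE₂(λ₂) = S`, again as a limit in
operator norm of Riemann–Stieltjes sums. -/
def HasDoubleSpectralIntegral (c : ℂ → ℂ → ℂ)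
    (F₁ : ℂ → H →L[ℂ] H) (E₁ : Set ℂ → H →L[ℂ] H) (K₁ : Set ℂ) (Y : H →L[ℂ] H)
    (F₂ : ℂ → H →L[ℂ] H) (E₂ : Set ℂ → H →L[ℂ] H) (K₂ : Set ℂ) (S : H →L[ℂ] H) : Prop :=
  ∀ ε > 0, ∃ δ > 0, ∀ (π₁ : TaggedPartition K₁) (π₂ : TaggedPartition K₂),
    π₁.FinerThan δ → π₂.FinerThan δ →
    ‖(∑ i, ∑ j, c (π₁.tag i) (π₂.tag j) •
        ((F₁ (π₁.tag i) * E₁ (π₁.cell i)) * Y * (F₂ (π₂.tag j) * E₂ (π₂.cell j)))) - S‖ < ε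

/-! ### Operators with a spectral decomposition -/

/-- `(X - λ I)^q`. -/
def shiftPow (X : H →L[ℂ] H) (q : ℕ) (l : ℂ) : H →L[ℂ] H :=
  (X - l • (1 : H →L[ℂ] H)) ^ q

/-- `E` is the (not necessarily self-adjoint) spectral measure of the bounded operator `X`, and
`X = ∫ λ dE(λ) + ∫ (X - λ I) dE(λ)` is its decomposition into the projection part and the
nilpotent part. The latter is only required to be quasinilpotent, that is, `X` is an arbitrary
bounded spectral operator in the sense of Dunford; this contains the case where it is nilpotent.
Only the values of `E` on Borel sets matter. -/
structure IsSpectralResolution (X : H →L[ℂ] H) (E : Set ℂ → H →L[ℂ] H) : Prop where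
  inter : ∀ A B, MeasurableSet A → MeasurableSet B → E (A ∩ B) = E A * E B
  spectrum_eq_one : E (spectrum ℂ X) = 1
  hasSum_iUnion : ∀ A : ℕ → Set ℂ, (∀ n, MeasurableSet (A n)) →
    (Pairwise fun m n => Disjoint (A m) (A n)) →
    ∀ x : H, HasSum (fun n => E (A n) x) (E (⋃ n, A n) x)
  commute : ∀ A, MeasurableSet A → Commute (E A) X
  decomposition : ∃ XP XN : H →L[ℂ] H,
    HasSpectralIntegral (fun l => l • (1 : H →L[ℂ] H)) E (spectrum ℂ X) XP ∧
    HasSpectralIntegral (fun l => X - l • (1 : H →L[ℂ] H)) E (spectrum ℂ X) XN ∧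
    X = XP + XN ∧ spectralRadius ℂ XN = 0

/-- The operator measure `(X - λ I)^q dE(λ)` vanishes in a neighbourhood of `l`. -/
def VanishesNear (X : H →L[ℂ] H) (E : Set ℂ → H →L[ℂ] H) (q : ℕ) (l : ℂ) : Prop :=
  ∃ U : Set ℂ, IsOpen U ∧ l ∈ U ∧ HasSpectralIntegral (shiftPow X q) E (U ∩ spectrum ℂ X) 0

/-- `m_l`: the order of the nilpotent `(X - λ I) dE(λ)` at `λ = l`, that is, the least `q` such that
`(X - λ I)^q dE(λ)` vanishes at `l` (`⊤` if there is none). -/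
def nilOrder (X : H →L[ℂ] H) (E : Set ℂ → H →L[ℂ] H) (l : ℂ) : ℕ∞ :=
  ⨅ q : {q : ℕ // VanishesNear X E q l}, ((q : ℕ) : ℕ∞)

/-- The points `l` of the spectrum with `q < m_l`, i.e. those at which the sum
`∑_{q < m_l}` has a term of index `q`. -/
def orderAbove (X : H →L[ℂ] H) (E : Set ℂ → H →L[ℂ] H) (q : ℕ) : Set ℂ :=
  {l | l ∈ spectrum ℂ X ∧ (q : ℕ∞) < nilOrder X E l}

/-! ### The generalized double operator integral -/

/-- `S` is the operator
`∫∫ ∑_{0 ≤ p < m_{λ₁}} ∑_{0 ≤ q < m_{λ₂}} c_{p,q}(λ₁,λ₂)`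
`(X₁ - λ₁ I)^p dE₁(λ₁) Y (X₂ - λ₂ I)^q dE₂(λ₂)`.
The indices `p = q = 0`; `p = 0 < q`; `q = 0 < p`; `0 < p, q` are the four groups of terms
projection–projection, projection–nilpotent, nilpotent–projection, nilpotent–nilpotent. -/
def HasCombination (X₁ : H →L[ℂ] H) (E₁ : Set ℂ → H →L[ℂ] H)
    (X₂ : H →L[ℂ] H) (E₂ : Set ℂ → H →L[ℂ] H)
    (c : ℕ → ℕ → ℂ → ℂ → ℂ) (Y S : H →L[ℂ] H) : Prop :=
  ∃ J : ℕ × ℕ → H →L[ℂ] H,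
    (∀ p q, HasDoubleSpectralIntegral (c p q)
      (shiftPow X₁ p) E₁ (orderAbove X₁ E₁ p) Y
      (shiftPow X₂ q) E₂ (orderAbove X₂ E₂ q) (J (p, q))) ∧
    HasSum J S

/-- The coefficients `β^{(p,q)}(λ₁,λ₂) / (p! q!)`. -/
def coeff {D : Set (ℂ × ℂ)} (β : Holo D) (p q : ℕ) (l₁ l₂ : ℂ) : ℂ :=
  partialDeriv β p q l₁ l₂ / ((p ! : ℂ) * (q ! : ℂ))

/-- The integral defining `T_β^{X₁,X₂}(Y)` exists and equals `S`. -/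
def HasGDOI (X₁ : H →L[ℂ] H) (E₁ : Set ℂ → H →L[ℂ] H)
    (X₂ : H →L[ℂ] H) (E₂ : Set ℂ → H →L[ℂ] H)
    {D : Set (ℂ × ℂ)} (β : Holo D) (Y S : H →L[ℂ] H) : Prop :=
  HasCombination X₁ E₁ X₂ E₂ (coeff β) Y S

open Classical in
/-- `T_β^{X₁,X₂}(Y)` (and `0` if the integral does not exist). -/
def gdoi (X₁ : H →L[ℂ] H) (E₁ : Set ℂ → H →L[ℂ] H)
    (X₂ : H →L[ℂ] H) (E₂ : Set ℂ → H →L[ℂ] H)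
    {D : Set (ℂ × ℂ)} (β : Holo D) (Y : H →L[ℂ] H) : H →L[ℂ] H :=
  if h : ∃ S, HasGDOI X₁ E₁ X₂ E₂ β Y S then h.choose else 0

/-- The coefficient family `c` is the one belonging to `β` on `σ(X₁) × σ(X₂)`. -/
def IsCoeffFamily (X₁ X₂ : H →L[ℂ] H) {D : Set (ℂ × ℂ)} (β : Holo D)
    (c : ℕ → ℕ → ℂ → ℂ → ℂ) : Prop :=
  ∀ p q, ∀ l₁ ∈ spectrum ℂ X₁, ∀ l₂ ∈ spectrum ℂ X₂,
    c p q l₁ l₂ = partialDeriv β p q l₁ l₂ / ((p ! : ℂ) * (q ! : ℂ))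

/-- The set `𝒮_{X₁,X₂,Y}(D)` of operators. -/
def operatorSet (X₁ : H →L[ℂ] H) (E₁ : Set ℂ → H →L[ℂ] H)
    (X₂ : H →L[ℂ] H) (E₂ : Set ℂ → H →L[ℂ] H) (D : Set (ℂ × ℂ)) (Y : H →L[ℂ] H) :
    Set (H →L[ℂ] H) :=
  {S | ∃ c, (∃ β : Holo D, IsCoeffFamily X₁ X₂ β c) ∧ HasCombination X₁ E₁ X₂ E₂ c Y S}

/-- The set of linear maps `Y ↦ Φ(Y)` whose value at each `Y` is the element of `𝒮_{X₁,X₂,Y}(D)`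
given by one and the same admissible family of coefficients. -/
def transformerSet (X₁ : H →L[ℂ] H) (E₁ : Set ℂ → H →L[ℂ] H)
    (X₂ : H →L[ℂ] H) (E₂ : Set ℂ → H →L[ℂ] H) (D : Set (ℂ × ℂ)) :
    Set (Module.End ℂ (H →L[ℂ] H)) :=
  {Φ | ∃ c, (∃ β : Holo D, IsCoeffFamily X₁ X₂ β c) ∧
    ∀ Y, HasCombination X₁ E₁ X₂ E₂ c Y (Φ Y)}

/-- The standing condition on the analytic functions on `D`: if the derivatives of `β` and `γ` of
all orders `(p, q)` with `p < m_{λ₁}`, `q < m_{λ₂}` agree on `σ(X₁) × σ(X₂)`, then there is a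
nonempty finite set of points of `σ(X₁) × σ(X₂)` at which their derivatives of all orders agree. -/
def DerivativeAgreementCondition (X₁ : H →L[ℂ] H) (E₁ : Set ℂ → H →L[ℂ] H)
    (X₂ : H →L[ℂ] H) (E₂ : Set ℂ → H →L[ℂ] H) (D : Set (ℂ × ℂ)) : Prop :=
  ∀ β γ : Holo D,
    (∀ l₁ ∈ spectrum ℂ X₁, ∀ l₂ ∈ spectrum ℂ X₂, ∀ p q : ℕ,
      (p : ℕ∞) < nilOrder X₁ E₁ l₁ → (q : ℕ∞) < nilOrder X₂ E₂ l₂ →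
      partialDeriv β p q l₁ l₂ = partialDeriv γ p q l₁ l₂) →
    ∃ P : Finset (ℂ × ℂ), P.Nonempty ∧ (P : Set (ℂ × ℂ)) ⊆ spectrum ℂ X₁ ×ˢ spectrum ℂ X₂ ∧
      ∀ z ∈ P, ∀ p q : ℕ, partialDeriv β p q z.1 z.2 = partialDeriv γ p q z.1 z.2

end GDOI

end

/-!
The proof rests on a local formula for the generalized double operator integral which does not
mention its limits. Let `X = S + N` be the decomposition of a spectral operator into its scalar and
its quasinilpotent part. Riemann sums against a spectral measure are multiplicative, because the
cells are disjoint (`sum_pow_smul_shiftPow_mul`). Hence the Riemann sums of `(λ - a)^k (X - λ)^p` over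
a set `P` converge to `N^p (S - a)^k E(P)`, and if `P` is contained in a small disc around `a`, then
these operators are geometrically small in `p` and `k`, uniformly in the partition.

Cover `σ(X₁) × σ(X₂)` by a grid of cells `P × Q` so small that `β` has a Taylor expansion around the
tag `(a, b)` of each cell on a much larger polydisc. Inserting this expansion of `∂₁^p ∂₂^q β` into the
double integrals, and passing to the limit under the sum by dominated convergence, gives the integral
over the cell as a power series in `N₁, S₁ - a` and `N₂, S₂ - b`. The truncation `p < m₁`, `q < m₂` is
invisible, because `N^p dE` vanishes off the set where the order exceeds `p`. Summation over `p, q`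
and the binomial theorem (`hasSum_binomial`) reassemble the powers of `N + (S - a) = X - a`, so that

`T_β(Y) = ∑_{cells} ∑_{m, n} β_{m,n}(a, b) (X₁ - a)^m E₁(P) Y (X₂ - b)^n E₂(Q)`

with the Taylor coefficients `β_{m,n}` (`IsGrid.hasCombination`, `IsGrid.gdoi_eq`). This settles
existence, and uniqueness holds since limits along fine partitions are unique. Multiplicativity of
`β ↦ T_β` is then the Cauchy product of series together with the Leibniz rule on each cell
(`localOp_mul_localOp`), as different cells do not interact.

For injectivity suppose `T_β = 0`. Compression to a cell which is a small disc around a given point of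
the spectrum shows that the local power series vanishes there. Testing on operators of rank one
separates the two variables, and in one variable a vanishing series `∑ dₙ (X - a)^n E(P) = 0` with
`d_l` as its first nonzero coefficient is `(X - a)^l` times an invertible series. So `(X - a)^l`, and
with it `N^l`, vanishes near `a`, which means `l ≥ m(a)` (`IsSpectralResolution.coeff_eq_zero`). The
passage from `X - a` to `N` uses that `X - a` is invertible on spectral subspaces away from `a`
(`isUnit_sub_mul_map_add`). Hence all derivatives of `β` of orders below `(m₁, m₂)` vanish on the
product of the spectra, and the agreement condition together with the identity theorem yields
`β = 0`.

If the spectra are infinite, they have accumulation points `a` and `b`, and the identity theorem in one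
variable, used in each variable in turn, shows that a function vanishing on `σ(X₁) × σ(X₂)` has all
derivatives zero at `(a, b)`.
-/

noncomputable section

namespace GDOI

open Filter Topology Set

set_option linter.unusedSectionVars false

section

variable {H : Type*} [NormedAddCommGroup H] [InnerProductSpace ℂ H] [CompleteSpace H]
variable {X : H →L[ℂ] H} {E : Set ℂ → H →L[ℂ] H}

/-! ### Spectral measures: additivity and boundedness -/

namespace IsSpectralResolution

theorem map_empty (h : IsSpectralResolution X E) : E ∅ = 0 := by
  ext x
  have hs := h.hasSum_iUnion (fun _ => ∅) (fun _ => MeasurableSet.empty) (fun _ _ _ => by simp) x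
  exact tendsto_nhds_unique tendsto_const_nhds (hs.summable.tendsto_atTop_zero)

/-- Finite additivity, from countable additivity applied to `A, B, ∅, ∅, …`. -/
theorem map_union (h : IsSpectralResolution X E) {A B : Set ℂ} (hA : MeasurableSet A)
    (hB : MeasurableSet B) (hAB : Disjoint A B) : E (A ∪ B) = E A + E B := by
  ext x
  let f : ℕ → Set ℂ := fun n => if n = 0 then A else if n = 1 then B else ∅
  have hf : ∀ n, MeasurableSet (f n) := fun n => by
    dsimp only [f]; split_ifs <;> simp [hA, hB]
  have hd : Pairwise fun m n => Disjoint (f m) (f n) := by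
    intro m n hmn
    dsimp only [f]
    split_ifs <;> first | omega | simp [hAB.symm]
  have hU : ⋃ n, f n = A ∪ B := by
    ext z
    simp only [mem_iUnion, mem_union]
    constructor
    · rintro ⟨n, hn⟩
      dsimp only [f] at hn
      split_ifs at hn
      · exact Or.inl hn
      · exact Or.inr hn
      · exact absurd hn (notMem_empty z)
    · rintro (hz | hz)
      · exact ⟨0, by simpa [f] using hz⟩
      · exact ⟨1, by simpa [f] using hz⟩
  have hs := h.hasSum_iUnion f hf hd x
  rw [hU] at hs
  have hs' : HasSum (fun n => E (f n) x) (∑ n ∈ Finset.range 2, E (f n) x) :=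
    hasSum_sum_of_ne_finset_zero fun n hn => by
      have : f n = ∅ := by
        simp only [Finset.mem_range, not_lt] at hn
        dsimp only [f]
        rw [if_neg (by omega), if_neg (by omega)]
      rw [this, h.map_empty]; rfl
  rw [hs.unique hs']
  simp [Finset.sum_range_succ, f]

theorem map_biUnion (h : IsSpectralResolution X E) {ι : Type*} (s : Finset ι) (A : ι → Set ℂ)
    (hA : ∀ i, MeasurableSet (A i)) (hd : Pairwise fun i j => Disjoint (A i) (A j)) :
    E (⋃ i ∈ s, A i) = ∑ i ∈ s, E (A i) := by
  classical
  induction s using Finset.induction_on with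
  | empty => simp [h.map_empty]
  | insert a s ha ih =>
    rw [Finset.set_biUnion_insert, h.map_union (hA a) (s.measurableSet_biUnion fun i _ => hA i),
      ih, Finset.sum_insert ha]
    refine disjoint_iUnion₂_right.2 fun i hi => hd ?_
    rintro rfl
    exact ha hi

theorem map_iUnion (h : IsSpectralResolution X E) {ι : Type*} [Fintype ι] (A : ι → Set ℂ)
    (hA : ∀ i, MeasurableSet (A i)) (hd : Pairwise fun i j => Disjoint (A i) (A j)) :
    E (⋃ i, A i) = ∑ i, E (A i) := by
  simpa using h.map_biUnion Finset.univ A hA hd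

theorem measurableSet_spectrum (X : H →L[ℂ] H) : MeasurableSet (spectrum ℂ X) :=
  (spectrum.isClosed X).measurableSet

theorem map_inter_spectrum (h : IsSpectralResolution X E) {A : Set ℂ} (hA : MeasurableSet A) :
    E (A ∩ spectrum ℂ X) = E A := by
  rw [h.inter _ _ hA (measurableSet_spectrum X), h.spectrum_eq_one, mul_one]

theorem mul_self (h : IsSpectralResolution X E) {A : Set ℂ} (hA : MeasurableSet A) :
    E A * E A = E A := by
  rw [← h.inter _ _ hA hA, inter_self]

theorem mul_eq_zero_of_disjoint (h : IsSpectralResolution X E) {A B : Set ℂ}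
    (hA : MeasurableSet A) (hB : MeasurableSet B) (hAB : Disjoint A B) : E A * E B = 0 := by
  rw [← h.inter _ _ hA hB, hAB.inter_eq, h.map_empty]

theorem commute_map (h : IsSpectralResolution X E) {A B : Set ℂ}
    (hA : MeasurableSet A) (hB : MeasurableSet B) : Commute (E A) (E B) := by
  rw [Commute, SemiconjBy, ← h.inter _ _ hA hB, ← h.inter _ _ hB hA, inter_comm]

open Classical in
/-- The `H`-valued vector measure `A ↦ E(A) x`. -/
def vectorMeasure (h : IsSpectralResolution X E) (x : H) : MeasureTheory.VectorMeasure ℂ H where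
  measureOf' A := if MeasurableSet A then E A x else 0
  empty' := by simp [h.map_empty]
  not_measurable' A hA := by simp [hA]
  m_iUnion' f hf hd := by
    simp only [hf, MeasurableSet.iUnion hf, if_true]
    exact h.hasSum_iUnion f hf hd x

/-- Each vector measure `A ↦ E(A) x` is bounded, so the uniform boundedness principle applies. -/
theorem exists_norm_le (h : IsSpectralResolution X E) :
    ∃ M : ℝ, 0 ≤ M ∧ ∀ A, MeasurableSet A → ‖E A‖ ≤ M := by
  let _ : NormedSpace ℝ H := NormedSpace.restrictScalars ℝ ℂ H
  obtain ⟨M, hM⟩ := banach_steinhaus (g := fun A : {A : Set ℂ // MeasurableSet A} => E A)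
    (fun x => ⟨(h.vectorMeasure x).bound, fun A => by
      have : (h.vectorMeasure x) A.1 = E A.1 x := if_pos A.2
      rw [← this]
      exact MeasureTheory.VectorMeasure.norm_apply_le_bound⟩)
  exact ⟨M, (norm_nonneg _).trans (hM ⟨∅, MeasurableSet.empty⟩), fun A hA => hM ⟨A, hA⟩⟩

end IsSpectralResolution

/-- If all subset sums of a finite family of complex numbers are bounded by `C`, then the sum of
the absolute values is at most `4 C`: split real and imaginary parts by sign. -/
theorem sum_norm_le_of_forall_subset_sum {ι : Type*} (s : Finset ι) (z : ι → ℂ) (C : ℝ)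
    (hC : ∀ t ⊆ s, ‖∑ i ∈ t, z i‖ ≤ C) : ∑ i ∈ s, ‖z i‖ ≤ 4 * C := by
  have key : ∀ f : ι → ℝ, (∀ t ⊆ s, |∑ i ∈ t, f i| ≤ C) → ∑ i ∈ s, |f i| ≤ 2 * C := by
    intro f hf
    rw [← Finset.sum_filter_add_sum_filter_not s (fun i => 0 ≤ f i)]
    have h1 : ∑ i ∈ s with 0 ≤ f i, |f i| = ∑ i ∈ s with 0 ≤ f i, f i :=
      Finset.sum_congr rfl fun i hi => abs_of_nonneg (Finset.mem_filter.1 hi).2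
    have h2 : ∑ i ∈ s with ¬ 0 ≤ f i, |f i| = -∑ i ∈ s with ¬ 0 ≤ f i, f i := by
      rw [← Finset.sum_neg_distrib]
      exact Finset.sum_congr rfl fun i hi =>
        abs_of_neg (not_le.1 (Finset.mem_filter.1 hi).2)
    have h3 := abs_le.1 (hf _ (Finset.filter_subset (fun i => 0 ≤ f i) s))
    have h4 := abs_le.1 (hf _ (Finset.filter_subset (fun i => ¬ 0 ≤ f i) s))
    rw [h1, h2]
    linarith [h3.2, h4.1]
  have hre := key (fun i => (z i).re) fun t ht => by
    rw [← Complex.re_sum]; exact (Complex.abs_re_le_norm _).trans (hC t ht)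
  have him := key (fun i => (z i).im) fun t ht => by
    rw [← Complex.im_sum]; exact (Complex.abs_im_le_norm _).trans (hC t ht)
  calc ∑ i ∈ s, ‖z i‖ ≤ ∑ i ∈ s, (|(z i).re| + |(z i).im|) :=
        Finset.sum_le_sum fun i _ => Complex.norm_le_abs_re_add_abs_im _
    _ ≤ 4 * C := by rw [Finset.sum_add_distrib]; linarith

/-- The integral of a simple function against a spectral measure is bounded by its supremum.
Coefficients on empty cells do not matter. -/
theorem IsSpectralResolution.exists_norm_sum_smul_le (h : IsSpectralResolution X E) :
    ∃ C : ℝ, 0 ≤ C ∧ ∀ (n : ℕ) (A : Fin n → Set ℂ) (c : Fin n → ℂ) (s : ℝ), 0 ≤ s →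
      (∀ i, MeasurableSet (A i)) → (Pairwise fun i j => Disjoint (A i) (A j)) →
      (∀ i, (A i).Nonempty → ‖c i‖ ≤ s) → ‖∑ i, c i • E (A i)‖ ≤ C * s := by
  obtain ⟨M, hM0, hM⟩ := h.exists_norm_le
  refine ⟨4 * M, by positivity, fun n A c s hs hA hd hc => ?_⟩
  refine ContinuousLinearMap.opNorm_le_bound _ (by positivity) fun x => ?_
  set v := (∑ i, c i • E (A i)) x with hv
  -- test against `v` itself
  have hsum : ∑ i, ‖inner ℂ v (E (A i) x)‖ ≤ 4 * (‖v‖ * (M * ‖x‖)) := by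
    refine sum_norm_le_of_forall_subset_sum _ _ _ fun t _ => ?_
    have : ∑ i ∈ t, inner ℂ v (E (A i) x) = inner ℂ v (E (⋃ i ∈ t, A i) x) := by
      rw [h.map_biUnion t A hA hd, sum_apply, inner_sum]
    rw [this]
    refine (norm_inner_le_norm _ _).trans ?_
    gcongr
    exact ContinuousLinearMap.le_of_opNorm_le _
      (hM _ (t.measurableSet_biUnion fun i _ => hA i)) x
  have hvv : ‖v‖ * ‖v‖ ≤ s * (4 * (‖v‖ * (M * ‖x‖))) := by
    have h1 : ‖inner ℂ v v‖ = ‖v‖ * ‖v‖ := by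
      rw [inner_self_eq_norm_sq_to_K]
      simp [sq]
    have h2 : inner ℂ v v = ∑ i, c i * inner ℂ v (E (A i) x) := by
      have hv' : v = ∑ i, c i • E (A i) x := by simp [hv, sum_apply]
      conv_lhs => arg 3; rw [hv']
      rw [inner_sum]
      exact Finset.sum_congr rfl fun i _ => inner_smul_right _ _ _
    rw [← h1, h2]
    calc ‖∑ i, c i * inner ℂ v (E (A i) x)‖ ≤ ∑ i, s * ‖inner ℂ v (E (A i) x)‖ := by
          refine norm_sum_le_of_le _ fun i _ => ?_
          rw [norm_mul]
          rcases (A i).eq_empty_or_nonempty with he | hne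
          · simp [he, h.map_empty]
          · gcongr; exact hc i hne
      _ = s * ∑ i, ‖inner ℂ v (E (A i) x)‖ := by rw [Finset.mul_sum]
      _ ≤ _ := by gcongr
  rcases (norm_nonneg v).eq_or_lt with h0 | h0
  · rw [← h0]; positivity
  · refine le_of_mul_le_mul_left (hvv.trans (le_of_eq ?_)) h0
    ring

end

section

open TaggedPartition

/-! ### Tagged partitions -/

namespace TaggedPartition

variable {K K' : Set ℂ}

theorem cell_subset (π : TaggedPartition K) (i : Fin π.n) : π.cell i ⊆ K :=
  (subset_iUnion π.cell i).trans π.iUnion_cell.subset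

theorem tag_mem' (π : TaggedPartition K) (i : Fin π.n) : π.tag i ∈ K :=
  π.cell_subset i (π.tag_mem i)

theorem FinerThan.mono {π : TaggedPartition K} {δ δ' : ℝ} (h : π.FinerThan δ) (hδ : δ ≤ δ') :
    π.FinerThan δ' := fun i z hz w hw => (h i z hz w hw).trans hδ

/-- The partition of the empty set without cells. -/
def ofEmpty : TaggedPartition ∅ where
  n := 0
  cell := Fin.elim0
  tag := Fin.elim0
  measurable_cell i := i.elim0
  disjoint_cell i := i.elim0
  iUnion_cell := by simp
  tag_mem i := i.elim0

/-- The partition with a single cell, tagged by `z`. -/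
def single (hK : MeasurableSet K) {z : ℂ} (hz : z ∈ K) : TaggedPartition K where
  n := 1
  cell _ := K
  tag _ := z
  measurable_cell _ := hK
  disjoint_cell i j hij := absurd (Subsingleton.elim i j) hij
  iUnion_cell := by simp [iUnion_const]
  tag_mem _ := hz

/-- Juxtaposition of partitions of disjoint sets. -/
def union (π : TaggedPartition K) (π' : TaggedPartition K') (h : Disjoint K K') :
    TaggedPartition (K ∪ K') where
  n := π.n + π'.n
  cell := Fin.append π.cell π'.cell
  tag := Fin.append π.tag π'.tag
  measurable_cell := Fin.addCases (fun i => by simpa using π.measurable_cell i)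
    (fun i => by simpa using π'.measurable_cell i)
  disjoint_cell := by
    intro i j
    refine Fin.addCases (fun i => ?_) (fun i => ?_) i <;>
      refine Fin.addCases (fun j => ?_) (fun j => ?_) j <;>
      intro hij <;> simp only [Fin.append_left, Fin.append_right]
    · exact π.disjoint_cell (by rintro rfl; exact hij rfl)
    · exact h.mono (π.cell_subset i) (π'.cell_subset j)
    · exact (h.mono (π.cell_subset j) (π'.cell_subset i)).symm
    · exact π'.disjoint_cell (by rintro rfl; exact hij rfl)
  iUnion_cell := by
    refine Eq.trans ?_ (congrArg₂ (· ∪ ·) π.iUnion_cell π'.iUnion_cell)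
    ext z
    simp only [mem_iUnion, mem_union]
    constructor
    · rintro ⟨i, hi⟩
      revert hi
      refine Fin.addCases (fun i hi => ?_) (fun i hi => ?_) i
      · exact Or.inl ⟨i, by simpa using hi⟩
      · exact Or.inr ⟨i, by simpa using hi⟩
    · rintro (⟨i, hi⟩ | ⟨i, hi⟩)
      · exact ⟨Fin.castAdd _ i, by simpa using hi⟩
      · exact ⟨Fin.natAdd _ i, by simpa using hi⟩
  tag_mem := Fin.addCases (fun i => by simpa using π.tag_mem i)
    (fun i => by simpa using π'.tag_mem i)

theorem FinerThan.union {π : TaggedPartition K} {π' : TaggedPartition K'} {δ : ℝ}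
    (hπ : π.FinerThan δ) (hπ' : π'.FinerThan δ) (h : Disjoint K K') :
    (π.union π' h).FinerThan δ :=
  Fin.addCases (fun i => by simpa [TaggedPartition.union] using hπ i)
    (fun i => by simpa [TaggedPartition.union] using hπ' i)

/-- A partition of the complement of a small ball extends by one cell. -/
theorem exists_finerThan_of_sdiff (hK : MeasurableSet K) {x z : ℂ} {δ : ℝ}
    (hz : z ∈ K ∩ Metric.ball x (δ / 2)) {π' : TaggedPartition (K \ Metric.ball x (δ / 2))}
    (hπ' : π'.FinerThan δ) : ∃ π : TaggedPartition K, π.FinerThan δ ∧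
      ∃ i, π.tag i = z ∧ π.cell i = K ∩ Metric.ball x (δ / 2) := by
  let π₀ := single (hK.inter (Metric.isOpen_ball (x := x) (ε := δ / 2)).measurableSet) hz
  have hπ₀ : π₀.FinerThan δ := fun i u hu v hv => by
    have h1 := Metric.mem_ball.1 hu.2
    have h2 := Metric.mem_ball'.1 hv.2
    linarith [dist_triangle u x v]
  have hu := hπ₀.union hπ' disjoint_sdiff_inter.symm
  have hi : ∃ i, (π₀.union π' disjoint_sdiff_inter.symm).tag i = z ∧
      (π₀.union π' disjoint_sdiff_inter.symm).cell i = K ∩ Metric.ball x (δ / 2) :=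
    ⟨Fin.castAdd π'.n (0 : Fin 1), Fin.append_left π₀.tag π'.tag (0 : Fin 1),
      Fin.append_left π₀.cell π'.cell (0 : Fin 1)⟩
  -- transport along the equality `K ∩ B ∪ K \ B = K`
  have hset : K ∩ Metric.ball x (δ / 2) ∪ K \ Metric.ball x (δ / 2) = K :=
    inter_union_sdiff _ _
  generalize π₀.union π' _ = ρ at hu hi
  generalize K ∩ Metric.ball x (δ / 2) = A at ρ hset hi
  generalize A ∪ K \ Metric.ball x (δ / 2) = L at ρ hset
  subst hset
  exact ⟨ρ, hu, hi⟩

/-- Every bounded Borel set has tagged partitions of arbitrarily small mesh: remove the balls of a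
finite cover one after the other. -/
theorem exists_finerThan (hK : MeasurableSet K) (hb : Bornology.IsBounded K) {δ : ℝ}
    (hδ : 0 < δ) : ∃ π : TaggedPartition K, π.FinerThan δ := by
  obtain ⟨t, ht, hcov⟩ := Metric.totallyBounded_iff.1
    (hb.isCompact_closure.totallyBounded.subset subset_closure) (δ / 2) (by positivity)
  lift t to Finset ℂ using ht
  clear hb
  induction t using Finset.induction_on generalizing K with
  | empty =>
    have : K = ∅ := by simpa [subset_empty_iff] using hcov
    subst this
    exact ⟨ofEmpty, fun i => i.elim0⟩
  | insert x t _ ih =>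
    have hcov' : ∀ z ∈ K, z ∉ Metric.ball x (δ / 2) → z ∈ ⋃ y ∈ (t : Set ℂ), Metric.ball y (δ / 2) :=
      fun z hz hzx => by
        have := hcov hz
        simp only [Finset.coe_insert, biUnion_insert, mem_union] at this
        exact this.resolve_left hzx
    rcases (K ∩ Metric.ball x (δ / 2)).eq_empty_or_nonempty with he | ⟨z, hz⟩
    · exact ih hK fun z hz => hcov' z hz fun h => (he.subset ⟨hz, h⟩ : z ∈ (∅ : Set ℂ))
    · obtain ⟨π', hπ'⟩ := ih
        (hK.diff (Metric.isOpen_ball (x := x) (ε := δ / 2)).measurableSet)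
        (fun z hz => hcov' z hz.1 hz.2)
      obtain ⟨π, hπ, -⟩ := exists_finerThan_of_sdiff hK hz hπ'
      exact ⟨π, hπ⟩

/-- A fine partition in which a prescribed small ball is a cell tagged by its centre. -/
theorem exists_finerThan_cell_eq_ball (hK : MeasurableSet K) (hb : Bornology.IsBounded K) {δ : ℝ}
    (hδ : 0 < δ) {x : ℂ} (hx : x ∈ K) : ∃ π : TaggedPartition K, π.FinerThan δ ∧
      ∃ i, π.tag i = x ∧ π.cell i = K ∩ Metric.ball x (δ / 2) := by
  obtain ⟨π', hπ'⟩ := exists_finerThan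
    (hK.diff (Metric.isOpen_ball (x := x) (ε := δ / 2)).measurableSet) (hb.subset sdiff_subset) hδ
  exact exists_finerThan_of_sdiff hK ⟨hx, Metric.mem_ball_self (by positivity)⟩ hπ'

/-- The filter of tagged partitions whose mesh tends to `0`. -/
def fine (K : Set ℂ) : Filter (TaggedPartition K) :=
  ⨅ δ ∈ Ioi (0 : ℝ), 𝓟 {π | π.FinerThan δ}

theorem hasBasis_fine (K : Set ℂ) :
    (fine K).HasBasis (fun δ : ℝ => 0 < δ) (fun δ => {π | π.FinerThan δ}) :=
  hasBasis_biInf_principal (fun a ha b hb => ⟨min a b, mem_Ioi.2 (lt_min ha hb),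
    fun _ h => FinerThan.mono h (min_le_left _ _), fun _ h => FinerThan.mono h (min_le_right _ _)⟩)
    ⟨1, mem_Ioi.2 one_pos⟩

theorem eventually_finerThan (K : Set ℂ) {δ : ℝ} (hδ : 0 < δ) :
    ∀ᶠ π in fine K, π.FinerThan δ := (hasBasis_fine K).mem_of_mem hδ

theorem fine_neBot (hK : MeasurableSet K) (hb : Bornology.IsBounded K) : (fine K).NeBot :=
  (hasBasis_fine K).neBot_iff.2 fun hδ => exists_finerThan hK hb hδ

end TaggedPartition

variable {H : Type*} [NormedAddCommGroup H] [InnerProductSpace ℂ H] [CompleteSpace H]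
variable {X : H →L[ℂ] H} {E : Set ℂ → H →L[ℂ] H} {K : Set ℂ}

theorem hasSpectralIntegral_iff_tendsto {F : ℂ → H →L[ℂ] H} {S : H →L[ℂ] H} :
    HasSpectralIntegral F E K S ↔
      Tendsto (fun π : TaggedPartition K => ∑ i, F (π.tag i) * E (π.cell i)) (fine K) (𝓝 S) := by
  rw [(hasBasis_fine K).tendsto_iff Metric.nhds_basis_ball]
  simp [HasSpectralIntegral, dist_eq_norm]

theorem hasDoubleSpectralIntegral_iff_tendsto {c : ℂ → ℂ → ℂ}
    {F₁ : ℂ → H →L[ℂ] H} {E₁ : Set ℂ → H →L[ℂ] H} {K₁ : Set ℂ} {Y : H →L[ℂ] H}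
    {F₂ : ℂ → H →L[ℂ] H} {E₂ : Set ℂ → H →L[ℂ] H} {K₂ : Set ℂ} {S : H →L[ℂ] H} :
    HasDoubleSpectralIntegral c F₁ E₁ K₁ Y F₂ E₂ K₂ S ↔
      Tendsto (fun π : TaggedPartition K₁ × TaggedPartition K₂ =>
        ∑ i, ∑ j, c (π.1.tag i) (π.2.tag j) •
          ((F₁ (π.1.tag i) * E₁ (π.1.cell i)) * Y * (F₂ (π.2.tag j) * E₂ (π.2.cell j))))
        (fine K₁ ×ˢ fine K₂) (𝓝 S) := by
  rw [((hasBasis_fine K₁).prod_same_index (hasBasis_fine K₂) (fun {a b} ha hb =>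
      ⟨min a b, lt_min ha hb, fun _ h => FinerThan.mono h (min_le_left _ _),
        fun _ h => FinerThan.mono h (min_le_right _ _)⟩)).tendsto_iff Metric.nhds_basis_ball]
  simp [HasDoubleSpectralIntegral, dist_eq_norm]

/-! ### Riemann sums and the scalar part -/

/-- The Riemann sum `∑ λᵢ E(Kᵢ)` of the identity function, with the tags as sample points. -/
def TaggedPartition.riemann (π : TaggedPartition K) (E : Set ℂ → H →L[ℂ] H) : H →L[ℂ] H :=
  ∑ i, π.tag i • E (π.cell i)

namespace IsSpectralResolution

theorem sum_map_cell_inter (h : IsSpectralResolution X E) (π : TaggedPartition K) {P : Set ℂ}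
    (hP : MeasurableSet P) : ∑ i, E (π.cell i ∩ P) = E (K ∩ P) := by
  rw [← h.map_iUnion (fun i => π.cell i ∩ P) (fun i => (π.measurable_cell i).inter hP)
    (fun i j hij => (π.disjoint_cell hij).mono inter_subset_left inter_subset_left),
    ← iUnion_inter, π.iUnion_cell]

theorem sum_map_cell (h : IsSpectralResolution X E) (π : TaggedPartition K) :
    ∑ i, E (π.cell i) = E K := by
  simpa using h.sum_map_cell_inter π MeasurableSet.univ

theorem commute_riemann (h : IsSpectralResolution X E) (π : TaggedPartition K) {A : Set ℂ}
    (hA : MeasurableSet A) : Commute (π.riemann E) (E A) :=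
  Commute.sum_left _ _ _ fun i _ => (h.commute_map (π.measurable_cell i) hA).smul_left _

theorem commute_riemann_self (h : IsSpectralResolution X E) (π : TaggedPartition K) :
    Commute (π.riemann E) X :=
  Commute.sum_left _ _ _ fun i _ => (h.commute _ (π.measurable_cell i)).smul_left _

theorem riemann_mul_cell (h : IsSpectralResolution X E) (π : TaggedPartition K) (i : Fin π.n) :
    π.riemann E * E (π.cell i) = π.tag i • E (π.cell i) := by
  rw [TaggedPartition.riemann, Finset.sum_mul, Finset.sum_eq_single i]
  · rw [smul_mul_assoc, h.mul_self (π.measurable_cell i)]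
  · intro j _ hj
    rw [smul_mul_assoc, h.mul_eq_zero_of_disjoint (π.measurable_cell j) (π.measurable_cell i)
      (π.disjoint_cell hj), smul_zero]
  · simp

theorem riemann_mul_cell_inter (h : IsSpectralResolution X E) (π : TaggedPartition K)
    (i : Fin π.n) {P : Set ℂ} (hP : MeasurableSet P) :
    π.riemann E * E (π.cell i ∩ P) = π.tag i • E (π.cell i ∩ P) := by
  rw [h.inter _ _ (π.measurable_cell i) hP, ← mul_assoc, h.riemann_mul_cell, smul_mul_assoc]

end IsSpectralResolution

/-- If `a` and `b` agree after multiplication by an element `e` commuting with `b`, then so do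
their powers. -/
theorem pow_mul_eq_of_mul_eq {R : Type*} [Monoid R] {a b e : R} (h : a * e = b * e)
    (hb : Commute b e) (k : ℕ) : a ^ k * e = b ^ k * e := by
  induction k with
  | zero => simp
  | succ k ih =>
    rw [pow_succ', mul_assoc, ih, (hb.pow_left k).eq, ← mul_assoc, h, mul_assoc,
      ← (hb.pow_left k).eq, ← mul_assoc, ← pow_succ']

namespace IsSpectralResolution

/-- Riemann sums are multiplicative: on the `i`-th cell, multiplication by the tag is the same as
multiplication by the Riemann sum of the identity function. -/
theorem sum_pow_smul_shiftPow_mul (h : IsSpectralResolution X E) (π : TaggedPartition K)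
    {P : Set ℂ} (hP : MeasurableSet P) (c : ℂ) (p k : ℕ) :
    ∑ i, (π.tag i - c) ^ k • (shiftPow X p (π.tag i) * E (π.cell i ∩ P)) =
      (X - π.riemann E) ^ p * ((π.riemann E - c • 1) ^ k * E (K ∩ P)) := by
  rw [← h.sum_map_cell_inter π hP, Finset.mul_sum, Finset.mul_sum]
  refine Finset.sum_congr rfl fun i _ => ?_
  set e := E (π.cell i ∩ P)
  have hcell := (π.measurable_cell i).inter hP
  have hXe : Commute X e := (h.commute _ hcell).symm
  have h1 : (π.riemann E - c • 1) * e = ((π.tag i - c) • (1 : H →L[ℂ] H)) * e := by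
    rw [sub_mul, h.riemann_mul_cell_inter π i hP, smul_mul_assoc, one_mul, smul_mul_assoc,
      one_mul, sub_smul]
  have h2 : (X - π.riemann E) * e = (X - π.tag i • 1) * e := by
    rw [sub_mul, sub_mul, h.riemann_mul_cell_inter π i hP, smul_mul_assoc, one_mul]
  rw [pow_mul_eq_of_mul_eq h1 ((Commute.one_left e).smul_left _), smul_pow, one_pow,
    smul_mul_assoc, one_mul, mul_smul_comm,
    pow_mul_eq_of_mul_eq h2 (hXe.sub_left ((Commute.one_left e).smul_left _))]
  rfl

/-- The scalar part `S = ∫ λ dE(λ)` of a spectral operator. -/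
def scalarPart (h : IsSpectralResolution X E) : H →L[ℂ] H := h.decomposition.choose

/-- The quasinilpotent part `N = X - S` of a spectral operator. -/
def nilPart (h : IsSpectralResolution X E) : H →L[ℂ] H := X - h.scalarPart

theorem tendsto_riemann_spectrum (h : IsSpectralResolution X E) :
    Tendsto (fun π : TaggedPartition (spectrum ℂ X) => π.riemann E) (fine _)
      (𝓝 h.scalarPart) := by
  have := hasSpectralIntegral_iff_tendsto.1 h.decomposition.choose_spec.choose_spec.1
  simpa [TaggedPartition.riemann, scalarPart] using this

theorem spectralRadius_nilPart (h : IsSpectralResolution X E) :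
    spectralRadius ℂ h.nilPart = 0 := by
  obtain ⟨-, -, h3, h4⟩ := h.decomposition.choose_spec.choose_spec
  have : h.nilPart = h.decomposition.choose_spec.choose := by
    rw [nilPart, scalarPart, sub_eq_iff_eq_add']; exact h3
  rw [this]; exact h4

/-- Limits along fine partitions of a Borel subset of the spectrum are unique. -/
theorem fine_neBot_of_subset (hK : MeasurableSet K) (hKX : K ⊆ spectrum ℂ X) : (fine K).NeBot :=
  TaggedPartition.fine_neBot hK ((spectrum.isBounded X).subset hKX)

theorem commute_scalarPart (h : IsSpectralResolution X E) {A : Set ℂ} (hA : MeasurableSet A) :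
    Commute h.scalarPart (E A) := by
  have := fine_neBot_of_subset (X := X) (measurableSet_spectrum X) subset_rfl
  refine tendsto_nhds_unique (h.tendsto_riemann_spectrum.mul_const (E A)) ?_
  simpa only [(h.commute_riemann _ hA).eq] using h.tendsto_riemann_spectrum.const_mul (E A)

theorem commute_scalarPart_self (h : IsSpectralResolution X E) : Commute h.scalarPart X := by
  have := fine_neBot_of_subset (X := X) (measurableSet_spectrum X) subset_rfl
  refine tendsto_nhds_unique (h.tendsto_riemann_spectrum.mul_const X) ?_
  simpa only [(h.commute_riemann_self _).eq] using h.tendsto_riemann_spectrum.const_mul X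

theorem commute_nilPart (h : IsSpectralResolution X E) {A : Set ℂ} (hA : MeasurableSet A) :
    Commute h.nilPart (E A) :=
  (h.commute A hA).symm.sub_left (h.commute_scalarPart hA)

theorem commute_nilPart_scalarPart (h : IsSpectralResolution X E) :
    Commute h.nilPart h.scalarPart :=
  h.commute_scalarPart_self.symm.sub_left (Commute.refl _)

/-- A fine partition of `K ⊆ σ(X)` can be completed to a fine partition of `σ(X)`; hence its
Riemann sums converge to `S E(K)`. -/
theorem tendsto_riemann (h : IsSpectralResolution X E) (hK : MeasurableSet K)
    (hKX : K ⊆ spectrum ℂ X) :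
    Tendsto (fun π : TaggedPartition K => π.riemann E) (fine K) (𝓝 (h.scalarPart * E K)) := by
  have hlim := h.tendsto_riemann_spectrum.mul_const (E K)
  rw [((hasBasis_fine _).tendsto_iff Metric.nhds_basis_ball)] at hlim ⊢
  intro ε hε
  obtain ⟨δ, hδ, hδ'⟩ := hlim ε hε
  refine ⟨δ, hδ, fun π hπ => ?_⟩
  have hK' : MeasurableSet (spectrum ℂ X \ K) := (measurableSet_spectrum X).diff hK
  obtain ⟨π', hπ'⟩ := exists_finerThan hK' ((spectrum.isBounded X).subset sdiff_subset) hδ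
  have hu := FinerThan.union hπ hπ' disjoint_sdiff_right
  have hR : (π.union π' disjoint_sdiff_right).riemann E * E K = π.riemann E := by
    rw [TaggedPartition.riemann, Finset.sum_mul]
    refine (Fin.sum_univ_add (a := π.n) (b := π'.n) _).trans ?_
    simp only [TaggedPartition.union, Fin.append_left, Fin.append_right, smul_mul_assoc]
    rw [Finset.sum_eq_zero (s := (Finset.univ : Finset (Fin π'.n))), add_zero,
      TaggedPartition.riemann]
    · refine Finset.sum_congr rfl fun i _ => ?_
      rw [← h.inter _ _ (π.measurable_cell i) hK, inter_eq_left.2 (π.cell_subset i)]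
    · intro i _
      rw [h.mul_eq_zero_of_disjoint (π'.measurable_cell i) hK
        (disjoint_sdiff_left.mono_left (π'.cell_subset i)), smul_zero]
  rw [← hR]
  have hset : K ∪ spectrum ℂ X \ K = spectrum ℂ X := union_sdiff_cancel hKX
  generalize π.union π' _ = ρ at hu
  generalize K ∪ spectrum ℂ X \ K = L at ρ hset
  subst hset
  exact hδ' ρ hu

/-- The Riemann sums of `(λ - c)^k (X - λ)^p` over `K ∩ P` converge to `N^p (S - c)^k E(K ∩ P)`. -/
theorem tendsto_riemann_pow (h : IsSpectralResolution X E) (hK : MeasurableSet K)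
    (hKX : K ⊆ spectrum ℂ X) {P : Set ℂ} (hP : MeasurableSet P) (c : ℂ) (p k : ℕ) :
    Tendsto (fun π : TaggedPartition K =>
      (X - π.riemann E) ^ p * ((π.riemann E - c • 1) ^ k * E (K ∩ P))) (fine K)
      (𝓝 (h.nilPart ^ p * ((h.scalarPart - c • 1) ^ k * E (K ∩ P)))) := by
  have hl := h.tendsto_riemann hK hKX
  have h1 := ((tendsto_const_nhds (x := X)).sub hl).pow p
  have h2 := ((hl.sub_const (c • (1 : H →L[ℂ] H))).pow k).mul_const (E (K ∩ P))
  have hKP := hK.inter hP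
  have he : E K * E (K ∩ P) = E (K ∩ P) := by
    rw [← h.inter _ _ hK hKP, ← inter_assoc, inter_self]
  have hone : Commute (c • (1 : H →L[ℂ] H)) (E (K ∩ P)) := (Commute.one_left _).smul_left _
  have e2 : (h.scalarPart * E K - c • 1) ^ k * E (K ∩ P) =
      (h.scalarPart - c • 1) ^ k * E (K ∩ P) := by
    refine pow_mul_eq_of_mul_eq ?_ ((h.commute_scalarPart hKP).sub_left hone) k
    rw [sub_mul, sub_mul, mul_assoc, he]
  have e1 : (X - h.scalarPart * E K) ^ p * E (K ∩ P) = h.nilPart ^ p * E (K ∩ P) := by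
    refine pow_mul_eq_of_mul_eq ?_ (h.commute_nilPart hKP) p
    rw [nilPart, sub_mul, sub_mul, mul_assoc, he]
  have hc : Commute ((h.scalarPart - c • 1) ^ k) (E (K ∩ P)) :=
    ((h.commute_scalarPart hKP).sub_left hone).pow_left k
  have := h1.mul h2
  rwa [e2, hc.eq, ← mul_assoc, e1, mul_assoc, ← hc.eq] at this

end IsSpectralResolution

end

section

open TaggedPartition

/-! ### Quasinilpotent elements -/

section Quasinilpotent

variable {R : Type*} [NormedRing R] [NormedAlgebra ℂ R] [CompleteSpace R]

theorem exists_norm_pow_le_of_spectralRadius_eq_zero {a : R} (ha : spectralRadius ℂ a = 0) {ε : ℝ}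
    (hε : 0 < ε) : ∃ C : ℝ, 0 ≤ C ∧ ∀ n : ℕ, ‖a ^ n‖ ≤ C * ε ^ n := by
  have hlim := spectrum.pow_nnnorm_pow_one_div_tendsto_nhds_spectralRadius a
  rw [ha] at hlim
  have hev := hlim.eventually (gt_mem_nhds (ENNReal.ofReal_pos.2 hε))
  obtain ⟨n₀, hn₀⟩ := eventually_atTop.1 (hev.and (eventually_ge_atTop 1))
  have hlarge : ∀ n, n₀ ≤ n → ‖a ^ n‖ ≤ ε ^ n := by
    intro n hn
    obtain ⟨h1, h2⟩ := hn₀ n hn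
    have h3 := ENNReal.rpow_le_rpow h1.le (Nat.cast_nonneg n)
    rw [← ENNReal.rpow_mul, one_div, inv_mul_cancel₀ (by positivity), ENNReal.rpow_one,
      ENNReal.rpow_natCast, ← ENNReal.ofReal_pow hε.le, ← enorm_eq_nnnorm, ← ofReal_norm,
      ENNReal.ofReal_le_ofReal_iff (by positivity)] at h3
    exact h3
  refine ⟨1 + ∑ n ∈ Finset.range n₀, ‖a ^ n‖ / ε ^ n, by positivity, fun n => ?_⟩
  rcases le_or_gt n₀ n with hn | hn
  · refine (hlarge n hn).trans (le_mul_of_one_le_left (by positivity) ?_)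
    exact le_add_of_nonneg_right (by positivity)
  · have := Finset.single_le_sum (f := fun n => ‖a ^ n‖ / ε ^ n) (fun i _ => by positivity)
      (Finset.mem_range.2 hn)
    rw [← div_le_iff₀ (by positivity)]
    exact this.trans (le_add_of_nonneg_left zero_le_one)

/-- `1 - a` divides `1 - a ^ n`, which is invertible by the Neumann series. -/
theorem isUnit_one_sub_of_norm_pow_lt_one {a : R} {n : ℕ} (h : ‖a ^ n‖ < 1) :
    IsUnit (1 - a) := by
  have h1 : IsUnit (1 - a ^ n) := (Units.oneSub _ h).isUnit
  have hc : Commute (1 - a) (∑ i ∈ Finset.range n, a ^ i) :=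
    Commute.sum_right _ _ _ fun i _ => ((Commute.one_left a).sub_left (Commute.refl a)).pow_right i
  rw [← mul_neg_geom_sum] at h1
  exact (hc.isUnit_mul_iff.1 h1).1

/-- A unit stays a unit after adding a quasinilpotent element commuting with it. -/
theorem isUnit_add_of_quasinilpotent {u a : R} (hu : IsUnit u) (hc : Commute u a)
    (ha : ∀ ε > 0, ∃ C : ℝ, 0 ≤ C ∧ ∀ n : ℕ, ‖a ^ n‖ ≤ C * ε ^ n) : IsUnit (u + a) := by
  obtain ⟨u, rfl⟩ := hu
  set v : R := ↑u⁻¹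
  have hv : Commute v a := hc.units_inv_left
  set t := ‖v‖ + 1
  have ht : 0 < t := by positivity
  obtain ⟨C, hC0, hC⟩ := ha (1 / (2 * t)) (by positivity)
  obtain ⟨n, hn⟩ := exists_pow_lt_of_lt_one (show (0:ℝ) < 1 / (C + 1) by positivity)
    (show (1 / 2 : ℝ) < 1 by norm_num)
  have hlt : ‖(-(v * a)) ^ (n + 1)‖ < 1 := by
    rw [← neg_mul, hv.neg_left.mul_pow]
    calc ‖(-v) ^ (n + 1) * a ^ (n + 1)‖ ≤ ‖(-v) ^ (n + 1)‖ * ‖a ^ (n + 1)‖ := norm_mul_le _ _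
      _ ≤ t ^ (n + 1) * (C * (1 / (2 * t)) ^ (n + 1)) := by
          gcongr
          · exact (norm_pow_le' (-v) (Nat.succ_pos n)).trans (by gcongr; simp [t])
          · exact hC _
      _ = C * (1 / 2) ^ (n + 1) := by
          rw [div_pow, mul_pow, div_pow]; field_simp
      _ ≤ C * (1 / (C + 1)) := by
          gcongr
          exact (pow_le_pow_of_le_one (by norm_num) (by norm_num) (Nat.le_succ n)).trans hn.le
      _ < 1 := by rw [mul_one_div, div_lt_one (by positivity)]; linarith
  have h1 := isUnit_one_sub_of_norm_pow_lt_one hlt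
  have h2 : (u : R) + a = u * (1 - -(v * a)) := by
    rw [sub_neg_eq_add, mul_add, mul_one, ← mul_assoc, Units.mul_inv, one_mul]
  rw [h2]
  exact u.isUnit.mul h1

end Quasinilpotent

variable {H : Type*} [NormedAddCommGroup H] [InnerProductSpace ℂ H] [CompleteSpace H]
variable {X : H →L[ℂ] H} {E : Set ℂ → H →L[ℂ] H} {K : Set ℂ}

namespace IsSpectralResolution

/-! ### Estimates for the scalar part -/

theorem exists_norm_nilPart_pow_le (h : IsSpectralResolution X E) {ε : ℝ} (hε : 0 < ε) :
    ∃ C : ℝ, 0 ≤ C ∧ ∀ n : ℕ, ‖h.nilPart ^ n‖ ≤ C * ε ^ n :=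
  exists_norm_pow_le_of_spectralRadius_eq_zero h.spectralRadius_nilPart hε

/-- Near the centre `c` of a small set `P`, the powers `(R - c)^k` of the Riemann sums are
geometrically small on the range of `E(P)`, uniformly in the partition. -/
theorem exists_norm_riemann_pow_le (h : IsSpectralResolution X E) :
    ∃ C : ℝ, 0 ≤ C ∧ ∀ (K P : Set ℂ) (π : TaggedPartition K) (c : ℂ) (ρ : ℝ), 0 < ρ →
      MeasurableSet P → P ⊆ Metric.closedBall c (ρ / 2) → π.FinerThan (ρ / 2) → ∀ k : ℕ,
      ‖(π.riemann E - c • 1) ^ k * E (K ∩ P)‖ ≤ C * ρ ^ k := by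
  obtain ⟨C, hC0, hC⟩ := h.exists_norm_sum_smul_le
  refine ⟨C, hC0, fun K P π c ρ hρ hP hPc hπ k => ?_⟩
  have := h.sum_pow_smul_shiftPow_mul π hP c 0 k
  rw [pow_zero, one_mul] at this
  rw [← this]
  simp only [shiftPow, pow_zero, one_mul]
  refine hC _ _ _ _ (by positivity) (fun i => (π.measurable_cell i).inter hP)
    (fun i j hij => (π.disjoint_cell hij).mono inter_subset_left inter_subset_left) ?_
  rintro i ⟨z, hz1, hz2⟩
  rw [norm_pow]
  gcongr
  have h1 := hπ i (π.tag i) (π.tag_mem i) z hz1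
  have h2 := Metric.mem_closedBall.1 (hPc hz2)
  rw [← dist_eq_norm]
  linarith [dist_triangle (π.tag i) z c]

/-- The limit form of `exists_norm_riemann_pow_le`. -/
theorem exists_norm_scalarPart_pow_le (h : IsSpectralResolution X E) :
    ∃ C : ℝ, 0 ≤ C ∧ ∀ (P : Set ℂ) (c : ℂ) (ρ : ℝ), 0 < ρ →
      MeasurableSet P → P ⊆ Metric.closedBall c (ρ / 2) → ∀ k : ℕ,
      ‖(h.scalarPart - c • 1) ^ k * E P‖ ≤ C * ρ ^ k := by
  obtain ⟨C, hC0, hC⟩ := h.exists_norm_riemann_pow_le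
  refine ⟨C, hC0, fun P c ρ hρ hP hPc k => ?_⟩
  have := fine_neBot_of_subset (X := X) (measurableSet_spectrum X) subset_rfl
  have hlim := h.tendsto_riemann_pow (measurableSet_spectrum X) subset_rfl hP c 0 k
  simp only [pow_zero, one_mul] at hlim
  rw [inter_comm, h.map_inter_spectrum hP] at hlim
  refine le_of_tendsto hlim.norm ?_
  filter_upwards [eventually_finerThan _ (half_pos hρ)] with π hπ
  rw [← h.map_inter_spectrum hP, inter_comm]
  exact hC _ P π c ρ hρ hP hPc hπ k

theorem scalarPart_mul_map_singleton (h : IsSpectralResolution X E) (c : ℂ) :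
    h.scalarPart * E {c} = c • E {c} := by
  obtain ⟨C, hC0, hC⟩ := h.exists_norm_scalarPart_pow_le
  have h0 : (h.scalarPart - c • 1) * E {c} = 0 := by
    rw [← norm_le_zero_iff]
    have ht : Tendsto (fun ρ : ℝ => C * ρ ^ 1) (𝓝[>] 0) (𝓝 (C * 0 ^ 1)) :=
      (((continuous_id.pow 1).const_mul C).tendsto 0).mono_left nhdsWithin_le_nhds
    rw [pow_one, mul_zero] at ht
    refine ge_of_tendsto ht ?_
    filter_upwards [self_mem_nhdsWithin] with ρ hρ
    have hρ' : 0 < ρ := hρ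
    have := hC {c} c ρ hρ (measurableSet_singleton c) (by simp; positivity) 1
    rwa [pow_one] at this
  rw [sub_mul, smul_mul_assoc, one_mul, sub_eq_zero] at h0
  exact h0

theorem nilPart_pow_mul_map_singleton (h : IsSpectralResolution X E) (c : ℂ) (k : ℕ) :
    h.nilPart ^ k * E {c} = (X - c • 1) ^ k * E {c} := by
  have hc := measurableSet_singleton c
  refine pow_mul_eq_of_mul_eq ?_
    ((h.commute _ hc).symm.sub_left ((Commute.one_left _).smul_left _)) k
  rw [nilPart, sub_mul, sub_mul, h.scalarPart_mul_map_singleton, smul_mul_assoc, one_mul]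

/-! ### Local invertibility and null sets -/

/-- If `B` keeps a positive distance from `l`, then `X - l` is invertible on the range of `E(B)`.
The inverse of the scalar part is approximated by `∑ (λᵢ - l)⁻¹ E(Bᵢ)`, and the quasinilpotent
part does not affect invertibility. -/
theorem isUnit_sub_mul_map_add (h : IsSpectralResolution X E) {B : Set ℂ} (hB : MeasurableSet B)
    (hBX : B ⊆ spectrum ℂ X) {l : ℂ} {ε : ℝ} (hε : 0 < ε) (hl : ∀ z ∈ B, ε ≤ ‖z - l‖) :
    IsUnit ((X - l • 1) * E B + (1 - E B)) := by
  set e := E B with he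
  have hee : e * e = e := h.mul_self hB
  obtain ⟨C, hC0, hC⟩ := h.exists_norm_sum_smul_le
  have hS : IsUnit ((h.scalarPart - l • 1) * e + (1 - e)) := by
    have hlim := h.tendsto_riemann hB hBX
    have hne := fine_neBot_of_subset hB hBX
    set D := C * ε⁻¹ + ‖1 - e‖ + 1
    have hD : 0 < D := by positivity
    obtain ⟨π, hπ⟩ := ((Metric.tendsto_nhds.1 hlim) (1 / D) (by positivity)).exists
    have hcell : ∀ i, E (π.cell i) * e = E (π.cell i) := fun i => by
      rw [he, ← h.inter _ _ (π.measurable_cell i) hB, inter_eq_left.2 (π.cell_subset i)]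
    have hcell' : ∀ i, e * E (π.cell i) = E (π.cell i) := fun i => by
      rw [he, ← h.inter _ _ hB (π.measurable_cell i), inter_eq_right.2 (π.cell_subset i)]
    set V := ∑ i, (π.tag i - l)⁻¹ • E (π.cell i) with hV
    set W := ∑ i, (π.tag i - l) • E (π.cell i) with hW
    have hne' : ∀ i, π.tag i - l ≠ 0 := fun i => by
      rw [← norm_pos_iff]; exact hε.trans_le (hl _ (π.tag_mem' i))
    have hmul : ∀ a b : Fin π.n → ℂ, (∀ i, a i * b i = 1) →
        (∑ i, a i • E (π.cell i)) * (∑ i, b i • E (π.cell i)) = e := by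
      intro a b hab
      rw [he, ← h.sum_map_cell π, Finset.sum_mul]
      refine Finset.sum_congr rfl fun i _ => ?_
      rw [Finset.mul_sum, Finset.sum_eq_single i]
      · rw [smul_mul_smul_comm, hab, one_smul, h.mul_self (π.measurable_cell i)]
      · intro j _ hj
        rw [smul_mul_smul_comm, h.mul_eq_zero_of_disjoint (π.measurable_cell i)
          (π.measurable_cell j) (π.disjoint_cell hj.symm), smul_zero]
      · simp
    have hz1 : ∀ a : Fin π.n → ℂ, (∑ i, a i • E (π.cell i)) * (1 - e) = 0 := fun a => by
      rw [Finset.sum_mul]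
      exact Finset.sum_eq_zero fun i _ => by
        rw [smul_mul_assoc, mul_sub, mul_one, hcell, sub_self, smul_zero]
    have hz2 : ∀ a : Fin π.n → ℂ, (1 - e) * (∑ i, a i • E (π.cell i)) = 0 := fun a => by
      rw [Finset.mul_sum]
      exact Finset.sum_eq_zero fun i _ => by
        rw [mul_smul_comm, sub_mul, one_mul, hcell', sub_self, smul_zero]
    have hidem : (1 - e) * (1 - e) = 1 - e := by
      rw [mul_sub, mul_one, sub_mul, one_mul, hee]; abel
    have hVW : (V + (1 - e)) * (W + (1 - e)) = 1 := by
      rw [add_mul, mul_add, mul_add, hmul _ _ (fun i => inv_mul_cancel₀ (hne' i)), hz1, hz2, hidem]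
      abel
    have hWV : (W + (1 - e)) * (V + (1 - e)) = 1 := by
      rw [add_mul, mul_add, mul_add, hmul _ _ (fun i => mul_inv_cancel₀ (hne' i)), hz1, hz2, hidem]
      abel
    have hWR : W = π.riemann E - l • e := by
      rw [hW, TaggedPartition.riemann, he, ← h.sum_map_cell π, Finset.smul_sum,
        ← Finset.sum_sub_distrib]
      exact Finset.sum_congr rfl fun i _ => sub_smul _ _ _
    have hVn : ‖V + (1 - e)‖ < D := by
      have : ‖V‖ ≤ C * ε⁻¹ := hC _ _ _ _ (by positivity) π.measurable_cell π.disjoint_cell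
        fun i _ => by
          rw [norm_inv]
          exact inv_anti₀ hε (hl _ (π.tag_mem' i))
      linarith [norm_add_le V (1 - e)]
    set U := (h.scalarPart - l • 1) * e + (1 - e) with hU
    have hdiff : W + (1 - e) - U = π.riemann E - h.scalarPart * e := by
      rw [hU, hWR, sub_mul, smul_mul_assoc, one_mul]; abel
    have hlt : ‖(V + (1 - e)) * (W + (1 - e) - U)‖ < 1 := by
      rw [hdiff]
      rw [dist_eq_norm] at hπ
      calc _ ≤ ‖V + (1 - e)‖ * ‖π.riemann E - h.scalarPart * e‖ := norm_mul_le _ _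
        _ ≤ D * ‖π.riemann E - h.scalarPart * e‖ := by gcongr
        _ < D * (1 / D) := by gcongr
        _ = 1 := mul_one_div_cancel hD.ne'
    have h1 : IsUnit ((V + (1 - e)) * U) := by
      have := (Units.oneSub _ hlt).isUnit
      rwa [Units.val_oneSub, mul_sub, hVW, sub_sub_cancel] at this
    have h2 : IsUnit (W + (1 - e)) := ⟨⟨_, _, hWV, hVW⟩, rfl⟩
    have := h2.mul h1
    rwa [← mul_assoc, hWV, one_mul] at this
  have hNe := h.commute_nilPart hB
  have hSe := h.commute_scalarPart hB
  have hcomm : Commute ((h.scalarPart - l • 1) * e + (1 - e)) (h.nilPart * e) := by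
    have c1 : Commute (h.scalarPart - l • 1) h.nilPart :=
      h.commute_nilPart_scalarPart.symm.sub_left ((Commute.one_left _).smul_left _)
    have c2 : Commute (h.scalarPart - l • 1) e :=
      hSe.sub_left ((Commute.one_left _).smul_left _)
    have c3 : Commute e h.nilPart := hNe.symm
    exact ((c1.mul_right c2).mul_left (c3.mul_right (Commute.refl e))).add_left
      ((Commute.one_left _).sub_left (c3.mul_right (Commute.refl e)))
  have hsum : (X - l • 1) * e + (1 - e) =
      ((h.scalarPart - l • 1) * e + (1 - e)) + h.nilPart * e := by
    rw [nilPart, sub_mul, sub_mul, sub_mul]; abel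
  rw [hsum]
  refine isUnit_add_of_quasinilpotent hS hcomm fun δ hδ => ?_
  obtain ⟨C', hC'0, hC'⟩ := h.exists_norm_nilPart_pow_le hδ
  refine ⟨C' * (‖(1 : H →L[ℂ] H)‖ + ‖e‖), by positivity, fun n => ?_⟩
  rw [hNe.mul_pow]
  have hen : ‖e ^ n‖ ≤ ‖(1 : H →L[ℂ] H)‖ + ‖e‖ := by
    rcases n with _ | n
    · simp
    · rw [(show IsIdempotentElem e from hee).pow_succ_eq]; simp
  calc _ ≤ ‖h.nilPart ^ n‖ * ‖e ^ n‖ := norm_mul_le _ _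
    _ ≤ (C' * δ ^ n) * (‖(1 : H →L[ℂ] H)‖ + ‖e‖) := by gcongr; exact hC' n
    _ = _ := by ring

theorem mul_map_eq_zero_of_subset (h : IsSpectralResolution X E) {T : H →L[ℂ] H} {A B : Set ℂ}
    (hA : MeasurableSet A) (hB : MeasurableSet B) (hAB : A ⊆ B) (hT : T * E B = 0) :
    T * E A = 0 := by
  rw [← inter_eq_right.2 hAB, h.inter _ _ hB hA, ← mul_assoc, hT, zero_mul]

theorem mul_map_iUnion_eq_zero (h : IsSpectralResolution X E) {T : H →L[ℂ] H} {A : ℕ → Set ℂ}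
    (hA : ∀ n, MeasurableSet (A n)) (hT : ∀ n, T * E (A n) = 0) : T * E (⋃ n, A n) = 0 := by
  ext x
  rw [← iUnion_disjointed]
  have hd := fun n => MeasurableSet.disjointed hA n
  have hs := (h.hasSum_iUnion _ hd (fun m n hmn => disjoint_disjointed A hmn) x).mapL T
  refine hs.unique ?_
  have : ∀ n, T (E (disjointed A n) x) = 0 := fun n => by
    have := h.mul_map_eq_zero_of_subset (hd n) (hA n) (disjointed_subset A n) (hT n)
    exact congrArg (fun f : H →L[ℂ] H => f x) this
  simp only [this]
  exact hasSum_zero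

/-- If `(X - c)^k E(B) = 0` for a ball `B` around `c`, then `N^k E(B) = 0`. -/
theorem nilPart_pow_mul_eq_zero (h : IsSpectralResolution X E) {c : ℂ} {r : ℝ}
    {k : ℕ} (hk : (X - c • 1) ^ k * E (Metric.ball c r ∩ spectrum ℂ X) = 0) :
    h.nilPart ^ k * E (Metric.ball c r ∩ spectrum ℂ X) = 0 := by
  set B := Metric.ball c r ∩ spectrum ℂ X with hBdef
  have hB : MeasurableSet B := Metric.isOpen_ball.measurableSet.inter (measurableSet_spectrum X)
  let A : ℕ → Set ℂ := fun n => B ∩ {z | 1 / ((n : ℝ) + 1) ≤ ‖z - c‖}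
  have hA : ∀ n, MeasurableSet (A n) := fun n =>
    hB.inter (measurableSet_le measurable_const (by fun_prop))
  have hA0 : ∀ n, (1 : H →L[ℂ] H) * E (A n) = 0 := by
    intro n
    have hAB : A n ⊆ B := inter_subset_left
    have hu := h.isUnit_sub_mul_map_add (hA n) (hAB.trans inter_subset_right)
      (show 0 < 1 / ((n : ℝ) + 1) by positivity) (fun z hz => hz.2)
    have h0 := h.mul_map_eq_zero_of_subset (hA n) hB hAB hk
    set e := E (A n)
    have hee : e * e = e := h.mul_self (hA n)
    have hXe : Commute (X - c • 1) e :=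
      (h.commute _ (hA n)).symm.sub_left ((Commute.one_left _).smul_left _)
    have := pow_mul_eq_of_mul_eq (a := (X - c • 1) * e + (1 - e)) (b := X - c • 1) (e := e)
      (by rw [add_mul, mul_assoc, hee, sub_mul 1, one_mul, hee, sub_self, add_zero]) hXe k
    rw [h0] at this
    rw [one_mul]
    exact (hu.pow k).mul_right_eq_zero.1 this
  have hU := h.mul_map_iUnion_eq_zero hA hA0
  have hdiff : ⋃ n, A n = B \ {c} := by
    rw [← inter_iUnion]
    ext z
    simp only [mem_inter_iff, mem_iUnion, mem_ofPred_eq, Set.mem_sdiff, mem_singleton_iff]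
    refine and_congr_right fun _ => ⟨?_, fun hz => ?_⟩
    · rintro ⟨n, hn⟩ rfl
      rw [sub_self, norm_zero] at hn
      exact absurd hn (not_le.2 (by positivity))
    · obtain ⟨n, hn⟩ := exists_nat_one_div_lt (norm_pos_iff.2 (sub_ne_zero.2 hz))
      exact ⟨n, hn.le⟩
  rw [hdiff, one_mul] at hU
  have hsplit : E B = E (B ∩ {c}) := by
    conv_lhs => rw [← inter_union_sdiff B {c}]
    rw [h.map_union (hB.inter (measurableSet_singleton c)) (hB.diff (measurableSet_singleton c))
      disjoint_sdiff_inter.symm, hU, add_zero]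
  have hcB : MeasurableSet (B ∩ {c}) := hB.inter (measurableSet_singleton c)
  have hE : E (B ∩ {c}) = E {c} * E (B ∩ {c}) := by
    rw [← h.inter _ _ (measurableSet_singleton c) hcB, inter_eq_right.2 inter_subset_right]
  rw [hsplit, hE, ← mul_assoc, h.nilPart_pow_mul_map_singleton, mul_assoc, ← hE, ← hsplit, hk]

/-! ### The order of the nilpotent part -/

theorem hasSpectralIntegral_shiftPow (h : IsSpectralResolution X E) (hK : MeasurableSet K)
    (hKX : K ⊆ spectrum ℂ X) (q : ℕ) :
    HasSpectralIntegral (shiftPow X q) E K (h.nilPart ^ q * E K) := by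
  rw [hasSpectralIntegral_iff_tendsto]
  have := h.tendsto_riemann_pow hK hKX MeasurableSet.univ 0 q 0
  simp only [← h.sum_pow_smul_shiftPow_mul _ MeasurableSet.univ] at this
  simpa using this

theorem vanishesNear_iff (h : IsSpectralResolution X E) {q : ℕ} {l : ℂ} :
    VanishesNear X E q l ↔
      ∃ U, IsOpen U ∧ l ∈ U ∧ h.nilPart ^ q * E (U ∩ spectrum ℂ X) = 0 := by
  refine exists_congr fun U => and_congr_right fun hU => and_congr_right fun _ => ?_
  have hK : MeasurableSet (U ∩ spectrum ℂ X) := hU.measurableSet.inter (measurableSet_spectrum X)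
  have hI := h.hasSpectralIntegral_shiftPow hK inter_subset_right q
  constructor
  · intro h0
    have := fine_neBot_of_subset hK inter_subset_right
    exact tendsto_nhds_unique (hasSpectralIntegral_iff_tendsto.1 hI)
      (hasSpectralIntegral_iff_tendsto.1 h0)
  · intro h0
    rwa [h0] at hI

theorem lt_nilOrder_iff {q : ℕ} {l : ℂ} :
    (q : ℕ∞) < nilOrder X E l ↔ ∀ q' ≤ q, ¬ VanishesNear X E q' l := by
  rw [← not_iff_not, not_lt, nilOrder]
  push Not
  constructor
  · intro hle
    by_contra! hcon
    have : ((q + 1 : ℕ) : ℕ∞) ≤ ⨅ q : {q : ℕ // VanishesNear X E q l}, ((q : ℕ) : ℕ∞) :=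
      le_iInf fun q' => by
        have : ¬ (q' : ℕ) ≤ q := fun hq => hcon _ hq q'.2
        exact_mod_cast (by omega : q + 1 ≤ (q' : ℕ))
    have := this.trans hle
    norm_cast at this
    omega
  · rintro ⟨q', hq', hv⟩
    exact (iInf_le _ (⟨q', hv⟩ : {q : ℕ // VanishesNear X E q l})).trans (by exact_mod_cast hq')

/-- The same neighbourhood serves for all of its points. -/
theorem isOpen_vanishesNear (X : H →L[ℂ] H) (E : Set ℂ → H →L[ℂ] H) (q : ℕ) :
    IsOpen {l | VanishesNear X E q l} := by
  rw [isOpen_iff_mem_nhds]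
  rintro l ⟨U, hU, hl, h0⟩
  filter_upwards [hU.mem_nhds hl] with l' hl'
  exact ⟨U, hU, hl', h0⟩

theorem measurableSet_orderAbove (X : H →L[ℂ] H) (E : Set ℂ → H →L[ℂ] H) (q : ℕ) :
    MeasurableSet (orderAbove X E q) := by
  have : orderAbove X E q =
      spectrum ℂ X ∩ ⋂ q' ∈ Finset.range (q + 1), {l | VanishesNear X E q' l}ᶜ := by
    ext l
    simp [orderAbove, lt_nilOrder_iff]
  rw [this]
  exact (measurableSet_spectrum X).inter (Finset.measurableSet_biInter _ fun q' _ =>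
    (isOpen_vanishesNear X E q').measurableSet.compl)

theorem orderAbove_subset (X : H →L[ℂ] H) (E : Set ℂ → H →L[ℂ] H) (q : ℕ) :
    orderAbove X E q ⊆ spectrum ℂ X := fun _ hl => hl.1

/-- The points of the spectrum at which the `p`-th power of the nilpotent part vanishes form a null
set for `N^p dE`, because countably many of the witnessing neighbourhoods suffice. -/
theorem nilPart_pow_mul_map_sdiff (h : IsSpectralResolution X E) (p : ℕ) :
    h.nilPart ^ p * E (spectrum ℂ X \ orderAbove X E p) = 0 := by
  let 𝒰 : Set (Set ℂ) := {U | IsOpen U ∧ h.nilPart ^ p * E (U ∩ spectrum ℂ X) = 0}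
  obtain ⟨𝒯, hc, h𝒯, hU⟩ := TopologicalSpace.isOpen_sUnion_countable 𝒰 fun U hU => hU.1
  have hempty : (∅ : Set ℂ) ∈ 𝒰 := ⟨isOpen_empty, by simp [h.map_empty]⟩
  obtain ⟨A, hA⟩ := (hc.insert ∅).exists_eq_range (insert_nonempty _ _)
  have hA𝒰 : ∀ n, A n ∈ 𝒰 := fun n => by
    rcases (hA ▸ mem_range_self n : A n ∈ insert ∅ 𝒯) with h1 | h1
    · rw [h1]; exact hempty
    · exact h𝒯 h1
  have hσ := measurableSet_spectrum X
  have h0 := h.mul_map_iUnion_eq_zero (fun n => (hA𝒰 n).1.measurableSet.inter hσ)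
    (fun n => (hA𝒰 n).2)
  refine h.mul_map_eq_zero_of_subset (hσ.diff (measurableSet_orderAbove X E p))
    (MeasurableSet.iUnion fun n => (hA𝒰 n).1.measurableSet.inter hσ) ?_ h0
  rintro l ⟨hl, hl'⟩
  have : ¬ (p : ℕ∞) < nilOrder X E l := fun hlt => hl' ⟨hl, hlt⟩
  rw [lt_nilOrder_iff] at this
  push Not at this
  obtain ⟨q, hq, hv⟩ := this
  obtain ⟨U, hUo, hlU, hU0⟩ := h.vanishesNear_iff.1 hv
  have hmem : U ∈ 𝒰 := ⟨hUo, by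
    rw [← Nat.sub_add_cancel hq, pow_add, mul_assoc, hU0, mul_zero]⟩
  have : l ∈ ⋃₀ 𝒯 := hU ▸ ⟨U, hmem, hlU⟩
  obtain ⟨V, hV, hlV⟩ := this
  obtain ⟨n, rfl⟩ : V ∈ range A := hA ▸ mem_insert_of_mem _ hV
  exact mem_iUnion.2 ⟨n, hlV, hl⟩

/-- Restricting the integral of `(X - λ)^p dE(λ)` to the set where the order exceeds `p` does not change
it, so the truncated sums in the double operator integral agree with the full ones. -/
theorem nilPart_pow_mul_map_orderAbove_inter (h : IsSpectralResolution X E) (p : ℕ) {P : Set ℂ}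
    (hP : MeasurableSet P) :
    h.nilPart ^ p * E (orderAbove X E p ∩ P) = h.nilPart ^ p * E P := by
  have hO := measurableSet_orderAbove X E p
  have hσ := measurableSet_spectrum X
  have h1 : h.nilPart ^ p * E (orderAbove X E p) = h.nilPart ^ p := by
    have := h.map_union hO (hσ.diff hO) disjoint_sdiff_right
    rw [union_sdiff_cancel (orderAbove_subset X E p), h.spectrum_eq_one] at this
    conv_rhs => rw [← mul_one (h.nilPart ^ p), this, mul_add, h.nilPart_pow_mul_map_sdiff, add_zero]
  rw [h.inter _ _ hO hP, ← mul_assoc, h1]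

/-- The spectral measure is supported on the whole spectrum: if `E` vanished near `l`, then `X - l`
would be invertible. -/
theorem nilOrder_pos (h : IsSpectralResolution X E) {l : ℂ} (hl : l ∈ spectrum ℂ X) :
    ((0 : ℕ) : ℕ∞) < nilOrder X E l := by
  rw [lt_nilOrder_iff]
  intro q hq hv
  obtain rfl : q = 0 := by omega
  obtain ⟨U, hU, hlU, h0⟩ := h.vanishesNear_iff.1 hv
  rw [pow_zero, one_mul] at h0
  have hσ := measurableSet_spectrum X
  have hB : MeasurableSet (spectrum ℂ X \ U) := hσ.diff hU.measurableSet
  have h1 : E (spectrum ℂ X \ U) = 1 := by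
    have := h.map_union (hU.measurableSet.inter hσ) hB
      (disjoint_sdiff_right.mono_left inter_subset_left)
    rwa [h0, zero_add, inter_comm, inter_union_sdiff, h.spectrum_eq_one, eq_comm] at this
  obtain ⟨ε, hε, hball⟩ := Metric.isOpen_iff.1 hU l hlU
  have hu := h.isUnit_sub_mul_map_add hB sdiff_subset hε (l := l) fun z hz => by
    by_contra! hlt
    exact hz.2 (hball (by rwa [Metric.mem_ball, dist_eq_norm]))
  rw [h1, mul_one, sub_self, add_zero] at hu
  refine hl ?_
  rw [spectrum.mem_resolventSet_iff, ← IsUnit.neg_iff, neg_sub, Algebra.algebraMap_eq_smul_one]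
  exact hu

end IsSpectralResolution

end

section

/-! ### Taylor expansion in two variables -/

/-- Antidiagonals of pairs of natural numbers are products of antidiagonals. -/
instance instHasAntidiagonalNatProd : Finset.HasAntidiagonal (ℕ × ℕ) where
  antidiagonal m := (Finset.HasAntidiagonal.antidiagonal m.1 ×ˢ
    Finset.HasAntidiagonal.antidiagonal m.2).map (Equiv.prodProdProdComm ℕ ℕ ℕ ℕ).toEmbedding
  mem_antidiagonal {n a} := by
    obtain ⟨⟨a, b⟩, c, d⟩ := a
    obtain ⟨n, m⟩ := n
    simp [Finset.mem_map_equiv]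

theorem sum_antidiagonal_natProd {M : Type*} [AddCommMonoid M] (m : ℕ × ℕ)
    (F : (ℕ × ℕ) × (ℕ × ℕ) → M) :
    ∑ x ∈ Finset.HasAntidiagonal.antidiagonal m, F x = ∑ i ∈ Finset.HasAntidiagonal.antidiagonal m.1,
      ∑ j ∈ Finset.HasAntidiagonal.antidiagonal m.2, F ((i.1, j.1), (i.2, j.2)) := by
  rw [← Finset.sum_product']
  exact Finset.sum_map _ _ _

/-- The partial derivative with respect to the first variable. -/
def dFst (g : ℂ × ℂ → ℂ) (z : ℂ × ℂ) : ℂ := fderiv ℂ g z (1, 0)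

/-- The partial derivative with respect to the second variable. -/
def dSnd (g : ℂ × ℂ → ℂ) (z : ℂ × ℂ) : ℂ := fderiv ℂ g z (0, 1)

/-- The mixed Taylor coefficient `∂₁^p ∂₂^q g / (p! q!)` of index `m = (p, q)`. -/
def taylorCoeff (g : ℂ × ℂ → ℂ) (m : ℕ × ℕ) (z : ℂ × ℂ) : ℂ :=
  (dFst^[m.1] (dSnd^[m.2] g)) z / ((m.1 ! : ℂ) * (m.2 ! : ℂ))

variable {D : Set (ℂ × ℂ)} {g g' : ℂ × ℂ → ℂ}

theorem analyticOnNhd_dFst (hg : AnalyticOnNhd ℂ g D) : AnalyticOnNhd ℂ (dFst g) D :=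
  (ContinuousLinearMap.apply ℂ ℂ ((1, 0) : ℂ × ℂ)).comp_analyticOnNhd hg.fderiv

theorem analyticOnNhd_dSnd (hg : AnalyticOnNhd ℂ g D) : AnalyticOnNhd ℂ (dSnd g) D :=
  (ContinuousLinearMap.apply ℂ ℂ ((0, 1) : ℂ × ℂ)).comp_analyticOnNhd hg.fderiv

theorem analyticOnNhd_iterate_dFst (hg : AnalyticOnNhd ℂ g D) (p : ℕ) :
    AnalyticOnNhd ℂ (dFst^[p] g) D := by
  induction p with
  | zero => exact hg
  | succ p ih => rw [Function.iterate_succ_apply']; exact analyticOnNhd_dFst ih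

theorem analyticOnNhd_iterate_dSnd (hg : AnalyticOnNhd ℂ g D) (p : ℕ) :
    AnalyticOnNhd ℂ (dSnd^[p] g) D := by
  induction p with
  | zero => exact hg
  | succ p ih => rw [Function.iterate_succ_apply']; exact analyticOnNhd_dSnd ih

theorem eqOn_dFst (hD : IsOpen D) (h : EqOn g g' D) : EqOn (dFst g) (dFst g') D := fun z hz => by
  rw [dFst, dFst, (h.eventuallyEq_of_mem (hD.mem_nhds hz)).fderiv_eq]

theorem eqOn_dSnd (hD : IsOpen D) (h : EqOn g g' D) : EqOn (dSnd g) (dSnd g') D := fun z hz => by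
  rw [dSnd, dSnd, (h.eventuallyEq_of_mem (hD.mem_nhds hz)).fderiv_eq]

theorem eqOn_iterate_dFst (hD : IsOpen D) (h : EqOn g g' D) (p : ℕ) :
    EqOn (dFst^[p] g) (dFst^[p] g') D := by
  induction p with
  | zero => exact h
  | succ p ih => rw [Function.iterate_succ_apply', Function.iterate_succ_apply']
                 exact eqOn_dFst hD ih

theorem eqOn_iterate_dSnd (hD : IsOpen D) (h : EqOn g g' D) (p : ℕ) :
    EqOn (dSnd^[p] g) (dSnd^[p] g') D := by
  induction p with
  | zero => exact h
  | succ p ih => rw [Function.iterate_succ_apply', Function.iterate_succ_apply']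
                 exact eqOn_dSnd hD ih

theorem eqOn_dSnd_dFst (hg : AnalyticOnNhd ℂ g D) :
    EqOn (dSnd (dFst g)) (dFst (dSnd g)) D := fun z hz => by
  have hd : DifferentiableAt ℂ (fderiv ℂ g) z := (hg.fderiv z hz).differentiableAt
  have hsymm : IsSymmSndFDerivAt ℂ g z :=
    (hg z hz).contDiffAt.isSymmSndFDerivAt (n := ⊤) (by simp)
  have h1 : ∀ v u : ℂ × ℂ, fderiv ℂ (fun y => fderiv ℂ g y v) z u = fderiv ℂ (fderiv ℂ g) z u v :=
    fun v u => by
      rw [fderiv_clm_apply hd (differentiableAt_const v)]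
      simp
  change fderiv ℂ (fun y => fderiv ℂ g y (1, 0)) z (0, 1) =
    fderiv ℂ (fun y => fderiv ℂ g y (0, 1)) z (1, 0)
  rw [h1, h1]
  exact hsymm _ _

theorem eqOn_iterate_dSnd_dFst (hD : IsOpen D) (hg : AnalyticOnNhd ℂ g D) (q : ℕ) :
    EqOn (dSnd^[q] (dFst g)) (dFst (dSnd^[q] g)) D := by
  induction q with
  | zero => exact fun _ _ => rfl
  | succ q ih =>
    rw [Function.iterate_succ_apply', Function.iterate_succ_apply']
    exact (eqOn_dSnd hD ih).trans (eqOn_dSnd_dFst (analyticOnNhd_iterate_dSnd hg q))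

theorem eqOn_iterate_dSnd_iterate_dFst (hD : IsOpen D) (hg : AnalyticOnNhd ℂ g D) (p q : ℕ) :
    EqOn (dSnd^[q] (dFst^[p] g)) (dFst^[p] (dSnd^[q] g)) D := by
  induction p with
  | zero => exact fun _ _ => rfl
  | succ p ih =>
    rw [Function.iterate_succ_apply', Function.iterate_succ_apply']
    exact (eqOn_iterate_dSnd_dFst hD (analyticOnNhd_iterate_dFst hg p) q).trans (eqOn_dFst hD ih)

theorem isOpen_slice_fst (hD : IsOpen D) (w : ℂ) : IsOpen {u : ℂ | (u, w) ∈ D} :=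
  hD.preimage (by fun_prop)

theorem isOpen_slice_snd (hD : IsOpen D) (u : ℂ) : IsOpen {w : ℂ | (u, w) ∈ D} :=
  hD.preimage (by fun_prop)

theorem analyticAt_slice_fst (hg : AnalyticOnNhd ℂ g D) {u w : ℂ} (h : (u, w) ∈ D) :
    AnalyticAt ℂ (fun u => g (u, w)) u :=
  AnalyticAt.fun_comp (f := fun u => ((u, w) : ℂ × ℂ)) (hg _ h) (by fun_prop)

theorem analyticAt_slice_snd (hg : AnalyticOnNhd ℂ g D) {u w : ℂ} (h : (u, w) ∈ D) :
    AnalyticAt ℂ (fun w => g (u, w)) w :=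
  AnalyticAt.fun_comp (f := fun w => ((u, w) : ℂ × ℂ)) (hg _ h) (by fun_prop)

theorem iteratedDeriv_slice_fst (hD : IsOpen D) (hg : AnalyticOnNhd ℂ g D) (p : ℕ) {u w : ℂ}
    (h : (u, w) ∈ D) : iteratedDeriv p (fun u => g (u, w)) u = (dFst^[p] g) (u, w) := by
  induction p generalizing u with
  | zero => simp
  | succ p ih =>
    rw [iteratedDeriv_succ, Function.iterate_succ_apply']
    have hev : iteratedDeriv p (fun u => g (u, w)) =ᶠ[𝓝 u] fun u => (dFst^[p] g) (u, w) := by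
      filter_upwards [(isOpen_slice_fst hD w).mem_nhds h] with u' hu' using ih hu'
    rw [hev.deriv_eq]
    have h1 := ((analyticOnNhd_iterate_dFst hg p) _ h).differentiableAt.hasFDerivAt
    have h2 : HasDerivAt (fun u => ((u, w) : ℂ × ℂ)) (1, 0) u :=
      (hasDerivAt_id u).prodMk (hasDerivAt_const u w)
    exact (h1.comp_hasDerivAt u h2).deriv

theorem iteratedDeriv_slice_snd (hD : IsOpen D) (hg : AnalyticOnNhd ℂ g D) (q : ℕ) {u w : ℂ}
    (h : (u, w) ∈ D) : iteratedDeriv q (fun w => g (u, w)) w = (dSnd^[q] g) (u, w) := by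
  induction q generalizing w with
  | zero => simp
  | succ p ih =>
    rw [iteratedDeriv_succ, Function.iterate_succ_apply']
    have hev : iteratedDeriv p (fun w => g (u, w)) =ᶠ[𝓝 w] fun w => (dSnd^[p] g) (u, w) := by
      filter_upwards [(isOpen_slice_snd hD u).mem_nhds h] with u' hu' using ih hu'
    rw [hev.deriv_eq]
    have h1 := ((analyticOnNhd_iterate_dSnd hg p) _ h).differentiableAt.hasFDerivAt
    have h2 : HasDerivAt (fun w => ((u, w) : ℂ × ℂ)) (0, 1) w :=
      (hasDerivAt_const w u).prodMk (hasDerivAt_id w)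
    exact (h1.comp_hasDerivAt w h2).deriv

theorem iteratedDeriv_iteratedDeriv_slice (hD : IsOpen D) (hg : AnalyticOnNhd ℂ g D) (p q : ℕ)
    {u w : ℂ} (h : (u, w) ∈ D) :
    iteratedDeriv p (fun u => iteratedDeriv q (fun w => g (u, w)) w) u =
      (dFst^[p] (dSnd^[q] g)) (u, w) := by
  have hev : (fun u => iteratedDeriv q (fun w => g (u, w)) w) =ᶠ[𝓝 u]
      fun u => (dSnd^[q] g) (u, w) := by
    filter_upwards [(isOpen_slice_fst hD w).mem_nhds h] with u' hu'
      using iteratedDeriv_slice_snd hD hg q hu'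
  rw [hev.iteratedDeriv_eq]
  exact iteratedDeriv_slice_fst hD (analyticOnNhd_iterate_dSnd hg q) p h

theorem mem_closedBall_prod {c z : ℂ × ℂ} {r : ℝ} :
    z ∈ Metric.closedBall c r ↔ z.1 ∈ Metric.closedBall c.1 r ∧ z.2 ∈ Metric.closedBall c.2 r := by
  simp [Metric.mem_closedBall, Prod.dist_eq]

/-- The Cauchy estimates in one variable. -/
theorem norm_iteratedDeriv_div_factorial_le {f : ℂ → ℂ} {c : ℂ} {r M : ℝ} (hr : 0 < r)
    (hf : ∀ z ∈ Metric.closedBall c r, AnalyticAt ℂ f z)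
    (hM : ∀ z ∈ Metric.closedBall c r, ‖f z‖ ≤ M) (n : ℕ) :
    ‖iteratedDeriv n f c / (n ! : ℂ)‖ ≤ M / r ^ n := by
  have hd : DifferentiableOn ℂ f (Metric.closedBall c r) :=
    fun z hz => (hf z hz).differentiableAt.differentiableWithinAt
  have := Complex.norm_iteratedDeriv_le_of_forall_mem_sphere_norm_le n hr
    (hd.diffContOnCl_ball subset_rfl) (fun z hz => hM z (Metric.sphere_subset_closedBall hz))
  rw [norm_div, Complex.norm_natCast, div_le_iff₀ (by positivity)]
  refine this.trans (le_of_eq ?_)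
  ring

/-- Cauchy estimates for the mixed Taylor coefficients. -/
theorem norm_taylorCoeff_le (hD : IsOpen D) (hg : AnalyticOnNhd ℂ g D) {c : ℂ × ℂ} {r M : ℝ}
    (hr : 0 < r) (hc : Metric.closedBall c r ⊆ D) (hM : ∀ z ∈ Metric.closedBall c r, ‖g z‖ ≤ M)
    (m : ℕ × ℕ) : ‖taylorCoeff g m c‖ ≤ M / r ^ (m.1 + m.2) := by
  obtain ⟨p, q⟩ := m
  obtain ⟨a, b⟩ := c
  have hball : ∀ u ∈ Metric.closedBall a r, ∀ w ∈ Metric.closedBall b r,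
      (u, w) ∈ Metric.closedBall (a, b) r := fun u hu w hw => mem_closedBall_prod.2 ⟨hu, hw⟩
  have hb : b ∈ Metric.closedBall b r := Metric.mem_closedBall_self hr.le
  have ha : a ∈ Metric.closedBall a r := Metric.mem_closedBall_self hr.le
  have h1 : ∀ u ∈ Metric.closedBall a r, ‖(dSnd^[q] g) (u, b) / (q ! : ℂ)‖ ≤ M / r ^ q := by
    intro u hu
    rw [← iteratedDeriv_slice_snd hD hg q (hc (hball u hu b hb))]
    exact norm_iteratedDeriv_div_factorial_le hr
      (fun w hw => analyticAt_slice_snd hg (hc (hball u hu w hw)))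
      (fun w hw => hM _ (hball u hu w hw)) q
  have h2 := norm_iteratedDeriv_div_factorial_le (f := fun u => (dSnd^[q] g) (u, b) / (q ! : ℂ))
    hr (fun u hu => (analyticAt_slice_fst (analyticOnNhd_iterate_dSnd hg q)
      (hc (hball u hu b hb))).div_const) h1 p
  rw [iteratedDeriv_div_const,
    iteratedDeriv_slice_fst hD (analyticOnNhd_iterate_dSnd hg q) p (hc (hball a ha b hb))] at h2
  rw [div_div, div_div, mul_comm (q ! : ℂ), ← pow_add, add_comm q p] at h2
  exact h2

theorem hasSum_of_eq {ι M : Type*} [AddCommMonoid M] [TopologicalSpace M] {f f' : ι → M} {a a' : M}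
    (h : HasSum f a) (hf : ∀ i, f' i = f i) (ha : a' = a) : HasSum f' a' := by
  rw [ha, funext hf]; exact h

theorem summable_pow_mul_pow {a b : ℝ} (ha : 0 ≤ a) (ha1 : a < 1) (hb : 0 ≤ b) (hb1 : b < 1) :
    Summable fun m : ℕ × ℕ => a ^ m.1 * b ^ m.2 :=
  (summable_geometric_of_lt_one ha ha1).mul_of_nonneg (summable_geometric_of_lt_one hb hb1)
    (fun _ => by positivity) (fun _ => by positivity)

/-- The Taylor expansion of an analytic function on a polydisc. -/
theorem hasSum_taylorCoeff (hD : IsOpen D) (hg : AnalyticOnNhd ℂ g D) {c z : ℂ × ℂ} {r : ℝ}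
    (hc : Metric.closedBall c r ⊆ D) (hz : z ∈ Metric.ball c r) :
    HasSum (fun m : ℕ × ℕ => taylorCoeff g m c * ((z.1 - c.1) ^ m.1 * (z.2 - c.2) ^ m.2))
      (g z) := by
  have hr : 0 < r := Metric.pos_of_mem_ball hz
  obtain ⟨M, hM⟩ := (isCompact_closedBall c r).exists_bound_of_continuousOn
    (hg.continuousOn.mono hc)
  have hM0 : 0 ≤ M := (norm_nonneg _).trans (hM c (Metric.mem_closedBall_self hr.le))
  obtain ⟨a, b⟩ := c
  obtain ⟨x, y⟩ := z
  have hx : x ∈ Metric.ball a r := by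
    rw [Metric.mem_ball, Prod.dist_eq] at hz; exact (le_max_left _ _).trans_lt hz
  have hy : y ∈ Metric.ball b r := by
    rw [Metric.mem_ball, Prod.dist_eq] at hz; exact (le_max_right _ _).trans_lt hz
  have hball : ∀ u ∈ Metric.closedBall a r, ∀ w ∈ Metric.closedBall b r,
      (u, w) ∈ D := fun u hu w hw => hc (mem_closedBall_prod.2 ⟨hu, hw⟩)
  have hb : b ∈ Metric.closedBall b r := Metric.mem_closedBall_self hr.le
  have ha : a ∈ Metric.closedBall a r := Metric.mem_closedBall_self hr.le
  have hsum : Summable fun m : ℕ × ℕ =>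
      taylorCoeff g m (a, b) * ((x - a) ^ m.1 * (y - b) ^ m.2) := by
    have hx' : ‖x - a‖ / r < 1 := by
      rw [div_lt_one hr, ← dist_eq_norm]; exact hx
    have hy' : ‖y - b‖ / r < 1 := by
      rw [div_lt_one hr, ← dist_eq_norm]; exact hy
    refine Summable.of_norm_bounded ((summable_pow_mul_pow (by positivity) hx' (by positivity)
      hy').mul_left M) fun m => ?_
    rw [norm_mul, norm_mul, norm_pow, norm_pow]
    calc _ ≤ M / r ^ (m.1 + m.2) * (‖x - a‖ ^ m.1 * ‖y - b‖ ^ m.2) := by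
          gcongr
          exact norm_taylorCoeff_le hD hg hr hc hM m
      _ = _ := by rw [pow_add, div_pow, div_pow]; field_simp
  have hrow : ∀ q : ℕ, HasSum (fun p : ℕ =>
      taylorCoeff g (p, q) (a, b) * ((x - a) ^ p * (y - b) ^ q))
      ((dSnd^[q] g) (x, b) / (q ! : ℂ) * (y - b) ^ q) := by
    intro q
    have hd : DifferentiableOn ℂ (fun u => (dSnd^[q] g) (u, b)) (Metric.ball a r) := fun u hu =>
      (analyticAt_slice_fst (analyticOnNhd_iterate_dSnd hg q) (hball u
        (Metric.ball_subset_closedBall hu) b hb)).differentiableAt.differentiableWithinAt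
    have := (Complex.hasSum_taylorSeries_on_ball hd hx).mul_right ((y - b) ^ q / (q ! : ℂ))
    simp only [iteratedDeriv_slice_fst hD (analyticOnNhd_iterate_dSnd hg q) _ (hball a ha b hb),
      smul_eq_mul] at this
    refine hasSum_of_eq this (fun p => ?_) (by ring)
    simp only [taylorCoeff]
    field_simp
  have hcol : HasSum (fun q : ℕ => (dSnd^[q] g) (x, b) / (q ! : ℂ) * (y - b) ^ q) (g (x, y)) := by
    have hx1 := Metric.ball_subset_closedBall hx
    have hd : DifferentiableOn ℂ (fun w => g (x, w)) (Metric.ball b r) := fun w hw =>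
      (analyticAt_slice_snd hg (hball x hx1 w
        (Metric.ball_subset_closedBall hw))).differentiableAt.differentiableWithinAt
    have := Complex.hasSum_taylorSeries_on_ball hd hy
    simp only [iteratedDeriv_slice_snd hD hg _ (hball x hx1 b hb), smul_eq_mul] at this
    refine hasSum_of_eq this (fun q => ?_) rfl
    field_simp
  have hswap := ((Equiv.prodComm ℕ ℕ).hasSum_iff.2 hsum.hasSum).prod_fiberwise hrow
  rw [← hswap.unique hcol]
  exact hsum.hasSum

/-- The coefficients in the Taylor expansion of a Taylor coefficient function. -/
theorem taylorCoeff_taylorCoeff (hD : IsOpen D) (hg : AnalyticOnNhd ℂ g D) (m k : ℕ × ℕ)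
    {z : ℂ × ℂ} (hz : z ∈ D) :
    taylorCoeff (dFst^[m.1] (dSnd^[m.2] g)) k z / ((m.1 ! : ℂ) * (m.2 ! : ℂ)) =
      (((m.1 + k.1).choose k.1 * (m.2 + k.2).choose k.2 : ℕ) : ℂ) * taylorCoeff g (m + k) z := by
  obtain ⟨p, q⟩ := m
  obtain ⟨k, l⟩ := k
  have h1 : (dFst^[k] (dSnd^[l] (dFst^[p] (dSnd^[q] g)))) z =
      (dFst^[p + k] (dSnd^[q + l] g)) z := by
    rw [add_comm p k, add_comm q l, Function.iterate_add_apply, Function.iterate_add_apply]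
    exact eqOn_iterate_dFst hD (eqOn_iterate_dSnd_iterate_dFst hD
      (analyticOnNhd_iterate_dSnd hg q) p l) k hz
  have hp : (((p + k).choose k : ℕ) : ℂ) * (p ! * k !) = ((p + k)! : ℂ) := by
    rw [← Nat.add_choose_mul_factorial_mul_factorial p k]; push_cast; ring
  have hq : (((q + l).choose l : ℕ) : ℂ) * (q ! * l !) = ((q + l)! : ℂ) := by
    rw [← Nat.add_choose_mul_factorial_mul_factorial q l]; push_cast; ring
  simp only [taylorCoeff, Prod.mk_add_mk, h1]
  have hne : ∀ n : ℕ, (n ! : ℂ) ≠ 0 := fun n => by exact_mod_cast n.factorial_ne_zero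
  have hne1 : (((p + k).choose k : ℕ) : ℂ) ≠ 0 := left_ne_zero_of_mul (hp ▸ hne (p + k))
  have hne2 : (((q + l).choose l : ℕ) : ℂ) ≠ 0 := left_ne_zero_of_mul (hq ▸ hne (q + l))
  rw [← hp, ← hq, div_div, Nat.cast_mul, mul_div_assoc', div_eq_div_iff
    (mul_ne_zero (mul_ne_zero (hne _) (hne _)) (mul_ne_zero (hne _) (hne _)))
    (mul_ne_zero (mul_ne_zero hne1 (mul_ne_zero (hne _) (hne _)))
      (mul_ne_zero hne2 (mul_ne_zero (hne _) (hne _))))]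
  ring

/-- The Taylor expansion on a polydisc of the coefficient functions themselves. -/
theorem hasSum_taylorCoeff_taylorCoeff (hD : IsOpen D) (hg : AnalyticOnNhd ℂ g D) {c z : ℂ × ℂ}
    {r : ℝ} (hc : Metric.closedBall c r ⊆ D) (hz : z ∈ Metric.ball c r) (m : ℕ × ℕ) :
    HasSum (fun k : ℕ × ℕ => ((((m.1 + k.1).choose k.1 * (m.2 + k.2).choose k.2 : ℕ) : ℂ) *
      taylorCoeff g (m + k) c) * ((z.1 - c.1) ^ k.1 * (z.2 - c.2) ^ k.2))
      (taylorCoeff g m z) := by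
  have hcD : c ∈ D := hc (Metric.mem_closedBall_self (Metric.pos_of_mem_ball hz).le)
  have := (hasSum_taylorCoeff hD (analyticOnNhd_iterate_dFst (analyticOnNhd_iterate_dSnd hg m.2)
    m.1) hc hz).mul_right ((m.1 ! : ℂ) * (m.2 ! : ℂ))⁻¹
  refine hasSum_of_eq this (fun k => ?_) (div_eq_mul_inv _ _)
  rw [← taylorCoeff_taylorCoeff hD hg m k hcD]
  ring

/-- The Leibniz rule in one variable, for Taylor coefficients. -/
theorem iteratedDeriv_mul_div_factorial {f h : ℂ → ℂ} {x : ℂ} (hf : AnalyticAt ℂ f x)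
    (hh : AnalyticAt ℂ h x) (n : ℕ) :
    iteratedDeriv n (fun y => f y * h y) x / (n ! : ℂ) = ∑ ij ∈ Finset.HasAntidiagonal.antidiagonal n,
      (iteratedDeriv ij.1 f x / (ij.1 ! : ℂ)) * (iteratedDeriv ij.2 h x / (ij.2 ! : ℂ)) := by
  have := iteratedDeriv_mul (n := n) hf.contDiffAt hh.contDiffAt
  change iteratedDeriv n (f * h) x / _ = _
  rw [this, Finset.sum_div, Finset.Nat.sum_antidiagonal_eq_sum_range_succ_mk]
  refine Finset.sum_congr rfl fun i hi => ?_
  have hi' : i ≤ n := Nat.lt_succ_iff.1 (Finset.mem_range.1 hi)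
  have := Nat.choose_mul_factorial_mul_factorial hi'
  have hn : ((n.choose i : ℕ) : ℂ) * (i ! * (n - i)!) = (n ! : ℂ) := by
    rw [← this]; push_cast; ring
  rw [← hn]
  have hne : ((n.choose i : ℕ) : ℂ) ≠ 0 := by exact_mod_cast (Nat.choose_pos hi').ne'
  field_simp

/-- The Leibniz rule: Taylor coefficients of a product are convolutions. -/
theorem taylorCoeff_mul (hD : IsOpen D) (hg : AnalyticOnNhd ℂ g D) (hg' : AnalyticOnNhd ℂ g' D)
    (m : ℕ × ℕ) {z : ℂ × ℂ} (hz : z ∈ D) :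
    taylorCoeff (fun z => g z * g' z) m z =
      ∑ x ∈ Finset.HasAntidiagonal.antidiagonal m, taylorCoeff g x.1 z * taylorCoeff g' x.2 z := by
  obtain ⟨p, q⟩ := m
  obtain ⟨a, b⟩ := z
  rw [sum_antidiagonal_natProd, Finset.sum_comm]
  have hgg' : AnalyticOnNhd ℂ (fun z => g z * g' z) D := hg.mul hg'
  have hrow : ∀ u, (u, b) ∈ D → (dSnd^[q] (fun z => g z * g' z)) (u, b) / (q ! : ℂ) =
      ∑ j ∈ Finset.HasAntidiagonal.antidiagonal q, ((dSnd^[j.1] g) (u, b) / (j.1 ! : ℂ)) *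
        ((dSnd^[j.2] g') (u, b) / (j.2 ! : ℂ)) := by
    intro u hu
    rw [← iteratedDeriv_slice_snd hD hgg' q hu, iteratedDeriv_mul_div_factorial
      (f := fun w => g (u, w)) (h := fun w => g' (u, w))
      (analyticAt_slice_snd hg hu) (analyticAt_slice_snd hg' hu)]
    refine Finset.sum_congr rfl fun j _ => ?_
    rw [iteratedDeriv_slice_snd hD hg _ hu, iteratedDeriv_slice_snd hD hg' _ hu]
  have hev : (fun u => (dSnd^[q] (fun z => g z * g' z)) (u, b) / (q ! : ℂ)) =ᶠ[𝓝 a]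
      fun u => ∑ j ∈ Finset.HasAntidiagonal.antidiagonal q, ((dSnd^[j.1] g) (u, b) / (j.1 ! : ℂ)) *
        ((dSnd^[j.2] g') (u, b) / (j.2 ! : ℂ)) := by
    filter_upwards [(isOpen_slice_fst hD b).mem_nhds hz] with u hu using hrow u hu
  have hA : ∀ j, AnalyticAt ℂ (fun u => (dSnd^[j] g) (u, b) / (j ! : ℂ)) a := fun j =>
    (analyticAt_slice_fst (analyticOnNhd_iterate_dSnd hg j) hz).div_const
  have hA' : ∀ j, AnalyticAt ℂ (fun u => (dSnd^[j] g') (u, b) / (j ! : ℂ)) a := fun j =>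
    (analyticAt_slice_fst (analyticOnNhd_iterate_dSnd hg' j) hz).div_const
  have h0 : taylorCoeff (fun z => g z * g' z) (p, q) (a, b) =
      iteratedDeriv p (fun u => (dSnd^[q] (fun z => g z * g' z)) (u, b) / (q ! : ℂ)) a /
        (p ! : ℂ) := by
    rw [iteratedDeriv_div_const, iteratedDeriv_slice_fst hD (analyticOnNhd_iterate_dSnd hgg' q) p hz,
      taylorCoeff, div_div, mul_comm (q ! : ℂ)]
  rw [h0, hev.iteratedDeriv_eq, iteratedDeriv_fun_sum, Finset.sum_div]
  · refine Finset.sum_congr rfl fun j _ => ?_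
    rw [iteratedDeriv_mul_div_factorial (hA _) (hA' _)]
    refine Finset.sum_congr rfl fun i _ => ?_
    rw [iteratedDeriv_div_const, iteratedDeriv_div_const,
      iteratedDeriv_slice_fst hD (analyticOnNhd_iterate_dSnd hg _) _ hz,
      iteratedDeriv_slice_fst hD (analyticOnNhd_iterate_dSnd hg' _) _ hz]
    simp only [taylorCoeff]
    rw [div_div, div_div, mul_comm (j.1 ! : ℂ), mul_comm (j.2 ! : ℂ)]
  · exact fun j _ => ((hA _).mul (hA' _)).contDiffAt

end

section

open TaggedPartition

/-! ### Power series in left and right multiplications -/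

section Algebra

variable {R : Type*} [NormedRing R] [NormedAlgebra ℂ R]

/-- The operator `Y ↦ x Y y` on a normed algebra. -/
abbrev LR (x y : R) : R →L[ℂ] R := ContinuousLinearMap.mulLeftRight ℂ R x y

theorem norm_LR_le (x y : R) : ‖LR x y‖ ≤ ‖x‖ * ‖y‖ :=
  ContinuousLinearMap.opNorm_mulLeftRight_apply_apply_le ℂ R x y

theorem LR_apply (x y Y : R) : LR x y Y = x * Y * y := rfl

theorem LR_smul_smul (s t : ℂ) (x y : R) : LR (s • x) (t • y) = (s * t) • LR x y := by
  ext Y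
  simp [smul_smul, mul_comm]

theorem LR_sum_sum {ι κ : Type*} (s : Finset ι) (t : Finset κ) (x : ι → R) (y : κ → R) :
    LR (∑ i ∈ s, x i) (∑ j ∈ t, y j) = ∑ i ∈ s, ∑ j ∈ t, LR (x i) (y j) := by
  rw [LR, map_sum, Finset.sum_comm]
  exact Finset.sum_congr rfl fun j _ => by rw [map_sum, sum_apply]

theorem tendsto_LR {ι : Type*} {l : Filter ι} {f f' : ι → R} {x y : R} (hf : Tendsto f l (𝓝 x))
    (hf' : Tendsto f' l (𝓝 y)) : Tendsto (fun i => LR (f i) (f' i)) l (𝓝 (LR x y)) := by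
  have hb : ∀ i, ‖LR (f i) (f' i) - LR x y‖ ≤ ‖f i - x‖ * ‖f' i‖ + ‖x‖ * ‖f' i - y‖ := by
    intro i
    have : LR (f i) (f' i) - LR x y = LR (f i - x) (f' i) + LR x (f' i - y) := by
      rw [LR, LR, LR, LR, map_sub, map_sub, sub_apply]
      abel
    rw [this]
    exact norm_add_le_of_le (norm_LR_le _ _) (norm_LR_le _ _)
  rw [tendsto_iff_norm_sub_tendsto_zero] at hf ⊢
  have h0 := (hf.mul hf'.norm).add (((tendsto_iff_norm_sub_tendsto_zero.1 hf').const_mul ‖x‖))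
  rw [zero_mul, mul_zero, add_zero] at h0
  exact squeeze_zero (fun _ => norm_nonneg _) hb h0

theorem LR_mul_LR (x y x' y' : R) : LR x y * LR x' y' = LR (x * x') (y' * y) := by
  ext Y
  simp [mul_assoc]

theorem smul_LR_mul_smul_LR (s t : ℂ) (x y x' y' : R) :
    (s • LR x y) * (t • LR x' y') = (s * t) • LR (x * x') (y' * y) := by
  ext Y
  simp [mul_assoc, smul_smul, mul_comm]

/-- Summation over `ℕ² × ℕ²` may be performed along antidiagonals. -/
theorem hasSum_sum_antidiagonal {V : Type*} [NormedAddCommGroup V] [CompleteSpace V]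
    {F : (ℕ × ℕ) × (ℕ × ℕ) → V} {s : V} (hF : HasSum F s) :
    HasSum (fun m => ∑ x ∈ Finset.HasAntidiagonal.antidiagonal m, F x) s := by
  have h1 := (Finset.HasAntidiagonal.sigmaAntidiagonalEquivProd (A := ℕ × ℕ)).hasSum_iff.2 hF
  refine h1.sigma fun m => ?_
  rw [← Finset.sum_coe_sort]
  exact hasSum_fintype _

theorem summable_half_pow : Summable fun m : ℕ × ℕ => (1 / 2 : ℝ) ^ m.1 * (1 / 2 : ℝ) ^ m.2 :=
  summable_pow_mul_pow (by norm_num) (by norm_num) (by norm_num) (by norm_num)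

variable [CompleteSpace R]

/-- Rearrangement of a power series in `Nᵢ + Tᵢ` according to powers of the `Nᵢ`. -/
theorem hasSum_binomial {N₁ T₁ e₁ N₂ T₂ e₂ : R} (h₁ : Commute N₁ T₁) (h₂ : Commute N₂ T₂)
    {t : ℕ × ℕ → ℂ} {r M C₁ C₂ : ℝ} (hr : 0 < r) (hM : 0 ≤ M) (hC₁ : 0 ≤ C₁)
    (ht : ∀ m, ‖t m‖ ≤ M / r ^ (m.1 + m.2))
    (hb₁ : ∀ p k, ‖N₁ ^ p * (T₁ ^ k * e₁)‖ ≤ C₁ * (r / 4) ^ (p + k))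
    (hb₂ : ∀ p k, ‖N₂ ^ p * (T₂ ^ k * e₂)‖ ≤ C₂ * (r / 4) ^ (p + k)) :
    HasSum (fun m : ℕ × ℕ => ∑' k : ℕ × ℕ,
      ((((m.1 + k.1).choose k.1 * (m.2 + k.2).choose k.2 : ℕ) : ℂ) * t (m + k)) •
        LR (N₁ ^ m.1 * (T₁ ^ k.1 * e₁)) (N₂ ^ m.2 * (T₂ ^ k.2 * e₂)))
      (∑' m : ℕ × ℕ, t m • LR ((N₁ + T₁) ^ m.1 * e₁) ((N₂ + T₂) ^ m.2 * e₂)) := by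
  set F : (ℕ × ℕ) × (ℕ × ℕ) → (R →L[ℂ] R) := fun x =>
    ((((x.1.1 + x.2.1).choose x.2.1 * (x.1.2 + x.2.2).choose x.2.2 : ℕ) : ℂ) * t (x.1 + x.2)) •
        LR (N₁ ^ x.1.1 * (T₁ ^ x.2.1 * e₁)) (N₂ ^ x.1.2 * (T₂ ^ x.2.2 * e₂)) with hF
  have hsum : Summable F := by
    refine Summable.of_norm_bounded ((summable_half_pow.mul_of_nonneg summable_half_pow
      (fun _ => by positivity) (fun _ => by positivity)).mul_left (M * C₁ * C₂)) fun x => ?_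
    obtain ⟨⟨p, q⟩, k, l⟩ := x
    simp only [hF]
    rw [norm_smul, norm_mul, Complex.norm_natCast]
    have hch : (((p + k).choose k * (q + l).choose l : ℕ) : ℝ) ≤ 2 ^ (p + k) * 2 ^ (q + l) := by
      exact_mod_cast Nat.mul_le_mul (Nat.choose_le_two_pow _ _) (Nat.choose_le_two_pow _ _)
    calc _ ≤ (2 ^ (p + k) * 2 ^ (q + l)) * (M / r ^ (p + k + (q + l))) *
          ((C₁ * (r / 4) ^ (p + k)) * (C₂ * (r / 4) ^ (q + l))) := by
          gcongr
          · exact ht _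
          · exact (norm_LR_le _ _).trans (mul_le_mul (hb₁ _ _) (hb₂ _ _) (norm_nonneg _)
              (by positivity))
      _ = M * C₁ * C₂ * ((2 * (r / 4) / r) ^ (p + k) * (2 * (r / 4) / r) ^ (q + l)) := by
          rw [pow_add r, div_pow _ r, div_pow _ r, mul_pow, mul_pow]
          field_simp
      _ = _ := by
          have : 2 * (r / 4) / r = 1 / 2 := by field_simp; norm_num
          rw [this, pow_add, pow_add]
          ring
  have hfib := hsum.hasSum.prod_fiberwise fun m => (hsum.prod_factor m).hasSum
  have hdiag := hasSum_sum_antidiagonal hsum.hasSum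
  have hval : ∀ m : ℕ × ℕ, ∑ x ∈ Finset.HasAntidiagonal.antidiagonal m, F x =
      t m • LR ((N₁ + T₁) ^ m.1 * e₁) ((N₂ + T₂) ^ m.2 * e₂) := by
    intro m
    rw [sum_antidiagonal_natProd, h₁.add_pow', h₂.add_pow', Finset.sum_mul, Finset.sum_mul,
      LR_sum_sum, Finset.smul_sum]
    refine Finset.sum_congr rfl fun i hi => ?_
    rw [Finset.smul_sum]
    refine Finset.sum_congr rfl fun j hj => ?_
    have hi' := Finset.HasAntidiagonal.mem_antidiagonal.1 hi
    have hj' := Finset.HasAntidiagonal.mem_antidiagonal.1 hj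
    simp only [hF, Prod.mk_add_mk, hi', hj']
    rw [← Nat.cast_smul_eq_nsmul ℂ, ← Nat.cast_smul_eq_nsmul ℂ, smul_mul_assoc, smul_mul_assoc,
      LR_smul_smul, smul_smul, mul_assoc, mul_assoc, Nat.cast_mul, mul_comm (t m)]
    congr 4
    · rw [← hi', Nat.choose_symm_add]
    · rw [← hj', Nat.choose_symm_add]
  simp only [hval] at hdiag
  rw [hdiag.tsum_eq]
  exact hfib

/-- The Cauchy product formula for double series. -/
theorem tsum_mul_tsum_natProd {A : Type*} [NormedRing A] [CompleteSpace A] {f f' : ℕ × ℕ → A}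
    (hf : Summable fun m => ‖f m‖) (hf' : Summable fun m => ‖f' m‖) :
    (∑' m, f m) * (∑' m, f' m) =
      ∑' m, ∑ k ∈ Finset.HasAntidiagonal.antidiagonal m, f k.1 * f' k.2 :=
  hf.of_norm.tsum_mul_tsum_eq_tsum_sum_antidiagonal hf'.of_norm (summable_mul_of_summable_norm hf hf')

/-- The product of two power series in left and right multiplications is the series of the
convolution of the coefficients. -/
theorem tsum_LR_mul_tsum_LR {x e y f : R} (hx : Commute x e) (hy : Commute y f) (he : e * e = e)
    (hf : f * f = f) {t t' : ℕ × ℕ → ℂ}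
    (hs : Summable fun m : ℕ × ℕ => ‖t m • LR (x ^ m.1 * e) (y ^ m.2 * f)‖)
    (hs' : Summable fun m : ℕ × ℕ => ‖t' m • LR (x ^ m.1 * e) (y ^ m.2 * f)‖) :
    (∑' m : ℕ × ℕ, t m • LR (x ^ m.1 * e) (y ^ m.2 * f)) *
      (∑' m : ℕ × ℕ, t' m • LR (x ^ m.1 * e) (y ^ m.2 * f)) =
    ∑' m : ℕ × ℕ, (∑ k ∈ Finset.HasAntidiagonal.antidiagonal m, t k.1 * t' k.2) •
      LR (x ^ m.1 * e) (y ^ m.2 * f) := by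
  refine (tsum_mul_tsum_natProd hs hs').trans (tsum_congr fun m => ?_)
  rw [Finset.sum_smul (R := ℂ) (M := R →L[ℂ] R)]
  refine Finset.sum_congr rfl fun k hk => ?_
  have hk' := Finset.HasAntidiagonal.mem_antidiagonal.1 hk
  rw [smul_LR_mul_smul_LR, ← hk', Prod.fst_add, Prod.snd_add]
  congr 2
  · rw [mul_assoc, ← mul_assoc e, ← (hx.pow_left _).eq, mul_assoc, he, ← mul_assoc, pow_add]
  · rw [mul_assoc, ← mul_assoc f, ← (hy.pow_left _).eq, mul_assoc, hf, ← mul_assoc, add_comm,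
      pow_add]

end Algebra

variable {H : Type*} [NormedAddCommGroup H] [InnerProductSpace ℂ H] [CompleteSpace H]
variable {X X₁ X₂ : H →L[ℂ] H} {E E₁ E₂ : Set ℂ → H →L[ℂ] H} {K₁ K₂ P Q : Set ℂ}

/-- With `N` the quasinilpotent and `S` the scalar part, the products `N^p (S - c)^k` are geometrically
small on the range of the spectral projection of a small set around `c`. -/
theorem IsSpectralResolution.exists_norm_nilPart_pow_mul_le (h : IsSpectralResolution X E) {ρ : ℝ}
    (hρ : 0 < ρ) : ∃ C : ℝ, 0 ≤ C ∧ ∀ (P : Set ℂ) (c : ℂ), MeasurableSet P →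
      P ⊆ Metric.closedBall c (ρ / 2) → ∀ p k : ℕ,
      ‖h.nilPart ^ p * ((h.scalarPart - c • 1) ^ k * E P)‖ ≤ C * ρ ^ (p + k) := by
  obtain ⟨C, hC0, hC⟩ := h.exists_norm_nilPart_pow_le hρ
  obtain ⟨C', hC0', hC'⟩ := h.exists_norm_scalarPart_pow_le
  refine ⟨C * C', by positivity, fun P c hP hPc p k => ?_⟩
  calc _ ≤ ‖h.nilPart ^ p‖ * ‖(h.scalarPart - c • 1) ^ k * E P‖ := norm_mul_le _ _
    _ ≤ (C * ρ ^ p) * (C' * ρ ^ k) := by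
        gcongr
        · exact hC p
        · exact hC' P c ρ hρ hP hPc k
    _ = _ := by rw [pow_add]; ring

theorem IsSpectralResolution.commute_nilPart_scalarPart_sub (h : IsSpectralResolution X E)
    (c : ℂ) : Commute h.nilPart (h.scalarPart - c • 1) :=
  h.commute_nilPart_scalarPart.sub_right ((Commute.one_right _).smul_right _)

theorem IsSpectralResolution.nilPart_add_scalarPart_sub (h : IsSpectralResolution X E) (c : ℂ) :
    h.nilPart + (h.scalarPart - c • 1) = X - c • 1 := by
  rw [nilPart]; abel

/-- On the range of the spectral projection of a set of radius `ρ / 2` around `c`, the powers of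
`X - c` grow at most like those of `2 ρ`. -/
theorem IsSpectralResolution.exists_norm_sub_pow_mul_le (h : IsSpectralResolution X E) {ρ : ℝ}
    (hρ : 0 < ρ) : ∃ C : ℝ, 0 ≤ C ∧ ∀ (P : Set ℂ) (c : ℂ), MeasurableSet P →
      P ⊆ Metric.closedBall c (ρ / 2) → ∀ n : ℕ, ‖(X - c • 1) ^ n * E P‖ ≤ C * (2 * ρ) ^ n := by
  obtain ⟨C, hC0, hC⟩ := h.exists_norm_nilPart_pow_mul_le hρ
  refine ⟨C, hC0, fun P c hP hPc n => ?_⟩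
  rw [← h.nilPart_add_scalarPart_sub, (h.commute_nilPart_scalarPart_sub c).add_pow, Finset.sum_mul]
  calc _ ≤ ∑ m ∈ Finset.range (n + 1), C * ρ ^ n * (n.choose m : ℝ) := by
        refine norm_sum_le_of_le _ fun m hm => ?_
        have hm' : m + (n - m) = n := by have := Finset.mem_range.1 hm; omega
        rw [← nsmul_eq_mul', smul_mul_assoc, mul_assoc, ← Nat.cast_smul_eq_nsmul ℂ, norm_smul,
          Complex.norm_natCast, mul_comm]
        gcongr
        have := hC P c hP hPc m (n - m)
        rwa [hm'] at this
    _ = _ := by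
        rw [← Finset.mul_sum, ← Nat.cast_sum, Nat.sum_range_choose, mul_pow]
        push_cast; ring

/-! ### Convergence of double integrals -/

/-- Tags of cells meeting a small set `P` are close to the centre of `P`. -/
theorem TaggedPartition.FinerThan.tag_mem_closedBall {K : Set ℂ} {π : TaggedPartition K} {c : ℂ}
    {ρ : ℝ} (hπ : π.FinerThan (ρ / 2)) (hPc : P ⊆ Metric.closedBall c (ρ / 2)) {i : Fin π.n}
    (hi : (π.cell i ∩ P).Nonempty) : π.tag i ∈ Metric.closedBall c ρ := by
  obtain ⟨z, hz1, hz2⟩ := hi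
  have h1 := hπ i (π.tag i) (π.tag_mem i) z hz1
  have h2 := Metric.mem_closedBall.1 (hPc hz2)
  rw [Metric.mem_closedBall]
  linarith [dist_triangle (π.tag i) z c]

/-- A bound on the Riemann sums of `(λ - c)^k (X - λ)^p` over a small set which holds for all fine
partitions and all `k` simultaneously. -/
theorem IsSpectralResolution.exists_eventually_norm_riemann_pow_le (h : IsSpectralResolution X E)
    {K : Set ℂ} (hK : MeasurableSet K) (hKX : K ⊆ spectrum ℂ X) (hP : MeasurableSet P) {c : ℂ}
    {ρ : ℝ} (hρ : 0 < ρ) (hPc : P ⊆ Metric.closedBall c (ρ / 2)) (p : ℕ) :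
    ∃ C : ℝ, 0 ≤ C ∧ ∀ᶠ π in fine K, ∀ k : ℕ,
      ‖(X - TaggedPartition.riemann π E) ^ p * ((TaggedPartition.riemann π E - c • 1) ^ k *
        E (K ∩ P))‖ ≤ C * ρ ^ k := by
  obtain ⟨C, hC0, hC⟩ := h.exists_norm_riemann_pow_le
  have hl := (((tendsto_const_nhds (x := X)).sub (h.tendsto_riemann hK hKX)).pow p).norm
  set L := ‖(X - h.scalarPart * E K) ^ p‖
  refine ⟨(L + 1) * C, by positivity, ?_⟩
  filter_upwards [hl.eventually (gt_mem_nhds (lt_add_one L)),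
    eventually_finerThan K (half_pos hρ)] with π hπ1 hπ2 k
  calc _ ≤ ‖(X - TaggedPartition.riemann π E) ^ p‖ *
        ‖(TaggedPartition.riemann π E - c • 1) ^ k * E (K ∩ P)‖ := norm_mul_le _ _
    _ ≤ (L + 1) * (C * ρ ^ k) := by
        gcongr
        exact hC K P π c ρ hρ hP hPc hπ2 k
    _ = _ := by ring

/-- The part of a double Riemann sum over `P × Q`, where the coefficient function has a power
series expansion, converges: expand, use that Riemann sums are multiplicative, and pass to the
limit under the sum. -/
theorem tendsto_doubleRiemann_inter (h₁ : IsSpectralResolution X₁ E₁)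
    (h₂ : IsSpectralResolution X₂ E₂) (hK₁ : MeasurableSet K₁) (hK₁X : K₁ ⊆ spectrum ℂ X₁)
    (hK₂ : MeasurableSet K₂) (hK₂X : K₂ ⊆ spectrum ℂ X₂) {a b : ℂ} {ρ : ℝ} (hρ : 0 < ρ)
    (hP : MeasurableSet P) (hPa : P ⊆ Metric.closedBall a (ρ / 2))
    (hQ : MeasurableSet Q) (hQb : Q ⊆ Metric.closedBall b (ρ / 2))
    {c : ℂ → ℂ → ℂ} {d : ℕ × ℕ → ℂ}
    (hc : ∀ x ∈ Metric.closedBall a ρ, ∀ y ∈ Metric.closedBall b ρ,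
      HasSum (fun k : ℕ × ℕ => d k * ((x - a) ^ k.1 * (y - b) ^ k.2)) (c x y))
    (hd : Summable fun k : ℕ × ℕ => ‖d k‖ * (ρ ^ k.1 * ρ ^ k.2)) (p q : ℕ) :
    Tendsto (fun π : TaggedPartition K₁ × TaggedPartition K₂ =>
      ∑ i, ∑ j, c (π.1.tag i) (π.2.tag j) •
        LR (shiftPow X₁ p (π.1.tag i) * E₁ (π.1.cell i ∩ P))
          (shiftPow X₂ q (π.2.tag j) * E₂ (π.2.cell j ∩ Q)))
      (fine K₁ ×ˢ fine K₂)
      (𝓝 (∑' k : ℕ × ℕ, d k •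
        LR (h₁.nilPart ^ p * ((h₁.scalarPart - a • 1) ^ k.1 * E₁ (K₁ ∩ P)))
          (h₂.nilPart ^ q * ((h₂.scalarPart - b • 1) ^ k.2 * E₂ (K₂ ∩ Q))))) := by
  let W₁ : TaggedPartition K₁ → ℕ → H →L[ℂ] H := fun π k =>
    (X₁ - π.riemann E₁) ^ p * ((π.riemann E₁ - a • 1) ^ k * E₁ (K₁ ∩ P))
  let W₂ : TaggedPartition K₂ → ℕ → H →L[ℂ] H := fun π k =>
    (X₂ - π.riemann E₂) ^ q * ((π.riemann E₂ - b • 1) ^ k * E₂ (K₂ ∩ Q))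
  have ev₁ := (eventually_finerThan K₁ (half_pos hρ)).prod_inl (fine K₂)
  have ev₂ := (eventually_finerThan K₂ (half_pos hρ)).prod_inr (fine K₁)
  have heq : (fun π : TaggedPartition K₁ × TaggedPartition K₂ =>
      ∑' k : ℕ × ℕ, d k • LR (W₁ π.1 k.1) (W₂ π.2 k.2)) =ᶠ[fine K₁ ×ˢ fine K₂]
      fun π => ∑ i, ∑ j, c (π.1.tag i) (π.2.tag j) •
        LR (shiftPow X₁ p (π.1.tag i) * E₁ (π.1.cell i ∩ P))
          (shiftPow X₂ q (π.2.tag j) * E₂ (π.2.cell j ∩ Q)) := by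
    filter_upwards [ev₁, ev₂] with π hπ₁ hπ₂
    refine HasSum.tsum_eq ?_
    have hterm : ∀ i j, HasSum (fun k : ℕ × ℕ => d k •
        LR ((π.1.tag i - a) ^ k.1 • (shiftPow X₁ p (π.1.tag i) * E₁ (π.1.cell i ∩ P)))
          ((π.2.tag j - b) ^ k.2 • (shiftPow X₂ q (π.2.tag j) * E₂ (π.2.cell j ∩ Q))))
        (c (π.1.tag i) (π.2.tag j) •
        LR (shiftPow X₁ p (π.1.tag i) * E₁ (π.1.cell i ∩ P))
          (shiftPow X₂ q (π.2.tag j) * E₂ (π.2.cell j ∩ Q))) := by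
      intro i j
      rcases (π.1.cell i ∩ P).eq_empty_or_nonempty with he | hne₁
      · simp [he, h₁.map_empty, LR]
      rcases (π.2.cell j ∩ Q).eq_empty_or_nonempty with he | hne₂
      · simp [he, h₂.map_empty, LR]
      have := (hc _ (hπ₁.tag_mem_closedBall hPa hne₁) _ (hπ₂.tag_mem_closedBall hQb hne₂)).smul_const
        (LR (shiftPow X₁ p (π.1.tag i) * E₁ (π.1.cell i ∩ P))
          (shiftPow X₂ q (π.2.tag j) * E₂ (π.2.cell j ∩ Q)))
      refine hasSum_of_eq this (fun k => ?_) rfl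
      rw [LR_smul_smul, smul_smul]
    refine hasSum_of_eq (hasSum_sum fun i _ => hasSum_sum fun j _ => hterm i j) (fun k => ?_) rfl
    simp only [W₁, W₂]
    rw [← h₁.sum_pow_smul_shiftPow_mul _ hP, ← h₂.sum_pow_smul_shiftPow_mul _ hQ, LR_sum_sum,
      Finset.smul_sum]
    exact Finset.sum_congr rfl fun i _ => Finset.smul_sum
  refine Tendsto.congr' heq ?_
  -- dominated convergence
  obtain ⟨C₁, hC₁0, hC₁⟩ := h₁.exists_eventually_norm_riemann_pow_le hK₁ hK₁X hP hρ hPa p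
  obtain ⟨C₂, hC₂0, hC₂⟩ := h₂.exists_eventually_norm_riemann_pow_le hK₂ hK₂X hQ hρ hQb q
  refine tendsto_tsum_of_dominated_convergence (hd.mul_left (C₁ * C₂)) (fun k => ?_) ?_
  · have t1 := (h₁.tendsto_riemann_pow hK₁ hK₁X hP a p k.1).comp
      (tendsto_fst (f := fine K₁) (g := fine K₂))
    have t2 := (h₂.tendsto_riemann_pow hK₂ hK₂X hQ b q k.2).comp
      (tendsto_snd (f := fine K₁) (g := fine K₂))
    exact (tendsto_LR t1 t2).const_smul (d k)
  · filter_upwards [hC₁.prod_inl (fine K₂), hC₂.prod_inr (fine K₁)] with π hπ₁ hπ₂ k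
    rw [norm_smul]
    calc _ ≤ ‖d k‖ * ((C₁ * ρ ^ k.1) * (C₂ * ρ ^ k.2)) := by
          gcongr
          exact (norm_LR_le _ _).trans (mul_le_mul (hπ₁ _) (hπ₂ _) (norm_nonneg _) (by positivity))
      _ = _ := by ring

/-! ### The transformer as a finite sum of power series -/

/-- The power series `∑ g_{m,n} (X₁ - a)^m E₁(P) Y (X₂ - b)^n E₂(Q)` with the Taylor coefficients of
`g` at `(a, b)`, as an operator in `Y`. -/
def localOp (X₁ : H →L[ℂ] H) (E₁ : Set ℂ → H →L[ℂ] H) (X₂ : H →L[ℂ] H)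
    (E₂ : Set ℂ → H →L[ℂ] H) (g : ℂ × ℂ → ℂ) (a b : ℂ) (P Q : Set ℂ) :
    (H →L[ℂ] H) →L[ℂ] (H →L[ℂ] H) :=
  ∑' m : ℕ × ℕ, taylorCoeff g m (a, b) •
    LR ((X₁ - a • 1) ^ m.1 * E₁ P) ((X₂ - b • 1) ^ m.2 * E₂ Q)

/-- The sum of the local power series over the cells of a grid, expanded around the tags. -/
def gridOp (X₁ : H →L[ℂ] H) (E₁ : Set ℂ → H →L[ℂ] H) (X₂ : H →L[ℂ] H)
    (E₂ : Set ℂ → H →L[ℂ] H) (g : ℂ × ℂ → ℂ) (π₁ : TaggedPartition K₁)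
    (π₂ : TaggedPartition K₂) : (H →L[ℂ] H) →L[ℂ] (H →L[ℂ] H) :=
  ∑ i, ∑ j, localOp X₁ E₁ X₂ E₂ g (π₁.tag i) (π₂.tag j) (π₁.cell i) (π₂.cell j)

variable {D : Set (ℂ × ℂ)} {g : ℂ × ℂ → ℂ}

theorem summable_norm_localOp (h₁ : IsSpectralResolution X₁ E₁) (h₂ : IsSpectralResolution X₂ E₂)
    (hD : IsOpen D) (hg : AnalyticOnNhd ℂ g D) {a b : ℂ} {r : ℝ} (hr : 0 < r)
    (hab : Metric.closedBall (a, b) r ⊆ D)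
    (hP : MeasurableSet P) (hPa : P ⊆ Metric.closedBall a (r / 8))
    (hQ : MeasurableSet Q) (hQb : Q ⊆ Metric.closedBall b (r / 8)) :
    Summable fun m : ℕ × ℕ => ‖taylorCoeff g m (a, b) •
      LR ((X₁ - a • 1) ^ m.1 * E₁ P) ((X₂ - b • 1) ^ m.2 * E₂ Q)‖ := by
  obtain ⟨M, hM⟩ := (isCompact_closedBall (a, b) r).exists_bound_of_continuousOn
    (hg.continuousOn.mono hab)
  -- on a cell of radius `r / 8` the powers grow at most like `(r / 2)^m`, the coefficients like `r^(-m)`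
  obtain ⟨C₁, hC₁0, hC₁⟩ := h₁.exists_norm_sub_pow_mul_le (show 0 < r / 4 by positivity)
  obtain ⟨C₂, hC₂0, hC₂⟩ := h₂.exists_norm_sub_pow_mul_le (show 0 < r / 4 by positivity)
  have h8 : r / 4 / 2 = r / 8 := by ring
  rw [h8] at hC₁ hC₂
  refine Summable.of_nonneg_of_le (fun _ => norm_nonneg _) (fun m => ?_)
    (summable_half_pow.mul_left (M * C₁ * C₂))
  rw [norm_smul]
  calc _ ≤ M / r ^ (m.1 + m.2) * ((C₁ * (2 * (r / 4)) ^ m.1) * (C₂ * (2 * (r / 4)) ^ m.2)) := by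
        gcongr
        · exact (norm_nonneg _).trans (norm_taylorCoeff_le hD hg hr hab hM m)
        · exact norm_taylorCoeff_le hD hg hr hab hM m
        · exact (norm_LR_le _ _).trans (mul_le_mul (hC₁ P a hP hPa _) (hC₂ Q b hQ hQb _)
            (norm_nonneg _) (by positivity))
    _ = M * C₁ * C₂ * ((2 * (r / 4) / r) ^ m.1 * (2 * (r / 4) / r) ^ m.2) := by
        rw [pow_add, div_pow _ r, div_pow _ r]; field_simp
    _ = _ := by
        have : 2 * (r / 4) / r = 1 / 2 := by field_simp; norm_num
        rw [this]

/-- On a small cell, the double integrals of all Taylor coefficient functions exist, and their sum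
is the power series of `g` at the centre of the cell. -/
theorem exists_tendsto_and_hasSum_localOp (h₁ : IsSpectralResolution X₁ E₁)
    (h₂ : IsSpectralResolution X₂ E₂) (hD : IsOpen D) (hg : AnalyticOnNhd ℂ g D) {a b : ℂ} {r : ℝ}
    (hr : 0 < r) (hab : Metric.closedBall (a, b) r ⊆ D)
    (hP : MeasurableSet P) (hPa : P ⊆ Metric.closedBall a (r / 8))
    (hQ : MeasurableSet Q) (hQb : Q ⊆ Metric.closedBall b (r / 8)) :
    ∃ J : ℕ × ℕ → (H →L[ℂ] H) →L[ℂ] (H →L[ℂ] H),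
      (∀ p q, Tendsto (fun π : TaggedPartition (orderAbove X₁ E₁ p) ×
          TaggedPartition (orderAbove X₂ E₂ q) =>
        ∑ i, ∑ j, taylorCoeff g (p, q) (π.1.tag i, π.2.tag j) •
          LR (shiftPow X₁ p (π.1.tag i) * E₁ (π.1.cell i ∩ P))
            (shiftPow X₂ q (π.2.tag j) * E₂ (π.2.cell j ∩ Q)))
        (fine (orderAbove X₁ E₁ p) ×ˢ fine (orderAbove X₂ E₂ q)) (𝓝 (J (p, q)))) ∧
      HasSum J (localOp X₁ E₁ X₂ E₂ g a b P Q) := by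
  obtain ⟨M, hM⟩ := (isCompact_closedBall (a, b) r).exists_bound_of_continuousOn
    (hg.continuousOn.mono hab)
  have hM0 : 0 ≤ M := (norm_nonneg _).trans (hM _ (Metric.mem_closedBall_self hr.le))
  have ht := norm_taylorCoeff_le hD hg hr hab hM
  have hr4 : 0 < r / 4 := by positivity
  have h8 : r / 4 / 2 = r / 8 := by ring
  obtain ⟨C₁, hC₁0, hC₁⟩ := h₁.exists_norm_nilPart_pow_mul_le hr4
  obtain ⟨C₂, hC₂0, hC₂⟩ := h₂.exists_norm_nilPart_pow_mul_le hr4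
  rw [h8] at hC₁ hC₂
  refine ⟨fun m => ∑' k : ℕ × ℕ,
      ((((m.1 + k.1).choose k.1 * (m.2 + k.2).choose k.2 : ℕ) : ℂ) *
        taylorCoeff g (m + k) (a, b)) •
        LR (h₁.nilPart ^ m.1 * ((h₁.scalarPart - a • 1) ^ k.1 * E₁ P))
          (h₂.nilPart ^ m.2 * ((h₂.scalarPart - b • 1) ^ k.2 * E₂ Q)), fun p q => ?_, ?_⟩
  · have hO : ∀ {X : H →L[ℂ] H} {E : Set ℂ → H →L[ℂ] H} (h : IsSpectralResolution X E) {P : Set ℂ}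
        (_ : MeasurableSet P) (a : ℂ) (p k : ℕ),
        h.nilPart ^ p * ((h.scalarPart - a • 1) ^ k * E (orderAbove X E p ∩ P)) =
          h.nilPart ^ p * ((h.scalarPart - a • 1) ^ k * E P) := by
      intro X E h P hP a p k
      have hc := (h.commute_nilPart_scalarPart_sub a).pow_pow p k
      rw [← mul_assoc, ← mul_assoc, hc.eq, mul_assoc, mul_assoc,
        h.nilPart_pow_mul_map_orderAbove_inter p hP]
    have := tendsto_doubleRiemann_inter h₁ h₂
      (IsSpectralResolution.measurableSet_orderAbove X₁ E₁ p)
      (IsSpectralResolution.orderAbove_subset X₁ E₁ p)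
      (IsSpectralResolution.measurableSet_orderAbove X₂ E₂ q)
      (IsSpectralResolution.orderAbove_subset X₂ E₂ q)
      hr4 hP (h8 ▸ hPa) hQ (h8 ▸ hQb) (c := fun x y => taylorCoeff g (p, q) (x, y))
      (d := fun k => (((p + k.1).choose k.1 * (q + k.2).choose k.2 : ℕ) : ℂ) *
        taylorCoeff g ((p, q) + k) (a, b))
      (fun x hx y hy => hasSum_taylorCoeff_taylorCoeff hD hg hab
        (z := (x, y)) (Metric.closedBall_subset_ball (by linarith : r / 4 < r)
          (mem_closedBall_prod.2 ⟨hx, hy⟩)) (p, q)) ?_ p q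
    · simpa only [hO h₁ hP, hO h₂ hQ] using this
    · refine Summable.of_nonneg_of_le (fun _ => by positivity) (fun k => ?_)
        (summable_half_pow.mul_left (2 ^ (p + q) * (M / r ^ (p + q))))
      have hch : (((p + k.1).choose k.1 * (q + k.2).choose k.2 : ℕ) : ℝ) ≤
          2 ^ (p + k.1) * 2 ^ (q + k.2) := by
        exact_mod_cast Nat.mul_le_mul (Nat.choose_le_two_pow _ _) (Nat.choose_le_two_pow _ _)
      rw [norm_mul, Complex.norm_natCast]
      calc _ ≤ (2 ^ (p + k.1) * 2 ^ (q + k.2)) * (M / r ^ (p + k.1 + (q + k.2))) *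
            ((r / 4) ^ k.1 * (r / 4) ^ k.2) := by
            gcongr
            exact ht _
        _ = 2 ^ (p + q) * (M / r ^ (p + q)) *
            ((2 * (r / 4) / r) ^ k.1 * (2 * (r / 4) / r) ^ k.2) := by
            rw [div_pow _ r, div_pow _ r, mul_pow, mul_pow]
            simp only [pow_add]
            field_simp
        _ = _ := by
            have : 2 * (r / 4) / r = 1 / 2 := by field_simp; norm_num
            rw [this]
  · have := hasSum_binomial (h₁.commute_nilPart_scalarPart_sub a)
      (h₂.commute_nilPart_scalarPart_sub b) hr hM0 hC₁0 ht (hC₁ P a hP hPa) (hC₂ Q b hQ hQb)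
    simpa only [localOp, h₁.nilPart_add_scalarPart_sub, h₂.nilPart_add_scalarPart_sub] using this

end

section

open TaggedPartition

variable {H : Type*} [NormedAddCommGroup H] [InnerProductSpace ℂ H] [CompleteSpace H]
variable {X X₁ X₂ : H →L[ℂ] H} {E E₁ E₂ : Set ℂ → H →L[ℂ] H} {K K₁ K₂ P Q : Set ℂ}
variable {D : Set (ℂ × ℂ)} {g g' : ℂ × ℂ → ℂ}

/-! ### Existence and uniqueness of the generalized double operator integral -/

theorem analyticOnNhd_zeroExt (hD : IsOpen D) (β : Holo D) : AnalyticOnNhd ℂ (zeroExt β) D := by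
  obtain ⟨g, hg, he⟩ := β.2
  refine hg.congr hD fun z hz => ?_
  rw [zeroExt, dif_pos hz]
  exact he ⟨z, hz⟩

theorem zeroExt_of_mem (β : Holo D) {z : ℂ × ℂ} (hz : z ∈ D) :
    zeroExt β z = (β : D → ℂ) ⟨z, hz⟩ := dif_pos hz

theorem partialDeriv_eq (hD : IsOpen D) (β : Holo D) (p q : ℕ) {u w : ℂ} (h : (u, w) ∈ D) :
    partialDeriv β p q u w = (dFst^[p] (dSnd^[q] (zeroExt β))) (u, w) :=
  iteratedDeriv_iteratedDeriv_slice hD (analyticOnNhd_zeroExt hD β) p q h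

theorem partialDeriv_div_eq (hD : IsOpen D) (β : Holo D) (p q : ℕ) {u w : ℂ} (h : (u, w) ∈ D) :
    partialDeriv β p q u w / ((p ! : ℂ) * (q ! : ℂ)) = taylorCoeff (zeroExt β) (p, q) (u, w) := by
  rw [partialDeriv_eq hD β p q h]; rfl

theorem TaggedPartition.FinerThan.cell_subset_closedBall {π : TaggedPartition K} {δ : ℝ}
    (h : π.FinerThan δ) (i : Fin π.n) : π.cell i ⊆ Metric.closedBall (π.tag i) δ :=
  fun z hz => h i z hz _ (π.tag_mem i)

/-- All polydiscs of radius `r` around points of `σ(X₁) × σ(X₂)` are contained in `D`, and the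
partitions of the two spectra have mesh at most `r / 8`, small enough for the local power series
around the tags to converge. -/
structure IsGrid (X₁ X₂ : H →L[ℂ] H) (D : Set (ℂ × ℂ)) (r : ℝ)
    (π₁ : TaggedPartition (spectrum ℂ X₁)) (π₂ : TaggedPartition (spectrum ℂ X₂)) : Prop where
  pos : 0 < r
  closedBall_subset : ∀ a ∈ spectrum ℂ X₁, ∀ b ∈ spectrum ℂ X₂, Metric.closedBall (a, b) r ⊆ D
  fine₁ : π₁.FinerThan (r / 8)
  fine₂ : π₂.FinerThan (r / 8)

theorem exists_radius (X₁ X₂ : H →L[ℂ] H) (hD : IsOpen D)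
    (hXD : spectrum ℂ X₁ ×ˢ spectrum ℂ X₂ ⊆ D) : ∃ r : ℝ, 0 < r ∧
      ∀ a ∈ spectrum ℂ X₁, ∀ b ∈ spectrum ℂ X₂, Metric.closedBall (a, b) r ⊆ D := by
  obtain ⟨r, hr, h⟩ := ((spectrum.isCompact X₁).prod
    (spectrum.isCompact X₂)).exists_cthickening_subset_open hD hXD
  exact ⟨r, hr, fun a ha b hb =>
    (Metric.closedBall_subset_cthickening (mk_mem_prod ha hb) r).trans h⟩

theorem IsSpectralResolution.sum_map_inter_cell (h : IsSpectralResolution X E)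
    (π : TaggedPartition (spectrum ℂ X)) {A : Set ℂ} (hA : MeasurableSet A) :
    ∑ i, E (A ∩ π.cell i) = E A := by
  rw [← h.map_inter_spectrum hA, inter_comm, ← h.sum_map_cell_inter π hA]
  exact Finset.sum_congr rfl fun i _ => by rw [inter_comm]

variable {r : ℝ} {π₁ : TaggedPartition (spectrum ℂ X₁)} {π₂ : TaggedPartition (spectrum ℂ X₂)}

/-- The integrals of all admissible coefficient families exist; their sum is given by the local
power series over any fine grid. -/
theorem IsGrid.hasCombination (hG : IsGrid X₁ X₂ D r π₁ π₂) (h₁ : IsSpectralResolution X₁ E₁)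
    (h₂ : IsSpectralResolution X₂ E₂) (hD : IsOpen D) {β : Holo D} {c : ℕ → ℕ → ℂ → ℂ → ℂ}
    (hc : IsCoeffFamily X₁ X₂ β c) (Y : H →L[ℂ] H) :
    HasCombination X₁ E₁ X₂ E₂ c Y (gridOp X₁ E₁ X₂ E₂ (zeroExt β) π₁ π₂ Y) := by
  have hg := analyticOnNhd_zeroExt hD β
  have hsub := fun i j => hG.closedBall_subset _ (π₁.tag_mem' i) _ (π₂.tag_mem' j)
  choose J hJ hJs using fun i j => exists_tendsto_and_hasSum_localOp h₁ h₂ hD hg hG.pos (hsub i j)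
    (π₁.measurable_cell i) (hG.fine₁.cell_subset_closedBall i) (π₂.measurable_cell j)
    (hG.fine₂.cell_subset_closedBall j)
  let ev := ContinuousLinearMap.apply ℂ (H →L[ℂ] H) Y
  refine ⟨fun m => ev (∑ i, ∑ j, J i j m), fun p q => ?_,
    (hasSum_sum fun i _ => hasSum_sum fun j _ => hJs i j).mapL ev⟩
  rw [hasDoubleSpectralIntegral_iff_tendsto]
  have hlim := tendsto_finsetSum Finset.univ fun i _ =>
    tendsto_finsetSum Finset.univ fun j _ => hJ i j p q
  refine Tendsto.congr (fun π => ?_) ((ev.continuous.tendsto _).comp hlim)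
  simp only [Function.comp_apply, ev, ContinuousLinearMap.apply_apply, sum_apply, smul_apply,
    LR_apply]
  -- interchange the sums over the grid and over the partition
  have hswap : ∀ {A B C D : ℕ} (f : Fin A → Fin B → Fin C → Fin D → H →L[ℂ] H),
      ∑ i, ∑ j, ∑ k, ∑ l, f i j k l = ∑ k, ∑ l, ∑ i, ∑ j, f i j k l := by
    intro A B C D f
    simp_rw [Finset.sum_comm (s := (Finset.univ : Finset (Fin B)))]
    rw [Finset.sum_comm]
    refine Finset.sum_congr rfl fun k _ => ?_
    rw [Finset.sum_comm]
  rw [hswap]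
  refine Finset.sum_congr rfl fun k _ => Finset.sum_congr rfl fun l _ => ?_
  have hk := (π.1.tag_mem' k).1
  have hl := (π.2.tag_mem' l).1
  have hkl : (π.1.tag k, π.2.tag l) ∈ D := hG.closedBall_subset _ hk _ hl
    (Metric.mem_closedBall_self hG.pos.le)
  rw [hc p q _ hk _ hl, partialDeriv_div_eq hD β p q hkl]
  simp_rw [← Finset.smul_sum]
  congr 1
  conv_rhs => rw [← h₁.sum_map_inter_cell π₁ (π.1.measurable_cell k),
    ← h₂.sum_map_inter_cell π₂ (π.2.measurable_cell l)]
  simp only [Finset.mul_sum, Finset.sum_mul]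
  exact Finset.sum_comm

theorem hasCombination_unique {c : ℕ → ℕ → ℂ → ℂ → ℂ} {Y S S' : H →L[ℂ] H}
    (h : HasCombination X₁ E₁ X₂ E₂ c Y S) (h' : HasCombination X₁ E₁ X₂ E₂ c Y S') : S = S' := by
  obtain ⟨J, hJ, hS⟩ := h
  obtain ⟨J', hJ', hS'⟩ := h'
  have : J = J' := by
    ext1 ⟨p, q⟩
    have n₁ := IsSpectralResolution.fine_neBot_of_subset
      (IsSpectralResolution.measurableSet_orderAbove X₁ E₁ p)
      (IsSpectralResolution.orderAbove_subset X₁ E₁ p)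
    have n₂ := IsSpectralResolution.fine_neBot_of_subset
      (IsSpectralResolution.measurableSet_orderAbove X₂ E₂ q)
      (IsSpectralResolution.orderAbove_subset X₂ E₂ q)
    exact tendsto_nhds_unique (hasDoubleSpectralIntegral_iff_tendsto.1 (hJ p q))
      (hasDoubleSpectralIntegral_iff_tendsto.1 (hJ' p q))
  subst this
  exact hS.unique hS'

theorem IsGrid.hasGDOI_iff (hG : IsGrid X₁ X₂ D r π₁ π₂) (h₁ : IsSpectralResolution X₁ E₁)
    (h₂ : IsSpectralResolution X₂ E₂) (hD : IsOpen D) (β : Holo D) (Y S : H →L[ℂ] H) :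
    HasGDOI X₁ E₁ X₂ E₂ β Y S ↔ S = gdoi X₁ E₁ X₂ E₂ β Y := by
  have hex : ∃ S, HasGDOI X₁ E₁ X₂ E₂ β Y S :=
    ⟨_, hG.hasCombination h₁ h₂ hD (fun _ _ _ _ _ _ => rfl) Y⟩
  rw [gdoi, dif_pos hex]
  constructor
  · exact fun h => hasCombination_unique h hex.choose_spec
  · rintro rfl
    exact hex.choose_spec

theorem IsGrid.gdoi_eq (hG : IsGrid X₁ X₂ D r π₁ π₂) (h₁ : IsSpectralResolution X₁ E₁)
    (h₂ : IsSpectralResolution X₂ E₂) (hD : IsOpen D) (β : Holo D) (Y : H →L[ℂ] H) :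
    gdoi X₁ E₁ X₂ E₂ β Y = gridOp X₁ E₁ X₂ E₂ (zeroExt β) π₁ π₂ Y :=
  ((hG.hasGDOI_iff h₁ h₂ hD β Y _).1
    (hG.hasCombination h₁ h₂ hD (fun _ _ _ _ _ _ => rfl) Y)).symm

/-! ### Multiplicativity -/

theorem taylorCoeff_congr (hD : IsOpen D) (h : EqOn g g' D) (m : ℕ × ℕ) {z : ℂ × ℂ} (hz : z ∈ D) :
    taylorCoeff g m z = taylorCoeff g' m z := by
  rw [taylorCoeff, taylorCoeff, eqOn_iterate_dFst hD (eqOn_iterate_dSnd hD h m.2) m.1 hz]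

theorem taylorCoeff_add (hD : IsOpen D) (hg : AnalyticOnNhd ℂ g D) (hg' : AnalyticOnNhd ℂ g' D)
    (m : ℕ × ℕ) {z : ℂ × ℂ} (hz : z ∈ D) :
    taylorCoeff (fun z => g z + g' z) m z = taylorCoeff g m z + taylorCoeff g' m z := by
  have h2 : ∀ q, EqOn (dSnd^[q] fun z => g z + g' z)
      (fun z => (dSnd^[q] g) z + (dSnd^[q] g') z) D := by
    intro q
    induction q with
    | zero => exact fun _ _ => rfl
    | succ q ih =>
      simp only [Function.iterate_succ_apply']
      refine (eqOn_dSnd hD ih).trans fun z hz => ?_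
      rw [dSnd, fderiv_fun_add (analyticOnNhd_iterate_dSnd hg q z hz).differentiableAt
        (analyticOnNhd_iterate_dSnd hg' q z hz).differentiableAt]
      rfl
  have h1 : ∀ p, EqOn (dFst^[p] fun z => (dSnd^[m.2] g) z + (dSnd^[m.2] g') z)
      (fun z => (dFst^[p] (dSnd^[m.2] g)) z + (dFst^[p] (dSnd^[m.2] g')) z) D := by
    have a := analyticOnNhd_iterate_dSnd hg m.2
    have a' := analyticOnNhd_iterate_dSnd hg' m.2
    intro p
    induction p with
    | zero => exact fun _ _ => rfl
    | succ p ih =>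
      simp only [Function.iterate_succ_apply']
      refine (eqOn_dFst hD ih).trans fun z hz => ?_
      rw [dFst, fderiv_fun_add (analyticOnNhd_iterate_dFst a p z hz).differentiableAt
        (analyticOnNhd_iterate_dFst a' p z hz).differentiableAt]
      rfl
  rw [taylorCoeff, eqOn_iterate_dFst hD (h2 m.2) m.1 hz, h1 m.1 hz, add_div]
  rfl

theorem taylorCoeff_const (c : ℂ) (m : ℕ × ℕ) (z : ℂ × ℂ) :
    taylorCoeff (fun _ => c) m z = if m = 0 then c else 0 := by
  have e1 : ∀ c : ℂ, dFst (fun _ => c) = fun _ => 0 := fun c => by ext; simp [dFst]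
  have e2 : ∀ c : ℂ, dSnd (fun _ => c) = fun _ => 0 := fun c => by ext; simp [dSnd]
  have i1 : ∀ (p : ℕ) (c : ℂ), dFst^[p] (fun _ => c) = fun _ => if p = 0 then c else 0 := by
    intro p
    induction p with
    | zero => intro c; simp
    | succ p ih => intro c; rw [Function.iterate_succ_apply, e1, ih]; simp
  have i2 : ∀ (p : ℕ) (c : ℂ), dSnd^[p] (fun _ => c) = fun _ => if p = 0 then c else 0 := by
    intro p
    induction p with
    | zero => intro c; simp
    | succ p ih => intro c; rw [Function.iterate_succ_apply, e2, ih]; simp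
  obtain ⟨p, q⟩ := m
  rw [taylorCoeff, i2, i1]
  by_cases hp : p = 0 <;> by_cases hq : q = 0 <;> simp [hp, hq]

/-- The power series on a cell is supported on the corresponding spectral projections. -/
theorem localOp_mul_LR (h₁ : IsSpectralResolution X₁ E₁) (h₂ : IsSpectralResolution X₂ E₂)
    (hD : IsOpen D) (hg : AnalyticOnNhd ℂ g D) {a b : ℂ} (hr : 0 < r)
    (hab : Metric.closedBall (a, b) r ⊆ D)
    (hP : MeasurableSet P) (hPa : P ⊆ Metric.closedBall a (r / 8))
    (hQ : MeasurableSet Q) (hQb : Q ⊆ Metric.closedBall b (r / 8)) :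
    localOp X₁ E₁ X₂ E₂ g a b P Q * LR (E₁ P) (E₂ Q) = localOp X₁ E₁ X₂ E₂ g a b P Q ∧
    LR (E₁ P) (E₂ Q) * localOp X₁ E₁ X₂ E₂ g a b P Q = localOp X₁ E₁ X₂ E₂ g a b P Q := by
  have hs := (summable_norm_localOp h₁ h₂ hD hg hr hab hP hPa hQ hQb).of_norm
  have c₁ : ∀ n, Commute ((X₁ - a • 1) ^ n) (E₁ P) := fun n =>
    ((h₁.commute _ hP).symm.sub_left ((Commute.one_left _).smul_left _)).pow_left n
  have c₂ : ∀ n, Commute ((X₂ - b • 1) ^ n) (E₂ Q) := fun n =>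
    ((h₂.commute _ hQ).symm.sub_left ((Commute.one_left _).smul_left _)).pow_left n
  constructor
  · rw [localOp, ← hs.tsum_mul_right]
    refine tsum_congr fun m => ?_
    rw [smul_mul_assoc, LR_mul_LR, mul_assoc, h₁.mul_self hP, ← mul_assoc, ← (c₂ m.2).eq, mul_assoc,
      h₂.mul_self hQ]
  · rw [localOp, ← hs.tsum_mul_left]
    refine tsum_congr fun m => ?_
    rw [mul_smul_comm, LR_mul_LR, ← mul_assoc, ← (c₁ m.1).eq, mul_assoc, h₁.mul_self hP, mul_assoc,
      h₂.mul_self hQ]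

/-- On one cell, multiplicativity is the Cauchy product of power series, combined with the Leibniz
rule for the Taylor coefficients. -/
theorem localOp_mul_localOp (h₁ : IsSpectralResolution X₁ E₁) (h₂ : IsSpectralResolution X₂ E₂)
    (hD : IsOpen D) (hg : AnalyticOnNhd ℂ g D) (hg' : AnalyticOnNhd ℂ g' D) {a b : ℂ} (hr : 0 < r)
    (hab : Metric.closedBall (a, b) r ⊆ D)
    (hP : MeasurableSet P) (hPa : P ⊆ Metric.closedBall a (r / 8))
    (hQ : MeasurableSet Q) (hQb : Q ⊆ Metric.closedBall b (r / 8)) :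
    localOp X₁ E₁ X₂ E₂ g a b P Q * localOp X₁ E₁ X₂ E₂ g' a b P Q =
      localOp X₁ E₁ X₂ E₂ (fun z => g z * g' z) a b P Q := by
  have hs := summable_norm_localOp h₁ h₂ hD hg hr hab hP hPa hQ hQb
  have hs' := summable_norm_localOp h₁ h₂ hD hg' hr hab hP hPa hQ hQb
  have c₁ : Commute (X₁ - a • 1) (E₁ P) :=
    (h₁.commute _ hP).symm.sub_left ((Commute.one_left _).smul_left _)
  have c₂ : Commute (X₂ - b • 1) (E₂ Q) :=
    (h₂.commute _ hQ).symm.sub_left ((Commute.one_left _).smul_left _)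
  rw [localOp, localOp, tsum_LR_mul_tsum_LR c₁ c₂ (h₁.mul_self hP) (h₂.mul_self hQ) hs hs', localOp]
  refine tsum_congr fun m => ?_
  rw [taylorCoeff_mul hD hg hg' m (hab (Metric.mem_closedBall_self hr.le))]

theorem localOp_mul_localOp_of_disjoint (h₁ : IsSpectralResolution X₁ E₁)
    (h₂ : IsSpectralResolution X₂ E₂) (hD : IsOpen D) (hg : AnalyticOnNhd ℂ g D)
    (hg' : AnalyticOnNhd ℂ g' D) {a b a' b' : ℂ} {P' Q' : Set ℂ} (hr : 0 < r)
    (hab : Metric.closedBall (a, b) r ⊆ D) (hab' : Metric.closedBall (a', b') r ⊆ D)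
    (hP : MeasurableSet P) (hPa : P ⊆ Metric.closedBall a (r / 8))
    (hQ : MeasurableSet Q) (hQb : Q ⊆ Metric.closedBall b (r / 8))
    (hP' : MeasurableSet P') (hPa' : P' ⊆ Metric.closedBall a' (r / 8))
    (hQ' : MeasurableSet Q') (hQb' : Q' ⊆ Metric.closedBall b' (r / 8))
    (hdisj : Disjoint P P' ∨ Disjoint Q Q') :
    localOp X₁ E₁ X₂ E₂ g a b P Q * localOp X₁ E₁ X₂ E₂ g' a' b' P' Q' = 0 := by
  rw [← (localOp_mul_LR h₁ h₂ hD hg hr hab hP hPa hQ hQb).1,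
    ← (localOp_mul_LR h₁ h₂ hD hg' hr hab' hP' hPa' hQ' hQb').2, mul_assoc,
    ← mul_assoc (LR _ _), LR_mul_LR]
  rcases hdisj with hd | hd
  · rw [h₁.mul_eq_zero_of_disjoint hP hP' hd]; simp [LR]
  · rw [h₂.mul_eq_zero_of_disjoint hQ' hQ hd.symm]; simp [LR]

theorem IsGrid.gridOp_mul (hG : IsGrid X₁ X₂ D r π₁ π₂) (h₁ : IsSpectralResolution X₁ E₁)
    (h₂ : IsSpectralResolution X₂ E₂) (hD : IsOpen D) (hg : AnalyticOnNhd ℂ g D)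
    (hg' : AnalyticOnNhd ℂ g' D) :
    gridOp X₁ E₁ X₂ E₂ (fun z => g z * g' z) π₁ π₂ =
      gridOp X₁ E₁ X₂ E₂ g π₁ π₂ * gridOp X₁ E₁ X₂ E₂ g' π₁ π₂ := by
  have hsub := fun i j => hG.closedBall_subset _ (π₁.tag_mem' i) _ (π₂.tag_mem' j)
  have hd : ∀ i j i' j', (i' ≠ i ∨ j' ≠ j) →
      localOp X₁ E₁ X₂ E₂ g (π₁.tag i) (π₂.tag j) (π₁.cell i) (π₂.cell j) *
      localOp X₁ E₁ X₂ E₂ g' (π₁.tag i') (π₂.tag j') (π₁.cell i') (π₂.cell j') = 0 :=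
    fun i j i' j' hne => localOp_mul_localOp_of_disjoint h₁ h₂ hD hg hg' hG.pos (hsub i j)
      (hsub i' j') (π₁.measurable_cell i) (hG.fine₁.cell_subset_closedBall i)
      (π₂.measurable_cell j) (hG.fine₂.cell_subset_closedBall j)
      (π₁.measurable_cell i') (hG.fine₁.cell_subset_closedBall i')
      (π₂.measurable_cell j') (hG.fine₂.cell_subset_closedBall j')
      (hne.imp (fun h => π₁.disjoint_cell h.symm) (fun h => π₂.disjoint_cell h.symm))
  simp only [gridOp, Finset.sum_mul]
  refine Finset.sum_congr rfl fun i _ => Finset.sum_congr rfl fun j _ => ?_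
  rw [← localOp_mul_localOp h₁ h₂ hD hg hg' hG.pos (hsub i j)
    (π₁.measurable_cell i) (hG.fine₁.cell_subset_closedBall i)
    (π₂.measurable_cell j) (hG.fine₂.cell_subset_closedBall j), Finset.mul_sum,
    Finset.sum_eq_single i, Finset.mul_sum, Finset.sum_eq_single j]
  · exact fun j' _ hj' => hd i j i j' (Or.inr hj')
  · simp
  · exact fun i' _ hi' => by
      rw [Finset.mul_sum]
      exact Finset.sum_eq_zero fun j' _ => hd i j i' j' (Or.inl hi')
  · simp

theorem IsGrid.gridOp_add (hG : IsGrid X₁ X₂ D r π₁ π₂) (h₁ : IsSpectralResolution X₁ E₁)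
    (h₂ : IsSpectralResolution X₂ E₂) (hD : IsOpen D) (hg : AnalyticOnNhd ℂ g D)
    (hg' : AnalyticOnNhd ℂ g' D) :
    gridOp X₁ E₁ X₂ E₂ (fun z => g z + g' z) π₁ π₂ =
      gridOp X₁ E₁ X₂ E₂ g π₁ π₂ + gridOp X₁ E₁ X₂ E₂ g' π₁ π₂ := by
  have hsub := fun i j => hG.closedBall_subset _ (π₁.tag_mem' i) _ (π₂.tag_mem' j)
  simp only [gridOp, ← Finset.sum_add_distrib]
  refine Finset.sum_congr rfl fun i _ => Finset.sum_congr rfl fun j _ => ?_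
  have hs : ∀ {g : ℂ × ℂ → ℂ}, AnalyticOnNhd ℂ g D → _ := fun {g} hg =>
    (summable_norm_localOp h₁ h₂ hD hg hG.pos (hsub i j)
      (π₁.measurable_cell i) (hG.fine₁.cell_subset_closedBall i)
      (π₂.measurable_cell j) (hG.fine₂.cell_subset_closedBall j)).of_norm
  rw [localOp, localOp, localOp, ← (hs hg).tsum_add (hs hg')]
  refine tsum_congr fun m => ?_
  rw [taylorCoeff_add hD hg hg' m (hsub i j (Metric.mem_closedBall_self hG.pos.le)), add_smul]

theorem gridOp_congr (hD : IsOpen D) (h : EqOn g g' D)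
    (hXD : spectrum ℂ X₁ ×ˢ spectrum ℂ X₂ ⊆ D) :
    gridOp X₁ E₁ X₂ E₂ g π₁ π₂ = gridOp X₁ E₁ X₂ E₂ g' π₁ π₂ := by
  refine Finset.sum_congr rfl fun i _ => Finset.sum_congr rfl fun j _ => tsum_congr fun m => ?_
  rw [taylorCoeff_congr hD h m (hXD (mk_mem_prod (π₁.tag_mem' i) (π₂.tag_mem' j)))]

theorem gridOp_const (h₁ : IsSpectralResolution X₁ E₁) (h₂ : IsSpectralResolution X₂ E₂) (c : ℂ) :
    gridOp X₁ E₁ X₂ E₂ (fun _ => c) π₁ π₂ = algebraMap ℂ _ c := by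
  have hloc : ∀ (a b : ℂ) (P Q : Set ℂ), localOp X₁ E₁ X₂ E₂ (fun _ => c) a b P Q =
      c • LR (E₁ P) (E₂ Q) := by
    intro a b P Q
    rw [localOp, tsum_eq_single 0]
    · rw [taylorCoeff_const, if_pos rfl]; simp
    · intro m hm
      rw [taylorCoeff_const, if_neg hm, zero_smul]
  simp only [gridOp, hloc, ← Finset.smul_sum]
  rw [← LR_sum_sum, h₁.sum_map_cell, h₂.sum_map_cell, h₁.spectrum_eq_one, h₂.spectrum_eq_one,
    Algebra.algebraMap_eq_smul_one]
  congr 1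

/-- `β ↦ T_β` as a homomorphism of algebras, computed on a fixed grid. Multiplication of operators on
`B(H)` is composition. -/
def IsGrid.transformer (hG : IsGrid X₁ X₂ D r π₁ π₂) (h₁ : IsSpectralResolution X₁ E₁)
    (h₂ : IsSpectralResolution X₂ E₂) (hD : IsOpen D)
    (hXD : spectrum ℂ X₁ ×ˢ spectrum ℂ X₂ ⊆ D) :
    Holo D →ₐ[ℂ] ((H →L[ℂ] H) →L[ℂ] (H →L[ℂ] H)) :=
  have hconst : ∀ c : ℂ, gridOp X₁ E₁ X₂ E₂ (zeroExt (algebraMap ℂ (Holo D) c)) π₁ π₂ =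
      algebraMap ℂ _ c :=
    fun c => by
      rw [← gridOp_const h₁ h₂ c]
      exact gridOp_congr hD (fun z hz => zeroExt_of_mem _ hz) hXD
  { toFun := fun β => gridOp X₁ E₁ X₂ E₂ (zeroExt β) π₁ π₂
    map_one' := by simpa using hconst 1
    map_zero' := by have := hconst 0; rwa [map_zero, map_zero] at this
    map_mul' := fun β γ => by
      rw [← hG.gridOp_mul h₁ h₂ hD (analyticOnNhd_zeroExt hD β) (analyticOnNhd_zeroExt hD γ)]
      exact gridOp_congr hD (fun z hz => by simp [zeroExt_of_mem _ hz]) hXD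
    map_add' := fun β γ => by
      rw [← hG.gridOp_add h₁ h₂ hD (analyticOnNhd_zeroExt hD β) (analyticOnNhd_zeroExt hD γ)]
      exact gridOp_congr hD (fun z hz => by simp [zeroExt_of_mem _ hz]) hXD
    commutes' := hconst }

end

section

open TaggedPartition

/-! ### Vanishing power series -/

/-- A power series with nonzero constant term and geometrically bounded coefficients has an inverse
whose coefficients are again geometrically bounded. -/
theorem exists_convolution_inverse {u : ℕ → ℂ} (h0 : u 0 ≠ 0) {A s : ℝ} (hs : 0 ≤ s)
    (hu : ∀ k, ‖u k‖ ≤ A * s ^ k) : ∃ (v : ℕ → ℂ) (C R : ℝ), 0 ≤ R ∧ (∀ k, ‖v k‖ ≤ C * R ^ k) ∧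
      ∀ n, ∑ x ∈ Finset.HasAntidiagonal.antidiagonal n, u x.1 * v x.2 = if n = 0 then 1 else 0 := by
  let ps := PowerSeries.mk u
  have hps : PowerSeries.constantCoeff ps ≠ 0 := by
    rw [← PowerSeries.coeff_zero_eq_constantCoeff_apply, PowerSeries.coeff_mk]; exact h0
  have hA : 0 ≤ A := by simpa using (norm_nonneg _).trans (hu 0)
  set w := ‖u 0‖⁻¹ with hw
  set B := w * A with hB
  have hB0 : 0 ≤ B := by positivity
  refine ⟨fun k => PowerSeries.coeff k ps⁻¹, w, s * (1 + B), by positivity, fun k => ?_, fun n => ?_⟩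
  · have hcu : ‖(PowerSeries.constantCoeff ps)⁻¹‖ = w := by
      rw [norm_inv, ← PowerSeries.coeff_zero_eq_constantCoeff_apply, PowerSeries.coeff_mk]
    induction k using Nat.strong_induction_on with
    | _ n ih =>
      simp only at ih ⊢
      rw [PowerSeries.coeff_inv]
      split_ifs with hn
      · subst hn; simp [hcu]
      rw [norm_mul, norm_neg, hcu, ← Finset.Nat.sum_antidiagonal_swap,
        Finset.Nat.sum_antidiagonal_eq_sum_range_succ_mk, Finset.sum_range_succ]
      simp only [Prod.swap_prod_mk, lt_self_iff_false, if_false, add_zero]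
      calc w * ‖∑ j ∈ Finset.range n, if j < n then
            PowerSeries.coeff (n - j) ps * PowerSeries.coeff j ps⁻¹ else 0‖
          ≤ w * ∑ j ∈ Finset.range n, A * s ^ n * (w * (1 + B) ^ j) := by
            gcongr
            refine norm_sum_le_of_le _ fun j hj => ?_
            have hj' := Finset.mem_range.1 hj
            rw [if_pos hj', norm_mul, PowerSeries.coeff_mk]
            calc _ ≤ (A * s ^ (n - j)) * (w * (s * (1 + B)) ^ j) :=
                  mul_le_mul (hu _) (ih j hj') (norm_nonneg _) (by positivity)
              _ = A * (s ^ (n - j) * s ^ j) * (w * (1 + B) ^ j) := by rw [mul_pow]; ring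
              _ = _ := by rw [← pow_add, Nat.sub_add_cancel hj'.le]
        _ = w * s ^ n * ((∑ j ∈ Finset.range n, (1 + B) ^ j) * ((1 + B) - 1)) := by
            rw [← Finset.mul_sum, ← Finset.mul_sum, hB]; ring
        _ = w * s ^ n * ((1 + B) ^ n - 1) := by rw [geom_sum_mul]
        _ ≤ w * (s * (1 + B)) ^ n := by
            rw [mul_pow, mul_assoc, ← mul_assoc w, ← mul_assoc w]
            gcongr
            linarith
  · have := congrArg (PowerSeries.coeff n) (PowerSeries.mul_inv_cancel ps hps)
    rw [PowerSeries.coeff_mul, PowerSeries.coeff_one] at this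
    simpa [ps] using this

theorem summable_norm_smul_of_le {V : Type*} [NormedAddCommGroup V] [NormedSpace ℂ V] {d : ℕ → ℂ}
    {f : ℕ → V} {M s C t : ℝ} (hd : ∀ n, ‖d n‖ ≤ M * s ^ n) (hf : ∀ n, ‖f n‖ ≤ C * t ^ n)
    (hs : 0 ≤ s) (ht : 0 ≤ t) (hst : s * t < 1) : Summable fun n => ‖d n • f n‖ := by
  have hM : 0 ≤ M := by simpa using (norm_nonneg _).trans (hd 0)
  refine Summable.of_nonneg_of_le (fun _ => norm_nonneg _) (fun n => ?_)
    ((summable_geometric_of_lt_one (by positivity) hst).mul_left (M * C))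
  rw [norm_smul]
  calc _ ≤ (M * s ^ n) * (C * t ^ n) := mul_le_mul (hd n) (hf n) (norm_nonneg _) (by positivity)
    _ = _ := by rw [mul_pow]; ring

/-- If `a ^ l * u(a) e = 0` for a power series `u` which is invertible at `a`, then `a ^ l * e = 0`. -/
theorem pow_mul_eq_zero_of_tsum_eq_zero {R : Type*} [NormedRing R] [NormedAlgebra ℂ R]
    [CompleteSpace R] {a e : R} (hae : Commute a e) (he : e * e = e) {u v : ℕ → ℂ}
    (huv : ∀ n, ∑ x ∈ Finset.HasAntidiagonal.antidiagonal n, u x.1 * v x.2 = if n = 0 then 1 else 0)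
    (hu : Summable fun n => ‖u n • (a ^ n * e)‖) (hv : Summable fun n => ‖v n • (a ^ n * e)‖)
    {l : ℕ} (h : ∑' n, u n • (a ^ (l + n) * e) = 0) : a ^ l * e = 0 := by
  have hprod : (∑' n, u n • (a ^ n * e)) * (∑' n, v n • (a ^ n * e)) = e := by
    rw [tsum_mul_tsum_eq_tsum_sum_antidiagonal_of_summable_norm hu hv, tsum_eq_single 0]
    · have := huv 0
      rw [Finset.Nat.antidiagonal_zero, Finset.sum_singleton, if_pos rfl] at this
      rw [Finset.Nat.antidiagonal_zero, Finset.sum_singleton, smul_mul_smul_comm, this]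
      simp [he]
    · intro n hn
      have : ∀ x ∈ Finset.HasAntidiagonal.antidiagonal n,
          u x.1 • (a ^ x.1 * e) * v x.2 • (a ^ x.2 * e) = (u x.1 * v x.2) • (a ^ n * e) := by
        intro x hx
        rw [smul_mul_smul_comm, mul_assoc, ← mul_assoc e, ← (hae.pow_left _).eq, mul_assoc, he,
          ← mul_assoc, ← pow_add, Finset.HasAntidiagonal.mem_antidiagonal.1 hx]
      rw [Finset.sum_congr rfl this, ← Finset.sum_smul, huv, if_neg hn, zero_smul]
  have h' : a ^ l * ∑' n, u n • (a ^ n * e) = 0 := by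
    rw [← hu.of_norm.tsum_mul_left, ← h]
    exact tsum_congr fun n => by rw [mul_smul_comm, ← mul_assoc, pow_add]
  rw [← hprod, ← mul_assoc, h', zero_mul]

variable {H : Type*} [NormedAddCommGroup H] [InnerProductSpace ℂ H] [CompleteSpace H]
variable {X X₁ X₂ : H →L[ℂ] H} {E E₁ E₂ : Set ℂ → H →L[ℂ] H} {K K₁ K₂ P Q : Set ℂ}

/-- If a power series in `X - c` vanishes on the range of the spectral projection of a small ball
around `c`, then its coefficients of index below the order of the nilpotent part at `c` vanish.
Otherwise, splitting off the first nonvanishing coefficient leaves an invertible series, so that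
`(X - c)^l` and hence `N^l` vanishes near `c`. -/
theorem IsSpectralResolution.coeff_eq_zero (h : IsSpectralResolution X E) {c : ℂ} {r M δ : ℝ}
    (hr : 0 < r) (hδ : 0 < δ) (hδr : δ ≤ r / 8) {d : ℕ → ℂ} (hd : ∀ n, ‖d n‖ ≤ M / r ^ n)
    (hsum : ∑' n, d n • ((X - c • 1) ^ n * E (spectrum ℂ X ∩ Metric.ball c δ)) = 0)
    {n : ℕ} (hn : (n : ℕ∞) < nilOrder X E c) : d n = 0 := by
  classical
  by_contra hdn
  have hex : ∃ n, d n ≠ 0 := ⟨n, hdn⟩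
  set l := Nat.find hex
  have hl : d l ≠ 0 := Nat.find_spec hex
  have hmin : ∀ m < l, d m = 0 := fun m hm => not_not.1 (Nat.find_min hex hm)
  refine lt_nilOrder_iff.1 hn l (Nat.find_min' hex hdn) ?_
  set a := X - c • (1 : H →L[ℂ] H)
  have hd' : ∀ n, ‖d n‖ ≤ M * (1 / r) ^ n := fun n => (hd n).trans (le_of_eq (by
    rw [one_div, inv_pow, div_eq_mul_inv]))
  have hu : ∀ k, ‖d (l + k)‖ ≤ M * (1 / r) ^ l * (1 / r) ^ k := fun k => (hd' _).trans (le_of_eq (by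
    rw [pow_add]; ring))
  obtain ⟨v, C, R, hR, hv, huv⟩ := exists_convolution_inverse (u := fun k => d (l + k))
    (by simpa using hl) (by positivity : (0:ℝ) ≤ 1 / r) hu
  -- a radius at which both the series and its inverse converge
  set ρ := min δ (1 / (4 * (R + 1))) with hρdef
  have hρ : 0 < ρ := lt_min hδ (by positivity)
  have hρδ : ρ ≤ δ := min_le_left _ _
  have hρR : R * (2 * ρ) < 1 := by
    have : ρ ≤ 1 / (4 * (R + 1)) := min_le_right _ _
    calc R * (2 * ρ) ≤ R * (2 * (1 / (4 * (R + 1)))) := by gcongr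
      _ < 1 := by
        rw [mul_one_div, mul_div_assoc', div_lt_one (by positivity)]
        linarith
  have hσ := measurableSet_spectrum X
  have hP : MeasurableSet (spectrum ℂ X ∩ Metric.ball c δ) :=
    hσ.inter Metric.isOpen_ball.measurableSet
  have hP' : MeasurableSet (Metric.ball c (ρ / 2) ∩ spectrum ℂ X) :=
    Metric.isOpen_ball.measurableSet.inter hσ
  have hsub : Metric.ball c (ρ / 2) ∩ spectrum ℂ X ⊆ spectrum ℂ X ∩ Metric.ball c δ :=
    fun z hz => ⟨hz.2, Metric.ball_subset_ball (by linarith) hz.1⟩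
  set e := E (Metric.ball c (ρ / 2) ∩ spectrum ℂ X) with hedef
  have hae : Commute a e := (h.commute _ hP').symm.sub_left ((Commute.one_left _).smul_left _)
  have hPe : E (spectrum ℂ X ∩ Metric.ball c δ) * e = e := by
    rw [hedef, ← h.inter _ _ hP hP', inter_eq_right.2 hsub]
  obtain ⟨C₁, -, hC₁⟩ := h.exists_norm_sub_pow_mul_le (show 0 < r / 4 by positivity)
  obtain ⟨C₂, -, hC₂⟩ := h.exists_norm_sub_pow_mul_le hρ
  have b₁ := hC₁ _ c hP (fun z hz => Metric.closedBall_subset_closedBall (by linarith)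
    (Metric.ball_subset_closedBall hz.2))
  have b₂ := hC₂ _ c hP' (fun z hz => Metric.ball_subset_closedBall hz.1)
  have hrρ : 1 / r * (2 * ρ) < 1 := by
    rw [one_div_mul_eq_div, div_lt_one hr]; linarith
  have s₁ : Summable fun n => ‖d n • (a ^ n * E (spectrum ℂ X ∩ Metric.ball c δ))‖ :=
    summable_norm_smul_of_le hd' b₁ (by positivity) (by positivity)
      (by rw [one_div_mul_eq_div, div_lt_one hr]; linarith)
  have s₂ : Summable fun n => ‖d n • (a ^ n * e)‖ :=
    summable_norm_smul_of_le hd' b₂ (by positivity) (by positivity) hrρ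
  have hzero : ∑' n, d n • (a ^ n * e) = 0 := by
    have h1 := s₁.of_norm.tsum_mul_right e
    rw [hsum, zero_mul] at h1
    rw [← h1]
    exact tsum_congr fun n => by rw [smul_mul_assoc, mul_assoc, hPe]
  have hshift : ∑' n, d (l + n) • (a ^ (l + n) * e) = 0 := by
    have := s₂.of_norm.sum_add_tsum_nat_add l
    rw [hzero, Finset.sum_eq_zero, zero_add] at this
    · simpa only [add_comm l] using this
    · exact fun m hm => by rw [hmin m (Finset.mem_range.1 hm), zero_smul]
  have hfin := pow_mul_eq_zero_of_tsum_eq_zero hae (h.mul_self hP') huv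
    (summable_norm_smul_of_le hu b₂ (by positivity) (by positivity) hrρ)
    (summable_norm_smul_of_le hv b₂ hR (by positivity) hρR) hshift
  exact h.vanishesNear_iff.2 ⟨_, Metric.isOpen_ball, Metric.mem_ball_self (by positivity),
    h.nilPart_pow_mul_eq_zero hfin⟩

variable {D : Set (ℂ × ℂ)} {g : ℂ × ℂ → ℂ}

/-- If the local power series around `(a, b)` vanishes as an operator, then so do the Taylor
coefficients below the orders of the nilpotent parts. Testing on operators of rank one reduces this
to the case of one variable. -/
theorem taylorCoeff_eq_zero_of_localOp_eq_zero (h₁ : IsSpectralResolution X₁ E₁)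
    (h₂ : IsSpectralResolution X₂ E₂) (hD : IsOpen D) (hg : AnalyticOnNhd ℂ g D) {a b : ℂ} {r δ : ℝ}
    (hr : 0 < r) (hδ : 0 < δ) (hδr : δ ≤ r / 8) (hab : Metric.closedBall (a, b) r ⊆ D)
    (h0 : localOp X₁ E₁ X₂ E₂ g a b (spectrum ℂ X₁ ∩ Metric.ball a δ)
      (spectrum ℂ X₂ ∩ Metric.ball b δ) = 0)
    {p q : ℕ} (hp : (p : ℕ∞) < nilOrder X₁ E₁ a) (hq : (q : ℕ∞) < nilOrder X₂ E₂ b) :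
    taylorCoeff g (p, q) (a, b) = 0 := by
  obtain ⟨M, hM⟩ := (isCompact_closedBall (a, b) r).exists_bound_of_continuousOn
    (hg.continuousOn.mono hab)
  have hM0 : 0 ≤ M := (norm_nonneg _).trans (hM _ (Metric.mem_closedBall_self hr.le))
  set t : ℕ × ℕ → ℂ := fun m => taylorCoeff g m (a, b)
  have ht : ∀ m, ‖t m‖ ≤ M / r ^ (m.1 + m.2) := norm_taylorCoeff_le hD hg hr hab hM
  have hP : MeasurableSet (spectrum ℂ X₁ ∩ Metric.ball a δ) :=
    (IsSpectralResolution.measurableSet_spectrum X₁).inter Metric.isOpen_ball.measurableSet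
  have hQ : MeasurableSet (spectrum ℂ X₂ ∩ Metric.ball b δ) :=
    (IsSpectralResolution.measurableSet_spectrum X₂).inter Metric.isOpen_ball.measurableSet
  have hPa : spectrum ℂ X₁ ∩ Metric.ball a δ ⊆ Metric.closedBall a (r / 8) := fun z hz =>
    Metric.closedBall_subset_closedBall hδr (Metric.ball_subset_closedBall hz.2)
  have hQb : spectrum ℂ X₂ ∩ Metric.ball b δ ⊆ Metric.closedBall b (r / 8) := fun z hz =>
    Metric.closedBall_subset_closedBall hδr (Metric.ball_subset_closedBall hz.2)
  have hS := (summable_norm_localOp h₁ h₂ hD hg hr hab hP hPa hQ hQb).of_norm.hasSum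
  change HasSum _ (localOp X₁ E₁ X₂ E₂ g a b _ _) at hS
  rw [h0] at hS
  obtain ⟨C₁, hC₁0, hC₁⟩ := h₁.exists_norm_sub_pow_mul_le (show 0 < r / 4 by positivity)
  obtain ⟨C₂, hC₂0, hC₂⟩ := h₂.exists_norm_sub_pow_mul_le (show 0 < r / 4 by positivity)
  have h8 : r / 4 / 2 = r / 8 := by ring
  rw [h8] at hC₁ hC₂
  have b₁ := hC₁ _ a hP hPa
  have b₂ := hC₂ _ b hQ hQb
  set U : ℕ → H →L[ℂ] H := fun m => (X₁ - a • 1) ^ m * E₁ (spectrum ℂ X₁ ∩ Metric.ball a δ)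
  set V : ℕ → H →L[ℂ] H := fun n => (X₂ - b • 1) ^ n * E₂ (spectrum ℂ X₂ ∩ Metric.ball b δ)
  have hhalf : 2 * (r / 4) / r = 1 / 2 := by field_simp; norm_num
  -- the value of the series at an operator of rank one
  have hrank : ∀ ξ v x ψ : H,
      HasSum (fun m : ℕ × ℕ => t m * (inner ℂ ξ (V m.2 x) * inner ℂ ψ (U m.1 v))) 0 := by
    intro ξ v x ψ
    let Y : H →L[ℂ] H := (innerSL ℂ ξ).smulRight v
    have e1 := hS.mapL (ContinuousLinearMap.apply ℂ (H →L[ℂ] H) Y)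
    have e2 := e1.mapL (ContinuousLinearMap.apply ℂ H x)
    have e3 := e2.mapL (innerSL ℂ ψ)
    refine hasSum_of_eq e3 (fun m => ?_) (by simp)
    simp [LR, t, U, V, Y]
  have hcoef : ∀ ψ v : H, ∑' m : ℕ, t (m, q) * inner ℂ ψ (U m v) = 0 := by
    intro ψ v
    have hα : ∀ m, ‖inner ℂ ψ (U m v)‖ ≤ ‖ψ‖ * (C₁ * (2 * (r / 4)) ^ m * ‖v‖) := fun m =>
      (norm_inner_le_norm _ _).trans (by
        gcongr
        exact ContinuousLinearMap.le_of_opNorm_le _ (b₁ m) v)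
    set L := M * ‖ψ‖ * C₁ * ‖v‖
    have htα : ∀ m n, ‖t (m, n) * inner ℂ ψ (U m v)‖ ≤ L / r ^ n * (1 / 2) ^ m := by
      intro m n
      rw [norm_mul]
      calc _ ≤ M / r ^ (m + n) * (‖ψ‖ * (C₁ * (2 * (r / 4)) ^ m * ‖v‖)) := by
            gcongr
            · exact ht (m, n)
            · exact hα m
        _ = L / r ^ n * (2 * (r / 4) / r) ^ m := by
            rw [pow_add, div_pow _ r]; simp only [L]; field_simp
        _ = _ := by rw [hhalf]
    have hgeom : Summable fun m : ℕ => (1 / 2 : ℝ) ^ m := summable_geometric_two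
    have hs1 : ∀ n, Summable fun m => t (m, n) * inner ℂ ψ (U m v) := fun n =>
      Summable.of_norm_bounded (hgeom.mul_left _) fun m => htα m n
    have hs2 : Summable fun m : ℕ × ℕ => (t m * inner ℂ ψ (U m.1 v)) • V m.2 := by
      refine Summable.of_norm_bounded (summable_half_pow.mul_left (L * C₂)) fun m => ?_
      rw [norm_smul]
      calc _ ≤ (L / r ^ m.2 * (1 / 2) ^ m.1) * (C₂ * (2 * (r / 4)) ^ m.2) :=
            mul_le_mul (htα m.1 m.2) (b₂ m.2) (norm_nonneg _) (by positivity)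
        _ = L * C₂ * ((1 / 2) ^ m.1 * (2 * (r / 4) / r) ^ m.2) := by
            rw [div_pow _ r]; field_simp
        _ = _ := by rw [hhalf]
    have hs3 : HasSum (fun m : ℕ × ℕ => (t m * inner ℂ ψ (U m.1 v)) • V m.2) 0 := by
      have hz : ∑' m : ℕ × ℕ, (t m * inner ℂ ψ (U m.1 v)) • V m.2 = 0 := by
        ext x
        refine ext_inner_left ℂ fun ξ => ?_
        have e2 := (hs2.hasSum.mapL (ContinuousLinearMap.apply ℂ H x)).mapL (innerSL ℂ ξ)
        rw [zero_apply, inner_zero_right]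
        refine e2.unique (hasSum_of_eq (hrank ξ v x ψ) (fun m => ?_) rfl)
        simp
        ring
      exact hz ▸ hs2.hasSum
    have hfib := ((Equiv.prodComm ℕ ℕ).hasSum_iff.2 hs3).prod_fiberwise
      (g := fun n => (∑' m : ℕ, t (m, n) * inner ℂ ψ (U m v)) • V n)
      (fun n => (hs1 n).hasSum.smul_const (V n))
    refine h₂.coeff_eq_zero (M := L * 2) hr hδ hδr (fun n => ?_) hfib.tsum_eq hq
    calc _ ≤ ∑' m : ℕ, L / r ^ n * (1 / 2) ^ m :=
          tsum_of_norm_bounded (hgeom.mul_left _).hasSum fun m => htα m n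
      _ = _ := by rw [tsum_mul_left, tsum_geometric_two]; ring
  have hs4 : Summable fun m => t (m, q) • U m := by
    refine (summable_norm_smul_of_le (M := M / r ^ q) (s := 1 / r) (fun m => ?_) b₁
      (by positivity) (by positivity) (by rw [one_div_mul_eq_div, hhalf]; norm_num)).of_norm
    refine (ht (m, q)).trans (le_of_eq ?_)
    rw [pow_add, one_div, inv_pow]; field_simp
  have hz : ∑' m, t (m, q) • U m = 0 := by
    ext v
    refine ext_inner_left ℂ fun ψ => ?_
    have e2 := (hs4.hasSum.mapL (ContinuousLinearMap.apply ℂ H v)).mapL (innerSL ℂ ψ)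
    rw [zero_apply, inner_zero_right, ← hcoef ψ v]
    refine e2.tsum_eq.symm.trans (tsum_congr fun m => ?_)
    simp
  refine h₁.coeff_eq_zero (M := M / r ^ q) hr hδ hδr (d := fun m => t (m, q)) (fun m => ?_) hz hp
  refine (ht (m, q)).trans (le_of_eq ?_)
  rw [pow_add]; field_simp

end

section

open TaggedPartition

variable {H : Type*} [NormedAddCommGroup H] [InnerProductSpace ℂ H] [CompleteSpace H]
variable {X X₁ X₂ : H →L[ℂ] H} {E E₁ E₂ : Set ℂ → H →L[ℂ] H}
variable {D : Set (ℂ × ℂ)} {g : ℂ × ℂ → ℂ}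
variable {r : ℝ} {π₁ : TaggedPartition (spectrum ℂ X₁)} {π₂ : TaggedPartition (spectrum ℂ X₂)}

/-! ### Injectivity -/

/-- Compressing to a cell of the grid isolates the power series on that cell. -/
theorem IsGrid.gridOp_mul_LR (hG : IsGrid X₁ X₂ D r π₁ π₂) (h₁ : IsSpectralResolution X₁ E₁)
    (h₂ : IsSpectralResolution X₂ E₂) (hD : IsOpen D) (hg : AnalyticOnNhd ℂ g D) (i : Fin π₁.n)
    (j : Fin π₂.n) : gridOp X₁ E₁ X₂ E₂ g π₁ π₂ * LR (E₁ (π₁.cell i)) (E₂ (π₂.cell j)) =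
      localOp X₁ E₁ X₂ E₂ g (π₁.tag i) (π₂.tag j) (π₁.cell i) (π₂.cell j) := by
  have hm : ∀ i j, localOp X₁ E₁ X₂ E₂ g (π₁.tag i) (π₂.tag j) (π₁.cell i) (π₂.cell j) *
      LR (E₁ (π₁.cell i)) (E₂ (π₂.cell j)) =
      localOp X₁ E₁ X₂ E₂ g (π₁.tag i) (π₂.tag j) (π₁.cell i) (π₂.cell j) := fun i j =>
    (localOp_mul_LR h₁ h₂ hD hg hG.pos
      (hG.closedBall_subset _ (π₁.tag_mem' i) _ (π₂.tag_mem' j))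
      (π₁.measurable_cell i) (hG.fine₁.cell_subset_closedBall i)
      (π₂.measurable_cell j) (hG.fine₂.cell_subset_closedBall j)).1
  have hd : ∀ i' j', (i' ≠ i ∨ j' ≠ j) →
      localOp X₁ E₁ X₂ E₂ g (π₁.tag i') (π₂.tag j') (π₁.cell i') (π₂.cell j') *
        LR (E₁ (π₁.cell i)) (E₂ (π₂.cell j)) = 0 := by
    intro i' j' hne
    rw [← hm i' j', mul_assoc, LR_mul_LR]
    rcases hne with hd | hd
    · rw [h₁.mul_eq_zero_of_disjoint (π₁.measurable_cell _) (π₁.measurable_cell _)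
        (π₁.disjoint_cell hd)]
      simp [LR]
    · rw [h₂.mul_eq_zero_of_disjoint (π₂.measurable_cell _) (π₂.measurable_cell _)
        (π₂.disjoint_cell hd.symm)]
      simp [LR]
  simp only [gridOp, Finset.sum_mul]
  rw [Finset.sum_eq_single i, Finset.sum_eq_single j, hm]
  · exact fun j' _ hj' => hd i j' (Or.inr hj')
  · simp
  · exact fun i' _ hi' => Finset.sum_eq_zero fun j' _ => hd i' j' (Or.inl hi')
  · simp

theorem exists_isGrid (X₁ X₂ : H →L[ℂ] H) (hD : IsOpen D)
    (hXD : spectrum ℂ X₁ ×ˢ spectrum ℂ X₂ ⊆ D) :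
    ∃ r π₁ π₂, IsGrid X₁ X₂ D r π₁ π₂ := by
  obtain ⟨r, hr, hsub⟩ := exists_radius X₁ X₂ hD hXD
  obtain ⟨π₁, hπ₁⟩ := exists_finerThan (IsSpectralResolution.measurableSet_spectrum X₁)
    (spectrum.isBounded X₁) (show 0 < r / 8 by positivity)
  obtain ⟨π₂, hπ₂⟩ := exists_finerThan (IsSpectralResolution.measurableSet_spectrum X₂)
    (spectrum.isBounded X₂) (show 0 < r / 8 by positivity)
  exact ⟨r, π₁, π₂, hr, hsub, hπ₁, hπ₂⟩

/-- If `T_β = 0`, then the derivatives of `β` below the orders of the nilpotent parts vanish on the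
product of the spectra. -/
theorem partialDeriv_eq_zero_of_gdoi_eq_zero (h₁ : IsSpectralResolution X₁ E₁)
    (h₂ : IsSpectralResolution X₂ E₂) (hD : IsOpen D)
    (hXD : spectrum ℂ X₁ ×ˢ spectrum ℂ X₂ ⊆ D) {β : Holo D}
    (h0 : ∀ Y, gdoi X₁ E₁ X₂ E₂ β Y = 0) {a b : ℂ} (ha : a ∈ spectrum ℂ X₁)
    (hb : b ∈ spectrum ℂ X₂) {p q : ℕ} (hp : (p : ℕ∞) < nilOrder X₁ E₁ a)
    (hq : (q : ℕ∞) < nilOrder X₂ E₂ b) : partialDeriv β p q a b = 0 := by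
  obtain ⟨r, hr, hsub⟩ := exists_radius X₁ X₂ hD hXD
  have hg := analyticOnNhd_zeroExt hD β
  obtain ⟨π₁, hπ₁, i, hi, hci⟩ := exists_finerThan_cell_eq_ball
    (IsSpectralResolution.measurableSet_spectrum X₁) (spectrum.isBounded X₁)
    (show 0 < r / 8 by positivity) ha
  obtain ⟨π₂, hπ₂, j, hj, hcj⟩ := exists_finerThan_cell_eq_ball
    (IsSpectralResolution.measurableSet_spectrum X₂) (spectrum.isBounded X₂)
    (show 0 < r / 8 by positivity) hb
  have hG : IsGrid X₁ X₂ D r π₁ π₂ := ⟨hr, hsub, hπ₁, hπ₂⟩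
  have hgrid : gridOp X₁ E₁ X₂ E₂ (zeroExt β) π₁ π₂ = 0 := by
    ext1 Y
    rw [← hG.gdoi_eq h₁ h₂ hD β Y, h0 Y]
    rfl
  have hloc := hG.gridOp_mul_LR h₁ h₂ hD hg i j
  rw [hgrid, zero_mul, hi, hj, hci, hcj] at hloc
  have ht := taylorCoeff_eq_zero_of_localOp_eq_zero h₁ h₂ hD hg hr
    (show 0 < r / 8 / 2 by positivity) (by linarith) (hsub a ha b hb) hloc.symm hp hq
  rw [taylorCoeff, div_eq_zero_iff] at ht
  rw [partialDeriv_eq hD β p q (hXD (mk_mem_prod ha hb))]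
  refine ht.resolve_right ?_
  exact mul_ne_zero (Nat.cast_ne_zero.2 (Nat.factorial_ne_zero _))
    (Nat.cast_ne_zero.2 (Nat.factorial_ne_zero _))

theorem partialDeriv_zero (p q : ℕ) (z w : ℂ) : partialDeriv (0 : Holo D) p q z w = 0 := by
  have hz : ∀ z, zeroExt (0 : Holo D) z = 0 := fun z => by
    rw [zeroExt]
    split_ifs <;> rfl
  simp [partialDeriv, hz]

/-- The identity theorem: a holomorphic function on a domain is determined by its derivatives of all
orders at one point. -/
theorem eq_zero_of_partialDeriv_eq_zero (hD : IsOpen D) (hDc : IsPreconnected D) {β : Holo D}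
    {z : ℂ × ℂ} (hz : z ∈ D) (h : ∀ p q, partialDeriv β p q z.1 z.2 = 0) : β = 0 := by
  have hg := analyticOnNhd_zeroExt hD β
  obtain ⟨r, hr, hsub⟩ := Metric.nhds_basis_closedBall.mem_iff.1 (hD.mem_nhds hz)
  have hev : zeroExt β =ᶠ[𝓝 z] 0 := by
    filter_upwards [Metric.ball_mem_nhds z hr] with w hw
    refine (hasSum_taylorCoeff hD hg hsub hw).unique (hasSum_of_eq hasSum_zero (fun m => ?_) rfl)
    rw [← partialDeriv_div_eq hD β m.1 m.2 hz, h, zero_div, zero_mul]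
  have heq := hg.eqOn_zero_of_preconnected_of_eventuallyEq_zero hDc hz hev
  ext w
  rw [← zeroExt_of_mem β w.2]
  exact heq w.2

/-! ### The agreement condition for infinite spectra -/

/-- An analytic function vanishing on `K₁ × K₂` has vanishing derivatives at `(a, b)` if `a` and `b` are
accumulation points: apply the one-variable identity theorem first in the second, then in the first
variable. -/
theorem iterate_dFst_dSnd_eq_zero_of_accPt (hD : IsOpen D) (hg : AnalyticOnNhd ℂ g D)
    {K₁ K₂ : Set ℂ} (hK : K₁ ×ˢ K₂ ⊆ D) (h0 : ∀ a ∈ K₁, ∀ b ∈ K₂, g (a, b) = 0) {a b : ℂ}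
    (ha : a ∈ K₁) (hb : b ∈ K₂) (hacc₁ : AccPt a (𝓟 K₁)) (hacc₂ : AccPt b (𝓟 K₂)) (p q : ℕ) :
    (dFst^[p] (dSnd^[q] g)) (a, b) = 0 := by
  have hzero : ∀ {f : ℂ → ℂ} {c : ℂ} {K : Set ℂ}, AnalyticAt ℂ f c → AccPt c (𝓟 K) →
      (∀ z ∈ K, f z = 0) → ∀ n, iteratedDeriv n f c = 0 := by
    intro f c K hf hc hz n
    have hev : f =ᶠ[𝓝 c] fun _ => 0 := hf.frequently_zero_iff_eventually_zero.1
      ((accPt_iff_frequently_nhdsNE.1 hc).mono hz)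
    rw [hev.iteratedDeriv_eq]
    simp
  have h1 : ∀ u ∈ K₁, (dSnd^[q] g) (u, b) = 0 := fun u hu => by
    rw [← iteratedDeriv_slice_snd hD hg q (hK (mk_mem_prod hu hb))]
    exact hzero (analyticAt_slice_snd hg (hK (mk_mem_prod hu hb))) hacc₂ (h0 u hu) q
  have hg' := analyticOnNhd_iterate_dSnd hg q
  rw [← iteratedDeriv_slice_fst hD hg' p (hK (mk_mem_prod ha hb))]
  exact hzero (analyticAt_slice_fst hg' (hK (mk_mem_prod ha hb))) hacc₁ h1 p

/-- Infinite spectra have accumulation points by compactness, and already the agreement of the functions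
themselves (order `(0, 0)`) on the product of the spectra suffices. -/
theorem derivativeAgreementCondition_of_infinite (h₁ : IsSpectralResolution X₁ E₁)
    (h₂ : IsSpectralResolution X₂ E₂) (hD : IsOpen D)
    (hXD : spectrum ℂ X₁ ×ˢ spectrum ℂ X₂ ⊆ D) (hi₁ : (spectrum ℂ X₁).Infinite)
    (hi₂ : (spectrum ℂ X₂).Infinite) : DerivativeAgreementCondition X₁ E₁ X₂ E₂ D := by
  intro β γ hβγ
  obtain ⟨a, ha, hacc₁⟩ := hi₁.exists_accPt_of_subset_isCompact (spectrum.isCompact X₁) subset_rfl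
  obtain ⟨b, hb, hacc₂⟩ := hi₂.exists_accPt_of_subset_isCompact (spectrum.isCompact X₂) subset_rfl
  have hab : (a, b) ∈ D := hXD (mk_mem_prod ha hb)
  have hf := analyticOnNhd_zeroExt hD (β - γ)
  have hz : ∀ u ∈ spectrum ℂ X₁, ∀ w ∈ spectrum ℂ X₂, zeroExt (β - γ) (u, w) = 0 := by
    intro u hu w hw
    have huw : (u, w) ∈ D := hXD (mk_mem_prod hu hw)
    have h := hβγ u hu w hw 0 0 (h₁.nilOrder_pos hu) (h₂.nilOrder_pos hw)
    rw [partialDeriv_eq hD β 0 0 huw, partialDeriv_eq hD γ 0 0 huw] at h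
    simp only [Function.iterate_zero, id] at h
    rw [zeroExt_of_mem _ huw] at h ⊢
    rw [zeroExt_of_mem _ huw] at h
    simp [h]
  refine ⟨{(a, b)}, Finset.singleton_nonempty _, ?_, fun z hzP p q => ?_⟩
  · simpa using mk_mem_prod ha hb
  · obtain rfl := Finset.mem_singleton.1 hzP
    have hsum : EqOn (zeroExt β) (fun z => zeroExt (β - γ) z + zeroExt γ z) D := fun z hz => by
      simp [zeroExt_of_mem _ hz]
    have ht := taylorCoeff_congr hD hsum (p, q) hab
    rw [taylorCoeff_add hD hf (analyticOnNhd_zeroExt hD γ) _ hab, taylorCoeff,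
      taylorCoeff, taylorCoeff,
      iterate_dFst_dSnd_eq_zero_of_accPt hD hf hXD hz ha hb hacc₁ hacc₂ p q, zero_div, zero_add] at ht
    rw [partialDeriv_eq hD β p q hab, partialDeriv_eq hD γ p q hab]
    exact (div_left_inj' (mul_ne_zero (Nat.cast_ne_zero.2 (Nat.factorial_ne_zero _))
      (Nat.cast_ne_zero.2 (Nat.factorial_ne_zero _)))).1 ht

/-! ### The algebra of transformers -/

/-- `β ↦ T_β` as a homomorphism into the algebra of linear maps on `B(H)`. -/
def IsGrid.transformerEnd (hG : IsGrid X₁ X₂ D r π₁ π₂)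
    (h₁ : IsSpectralResolution X₁ E₁) (h₂ : IsSpectralResolution X₂ E₂) (hD : IsOpen D)
    (hXD : spectrum ℂ X₁ ×ˢ spectrum ℂ X₂ ⊆ D) : Holo D →ₐ[ℂ] Module.End ℂ (H →L[ℂ] H) where
  toRingHom := ContinuousLinearMap.toLinearMapRingHom.comp
    (hG.transformer h₁ h₂ hD hXD : Holo D →+* (H →L[ℂ] H) →L[ℂ] (H →L[ℂ] H))
  commutes' c := by
    have := (hG.transformer h₁ h₂ hD hXD).commutes c
    ext1 Y
    exact DFunLike.congr_fun this Y

theorem IsGrid.transformerEnd_apply (hG : IsGrid X₁ X₂ D r π₁ π₂)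
    (h₁ : IsSpectralResolution X₁ E₁) (h₂ : IsSpectralResolution X₂ E₂) (hD : IsOpen D)
    (hXD : spectrum ℂ X₁ ×ˢ spectrum ℂ X₂ ⊆ D) (β : Holo D) (Y : H →L[ℂ] H) :
    hG.transformerEnd h₁ h₂ hD hXD β Y = gdoi X₁ E₁ X₂ E₂ β Y :=
  (hG.gdoi_eq h₁ h₂ hD β Y).symm

theorem isCoeffFamily_coeff (β : Holo D) : IsCoeffFamily X₁ X₂ β (coeff β) :=
  fun _ _ _ _ _ _ => rfl

theorem IsGrid.hasCombination_iff (hG : IsGrid X₁ X₂ D r π₁ π₂)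
    (h₁ : IsSpectralResolution X₁ E₁) (h₂ : IsSpectralResolution X₂ E₂) (hD : IsOpen D)
    {β : Holo D} {c : ℕ → ℕ → ℂ → ℂ → ℂ} (hc : IsCoeffFamily X₁ X₂ β c) (Y S : H →L[ℂ] H) :
    HasCombination X₁ E₁ X₂ E₂ c Y S ↔ S = gdoi X₁ E₁ X₂ E₂ β Y := by
  rw [hG.gdoi_eq h₁ h₂ hD β Y]
  constructor
  · exact fun h => hasCombination_unique h (hG.hasCombination h₁ h₂ hD hc Y)
  · rintro rfl
    exact hG.hasCombination h₁ h₂ hD hc Y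

end

end GDOI

end

theorem mainTheorem2 {H : Type*} [NormedAddCommGroup H] [InnerProductSpace ℂ H] [CompleteSpace H]
    (X₁ X₂ : H →L[ℂ] H) (E₁ E₂ : Set ℂ → H →L[ℂ] H)
    (h₁ : GDOI.IsSpectralResolution X₁ E₁) (h₂ : GDOI.IsSpectralResolution X₂ E₂)
    (D : Set (ℂ × ℂ)) (hDopen : IsOpen D) (hDconn : IsConnected D)
    (hD : spectrum ℂ X₁ ×ˢ spectrum ℂ X₂ ⊆ D) :
    -- the defining integrals converge, to a unique limit
    (∀ (β : GDOI.Holo D) (Y S : H →L[ℂ] H),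
      GDOI.HasGDOI X₁ E₁ X₂ E₂ β Y S ↔ S = GDOI.gdoi X₁ E₁ X₂ E₂ β Y) ∧
    -- for every `Y`, the operators `T_β(Y)` are exactly the elements of `𝒮_{X₁,X₂,Y}(D)`
    (∀ Y : H →L[ℂ] H, Set.range (fun β : GDOI.Holo D => GDOI.gdoi X₁ E₁ X₂ E₂ β Y) =
      GDOI.operatorSet X₁ E₁ X₂ E₂ D Y) ∧
    -- `β ↦ T_β` is a linear (and multiplicative) isomorphism
    (GDOI.DerivativeAgreementCondition X₁ E₁ X₂ E₂ D →
      ∃ (A : Subalgebra ℂ (Module.End ℂ (H →L[ℂ] H))) (e : GDOI.Holo D ≃ₐ[ℂ] A),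
        (A : Set (Module.End ℂ (H →L[ℂ] H))) = GDOI.transformerSet X₁ E₁ X₂ E₂ D ∧
        ∀ (β : GDOI.Holo D) (Y : H →L[ℂ] H),
          (e β : Module.End ℂ (H →L[ℂ] H)) Y = GDOI.gdoi X₁ E₁ X₂ E₂ β Y) ∧
    -- the condition holds automatically for continuous (indeed, for infinite) spectra
    ((spectrum ℂ X₁).Infinite → (spectrum ℂ X₂).Infinite →
      GDOI.DerivativeAgreementCondition X₁ E₁ X₂ E₂ D) := by
  obtain ⟨r, π₁, π₂, hG⟩ := GDOI.exists_isGrid X₁ X₂ hDopen hD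
  refine ⟨fun β Y S => hG.hasCombination_iff h₁ h₂ hDopen (GDOI.isCoeffFamily_coeff β) Y S,
    fun Y => ?_, fun hA => ?_,
    GDOI.derivativeAgreementCondition_of_infinite h₁ h₂ hDopen hD⟩
  · ext S
    constructor
    · rintro ⟨β, rfl⟩
      exact ⟨_, ⟨β, GDOI.isCoeffFamily_coeff β⟩,
        (hG.hasCombination_iff h₁ h₂ hDopen (GDOI.isCoeffFamily_coeff β) Y _).2 rfl⟩
    · rintro ⟨c, ⟨β, hc⟩, hS⟩
      exact ⟨β, ((hG.hasCombination_iff h₁ h₂ hDopen hc Y S).1 hS).symm⟩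
  · have hinj : Function.Injective (hG.transformerEnd h₁ h₂ hDopen hD) := by
      refine (injective_iff_map_eq_zero _).2 fun β hβ => ?_
      have h0 : ∀ Y, GDOI.gdoi X₁ E₁ X₂ E₂ β Y = 0 := fun Y => by
        rw [← hG.transformerEnd_apply h₁ h₂ hDopen hD, hβ]
        rfl
      obtain ⟨P, ⟨z, hz⟩, hP, hall⟩ := hA β 0 fun a ha b hb p q hp hq => by
        rw [GDOI.partialDeriv_zero,
          GDOI.partialDeriv_eq_zero_of_gdoi_eq_zero h₁ h₂ hDopen hD h0 ha hb hp hq]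
      exact GDOI.eq_zero_of_partialDeriv_eq_zero hDopen hDconn.isPreconnected (hD (hP hz))
        fun p q => by rw [hall z hz, GDOI.partialDeriv_zero]
    refine ⟨(hG.transformerEnd h₁ h₂ hDopen hD).range, AlgEquiv.ofInjective _ hinj, ?_, fun β Y => ?_⟩
    · ext Φ
      constructor
      · rintro ⟨β, rfl⟩
        exact ⟨_, ⟨β, GDOI.isCoeffFamily_coeff β⟩, fun Y =>
          (hG.hasCombination_iff h₁ h₂ hDopen (GDOI.isCoeffFamily_coeff β) Y _).2
            (hG.transformerEnd_apply h₁ h₂ hDopen hD β Y)⟩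
      · rintro ⟨c, ⟨β, hc⟩, hΦ⟩
        refine ⟨β, LinearMap.ext fun Y => ?_⟩
        rw [(hG.hasCombination_iff h₁ h₂ hDopen hc Y _).1 (hΦ Y)]
        exact hG.transformerEnd_apply h₁ h₂ hDopen hD β Y
    · exact hG.transformerEnd_apply h₁ h₂ hDopen hD β Y
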